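/- \textbf{Corollary.} Consider an anonymous synchronous quantum network: $n \ge 1$ parties are the nodes of a connected simple undirected graph $G=(V,E)$ of maximum degree $D$, with an arbitrary port numbering (each party $l$ of degree $d_l$ labels its incident links bijectively by $1,\dots,d_l$, independently of the others). Links carry qubits and classical bits in both directions, and all parties run the same program. A party is given only its own degree $d$, a classical variable $\mathsf{status}$ initialized to "eligible", and an integer $N \ge n$ (an upper bound on the number of parties). Each party runs \emph{Algorithm I} with parameter $N$, which is the following. For $k = N, N-1, \dots, 2$: (a) Prepare a qubit $\mathbf R_0$ in state $(|0\rangle+|1\rangle)/\sqrt2$ if eligible and $|0\rangle$ otherwise, and a qubit $\mathbf S$ in the state "consistent". (b) (Subroutine A) On two-qubit registers with contents in $\{0,1,\ast,\times\}$, let $x$ be a copy of $\mathbf R_0$ if eligible, and $x=\ast$ otherwise. For $N-1$ rounds, coherently send a copy of the current value to every neighbour, and compute the next value by combining the own value and those received with the commutative associative idempotent operation $\circ$ for which $\ast$ is neutral, $0\circ1=\times$, and $\times$ is absorbing. Then flip $\mathbf S$ to "inconsistent" if the final value is $\times$, and undo all the other computation and communication. (c) Measure $\mathbf S$. If the result is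 "consistent", each eligible party prepares a qubit $\mathbf R_1$ in $|0\rangle$ and then (Subroutine B) applies $U_k$ to $\mathbf R_0$ if $k$ is even, and, if $k$ is odd, applies a CNOT from $\mathbf R_0$ to $\mathbf R_1$ followed by $V_k$ on $(\mathbf R_0,\mathbf R_1)$. If the result is "inconsistent", just prepare $\mathbf R_1$ in $|0\rangle$. Here, with $\omega=e^{i\pi/k}$, $R_k=\cos(\pi/k)$ and $I_k=\sin(\pi/k)$, in the computational basis, $$U_k=\frac1{\sqrt2}\begin{pmatrix}1&\omega^{-1}\\-\omega&1\end{pmatrix},\qquad V_k=\frac1{\sqrt{R_k+1}}\begin{pmatrix}\frac1{\sqrt2}&0&\sqrt{R_k}&\frac{\omega}{\sqrt2}\\ \frac1{\sqrt2}&0&-\sqrt{R_k}\,\omega^{-1}&\frac{\omega^{-1}}{\sqrt2}\\ \sqrt{R_k}&0&\frac{e^{-i\pi/(2k)}I_k}{i\sqrt2R_{2k}}&-\sqrt{R_k}\\0&\sqrt{R_k+1}&0&0\end{pmatrix}.$$ (d) Each eligible party measures $\mathbf R_0,\mathbf R_1$ in the computational basis to get a two-bit integer $z$ (with $\mathbf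 R_0$ as its high bit); each ineligible party sets $z=-1$. (e) (Subroutine C) In $N-1$ rounds of sending the current maximum to all neighbours, compute the maximum $z_{\max}$ of $z$ over all parties. A party with $z\ne z_{\max}$ becomes ineligible. At the end each party outputs $\mathsf{status}$. Then, with probability $1$, at the end exactly one party is eligible and all the others are ineligible. Moreover there is an absolute constant $C$ (independent of $n$, $N$, $G$ and the port numbering) such that every execution of positive probability has \begin{itemize} \item at most $CN^2$ rounds; \item at most $C\max(D,1)N^2$ steps of each party, including local computation (so $O(DN^2)$ time whenever $n\ge2$); \item for each party with $d$ neighbours, at most $CdN^2$ qubits sent or received by it; \item at most $C|E|N^2$ qubits and classical bits sent in total over all parties. \end{itemize} -/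

import Mathlib

noncomputable section

namespace QLE

/-! ### The gates of Subroutine B -/

/-- `e^{iπ/k}`. -/
def om (k : ℤ) : ℂ := Complex.exp (Complex.I * ((Real.pi : ℂ) / (k : ℂ)))

/-- `R_k`, the real part of `e^{iπ/k}`. -/
def Rk (k : ℤ) : ℝ := (om k).re

/-- `I_k`, the imaginary part of `e^{iπ/k}`. -/
def Ik (k : ℤ) : ℝ := (om k).im

/-- The Hadamard matrix, which sends `|0⟩` to `(|0⟩ + |1⟩)/√2`. -/
def hadMat : Matrix (Fin 2) (Fin 2) ℂ :=
  ((1 / Real.sqrt 2 : ℝ) : ℂ) • !![1, 1; 1, -1]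

/-- The matrix `U_k`. -/
def UMat (k : ℤ) : Matrix (Fin 2) (Fin 2) ℂ :=
  ((1 / Real.sqrt 2 : ℝ) : ℂ) • !![1, (om k)⁻¹; -om k, 1]

/-- The matrix `V_k`, rows and columns in the order `00, 01, 10, 11`. -/
def VMat (k : ℤ) : Matrix (Fin 4) (Fin 4) ℂ :=
  ((1 / Real.sqrt (Rk k + 1) : ℝ) : ℂ) •
    !![((1 / Real.sqrt 2 : ℝ) : ℂ), 0, (Real.sqrt (Rk k) : ℂ), om k / (Real.sqrt 2 : ℂ);
       ((1 / Real.sqrt 2 : ℝ) : ℂ), 0, -(Real.sqrt (Rk k) : ℂ) * (om k)⁻¹,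
         (om k)⁻¹ / (Real.sqrt 2 : ℂ);
       (Real.sqrt (Rk k) : ℂ), 0,
         (om (2 * k))⁻¹ * (Ik k : ℂ) / (Complex.I * (Real.sqrt 2 : ℂ) * (Rk (2 * k) : ℂ)),
         -(Real.sqrt (Rk k) : ℂ);
       0, (Real.sqrt (Rk k + 1) : ℂ), 0, 0]

lemma om_eq (k : ℤ) : om k = ⟨Real.cos (Real.pi / k), Real.sin (Real.pi / k)⟩ := by
  have h : Complex.I * ((Real.pi : ℂ) / (k : ℂ)) = ((Real.pi / k : ℝ) : ℂ) * Complex.I := by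
    push_cast; ring
  rw [om, h]
  apply Complex.ext
  · exact Complex.exp_ofReal_mul_I_re _
  · exact Complex.exp_ofReal_mul_I_im _

lemma om_inv (k : ℤ) : (om k)⁻¹ = ⟨Real.cos (Real.pi / k), -Real.sin (Real.pi / k)⟩ := by
  have h : Complex.normSq (om k) = 1 := by
    rw [om_eq, Complex.normSq_mk]
    nlinarith [Real.sin_sq_add_cos_sq (Real.pi / k)]
  rw [Complex.inv_def, h, om_eq]
  simp [Complex.ext_iff]

lemma hadMat_mem : hadMat ∈ Matrix.unitaryGroup (Fin 2) ℂ := by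
  rw [Matrix.mem_unitaryGroup_iff']
  have h2 : (Real.sqrt 2)⁻¹ * (Real.sqrt 2)⁻¹ = 1 / 2 := by
    rw [← mul_inv, Real.mul_self_sqrt (by norm_num)]; norm_num
  ext i j
  fin_cases i <;> fin_cases j <;>
    simp [hadMat, Matrix.mul_apply, Fin.sum_univ_two, Complex.ext_iff, Matrix.star_apply] <;>
    grind

lemma UMat_mem (k : ℤ) : UMat k ∈ Matrix.unitaryGroup (Fin 2) ℂ := by
  rw [Matrix.mem_unitaryGroup_iff']
  have h2 : (Real.sqrt 2)⁻¹ ^ 2 = 1 / 2 := by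
    rw [inv_pow, Real.sq_sqrt (by norm_num)]; norm_num
  have hs := Real.sin_sq_add_cos_sq (Real.pi / k)
  ext i j
  fin_cases i <;> fin_cases j <;>
    simp [UMat, Matrix.mul_apply, Fin.sum_univ_two, Complex.ext_iff, Matrix.star_apply,
      om_eq] <;>
    constructor <;> grind

lemma VMat_mem (k : ℤ) (hk : 3 ≤ k) : VMat k ∈ Matrix.unitaryGroup (Fin 4) ℂ := by
  rw [Matrix.mem_unitaryGroup_iff']
  have hk0 : (0 : ℝ) < k := by exact_mod_cast (by omega : (0 : ℤ) < k)
  have hk3 : (3 : ℝ) ≤ k := by exact_mod_cast hk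
  obtain ⟨a, ha⟩ : ∃ a, a = Real.pi / ((2 * k : ℤ) : ℝ) := ⟨_, rfl⟩
  have ha2 : Real.pi / (k : ℝ) = 2 * a := by rw [ha]; push_cast; field_simp
  have hpi := Real.pi_pos
  have ha0 : 0 < a := by rw [ha]; push_cast; positivity
  have ha4 : 2 * a < Real.pi / 2 := by
    rw [← ha2, div_lt_div_iff₀ hk0 (by norm_num)]; nlinarith
  have hc : 0 < Real.cos a := Real.cos_pos_of_mem_Ioo ⟨by linarith, by linarith⟩
  have hR : 0 < Real.cos (2 * a) := Real.cos_pos_of_mem_Ioo ⟨by linarith, by linarith⟩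
  have hs := Real.sin_sq_add_cos_sq a
  have hsin := Real.sin_two_mul a
  have hcos := Real.cos_two_mul a
  have hw : Real.sqrt (Real.cos (2 * a) + 1) = Real.sqrt 2 * Real.cos a := by
    rw [hcos, show 2 * Real.cos a ^ 2 - 1 + 1 = 2 * Real.cos a ^ 2 by ring,
      Real.sqrt_mul (by norm_num), Real.sqrt_sq hc.le]
  have hr := Real.sq_sqrt hR.le
  have h2 := Real.sq_sqrt (show (0 : ℝ) ≤ 2 by norm_num)
  have h2p : 0 < Real.sqrt 2 := by positivity
  have e1 : om k = ⟨Real.cos (2 * a), Real.sin (2 * a)⟩ := by rw [om_eq, ha2]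
  have e2 : (om k)⁻¹ = ⟨Real.cos (2 * a), -Real.sin (2 * a)⟩ := by rw [om_inv, ha2]
  have e3 : (om (2 * k))⁻¹ * (Ik k : ℂ) /
      (Complex.I * (Real.sqrt 2 : ℂ) * (Rk (2 * k) : ℂ)) =
      ⟨-(Real.sqrt 2 * Real.sin a ^ 2), -(Real.sqrt 2 * Real.sin a * Real.cos a)⟩ := by
    have hcC : (Real.cos a : ℂ) ≠ 0 := by exact_mod_cast hc.ne'
    have h2C : (Real.sqrt 2 : ℂ) ≠ 0 := by exact_mod_cast h2p.ne'
    rw [om_inv, Ik, e1, Rk, om_eq, ← ha]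
    rw [div_eq_iff (mul_ne_zero (mul_ne_zero Complex.I_ne_zero h2C) hcC)]
    dsimp only
    rw [hsin]
    generalize Real.cos a = c at *
    generalize Real.sin a = s at *
    generalize Real.sqrt 2 = w at *
    apply Complex.ext
    · simp; grind
    · simp; grind
  have e4 : Rk k = Real.cos (2 * a) := by rw [Rk, e1]
  have h2i : (Real.sqrt 2)⁻¹ * Real.sqrt 2 = 1 := inv_mul_cancel₀ h2p.ne'
  have hci : (Real.cos a)⁻¹ * Real.cos a = 1 := inv_mul_cancel₀ hc.ne'
  rw [VMat, e3, e2, e1, e4, hw]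
  generalize Real.sqrt (Real.cos (2 * a)) = r at *
  rw [hcos] at hr
  rw [hsin, hcos]
  generalize Real.cos a = c at *
  generalize Real.sin a = s at *
  generalize Real.sqrt 2 = w at *
  ext i j
  fin_cases i <;> fin_cases j <;>
    simp [Matrix.mul_apply, Fin.sum_univ_four, Complex.ext_iff, Matrix.star_apply, div_eq_mul_inv]
  all_goals try constructor
  all_goals grind
/-- Hadamard gate. -/
def hadamard : Matrix.unitaryGroup (Fin 2) ℂ := ⟨hadMat, hadMat_mem⟩

/-- The gate `U_k`. -/
def Ugate (k : ℤ) : Matrix.unitaryGroup (Fin 2) ℂ := ⟨UMat k, UMat_mem k⟩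

/-- The gate `V_k`; it is used for odd `k ≥ 3` only (`V_k` is not defined for `k = 1`). -/
def Vgate (k : ℤ) : Matrix.unitaryGroup (Fin 4) ℂ :=
  if h : 3 ≤ k then ⟨VMat k, VMat_mem k h⟩ else 1

/-! ### Programs for anonymous synchronous quantum networks

All parties execute one and the same finite program text.  A program is a skeleton of `for` loops
whose bounds depend only on the common input `N`, filled with local code and synchronous exchanges
of messages.  So all parties are always at the same place of the skeleton, and the loop counters
of the skeleton are equal at all parties. -/

/-- Variables with the same value at all parties: the common input `N` and the loop counters of
the skeleton. -/
inductive PVar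
  | N | k | t
  deriving DecidableEq

/-- Classical integer variables in the private memory of a party.  `d` holds the number of ports.
`status` is `1` for eligible and `0` for ineligible. -/
inductive CVar
  | status | d | i | s | b0 | b1 | z | zmax | y
  deriving DecidableEq

/-- Names of quantum registers. -/
inductive QName
  | R0 | R1 | S | X | A
  deriving DecidableEq

/-- The name of a qubit inside one party: bit `bit` of the register `name[row][col]`.  One-qubit
registers are `name[0][0]` with `bit = false`.  In the two-qubit registers `X[t][i]` and `A[t][i]`
`bit = true` is the high bit and `bit = false` is the low bit. -/
structure Qubit where
  name : QName
  row : ℤ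
  col : ℤ
  bit : Bool
  deriving DecidableEq

/-- Integer expressions over variables in `α`. -/
inductive Expr (α : Type)
  | lit (a : ℤ)
  | var (x : α)
  | add (e f : Expr α)
  | sub (e f : Expr α)
  | max (e f : Expr α)

def Expr.eval {α : Type} (m : α → ℤ) : Expr α → ℤ
  | .lit a => a
  | .var x => m x
  | .add e f => e.eval m + f.eval m
  | .sub e f => e.eval m - f.eval m
  | .max e f => Max.max (e.eval m) (f.eval m)

/-- Expressions that a party can evaluate: they read the common counters and its own memory. -/
abbrev LExpr := Expr (PVar ⊕ CVar)

/-- Tests: equality of two integers, and evenness. -/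
inductive Cond
  | eq (e f : LExpr)
  | even (e : LExpr)

/-- A qubit whose indices are given by expressions. -/
structure QRef where
  name : QName
  row : LExpr
  col : LExpr
  bit : Bool

/-- Local code of a party.
* `prep q` resets the qubit `q` to `|0⟩`;
* `xor f ctrl q` is the reversible gate `|x⟩|b⟩ ↦ |x⟩|b ⊕ f(x)⟩` with control qubits `ctrl` and
  target qubit `q`;
* `gate1 U e q`, `gate2 U e q₀ q₁` apply the unitary `U e` to one qubit, to two qubits;
* `measure q x` measures `q` in the computational basis and stores the outcome in `x`;
* `recv x e` reads into `x` the classical message that lies at port `e`;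
* `forUp x lo hi c` is a loop with counter `x = lo, lo + 1, …, hi`, and `forDown x hi lo c` one with
  counter `x = hi, hi - 1, …, lo` (no iteration if `hi < lo`). -/
inductive Cmd
  | skip
  | assign (x : CVar) (e : LExpr)
  | recv (x : CVar) (port : LExpr)
  | prep (q : QRef)
  | xor {m : ℕ} (f : (Fin m → Bool) → Bool) (ctrl : Fin m → QRef) (q : QRef)
  | gate1 (U : ℤ → Matrix.unitaryGroup (Fin 2) ℂ) (e : LExpr) (q : QRef)
  | gate2 (U : ℤ → Matrix.unitaryGroup (Fin 4) ℂ) (e : LExpr) (q₀ q₁ : QRef)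
  | measure (q : QRef) (x : CVar)
  | seq (c₁ c₂ : Cmd)
  | ite (b : Cond) (c₁ c₂ : Cmd)
  | forUp (x : CVar) (lo hi : LExpr) (c : Cmd)
  | forDown (x : CVar) (hi lo : LExpr) (c : Cmd)

/-- Programs.
* `loc c`: every party executes the local code `c`;
* `exchQ a e`: one round, in which every party exchanges, for each of its ports `i`, its two-qubit
  register `a[e][i]` with the neighbour connected via port `i`;
* `exchC x`: one round, in which every party sends the value of `x` via each of its ports. -/
inductive Prog
  | loc (c : Cmd)
  | exchQ (a : QName) (row : Expr PVar)
  | exchC (x : CVar)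
  | seq (p₁ p₂ : Prog)
  | forUp (x : PVar) (lo hi : Expr PVar) (p : Prog)
  | forDown (x : PVar) (hi lo : Expr PVar) (p : Prog)

/-! ### Networks and their states -/

/-- A port numbering: each party numbers its incident links bijectively (port number minus one is
an element of `Fin (degree)`), independently of the other parties. -/
abbrev PortNumbering {n : ℕ} (G : SimpleGraph (Fin n)) [DecidableRel G.Adj] :=
  ∀ v : Fin n, G.neighborSet v ≃ Fin (G.degree v)

section Semantics

variable {n : ℕ} (G : SimpleGraph (Fin n)) [DecidableRel G.Adj] (σ : PortNumbering G)

/-- The other end of the link at port `i` (`1 ≤ i ≤ degree`) of party `v`: the neighbour `u` there,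
and the port of `u` that belongs to the same link. -/
def remote (v : Fin n) (i : ℤ) : Option (Fin n × ℤ) :=
  if h : 1 ≤ i ∧ i ≤ G.degree v then
    let u : G.neighborSet v := (σ v).symm ⟨(i - 1).toNat, by omega⟩
    some (u.1, ((σ u.1 ⟨v, SimpleGraph.Adj.symm u.2⟩ : ℕ) : ℤ) + 1)
  else none

/-- A computational basis state of all qubits of all parties. -/
abbrev Conf (n : ℕ) := Fin n → Qubit → Bool

/-- State of the network in one branch of the measurement outcomes.  `ψ` is the joint quantum state,
not normalized: its squared norm is the probability of the branch.  The other fields are the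
classical memories, the classical messages that lie at the ports, and the counters: local steps,
qubits sent, qubits received and classical bits sent by each party, and rounds. -/
structure State (n : ℕ) where
  ψ : Conf n →₀ ℂ
  mem : Fin n → CVar → ℤ
  inbox : Fin n → ℤ → ℤ
  steps : Fin n → ℕ
  qsent : Fin n → ℕ
  qrecv : Fin n → ℕ
  csent : Fin n → ℕ
  rounds : ℕ

/-- Squared norm. -/
def normSq {n : ℕ} (ψ : Conf n →₀ ℂ) : ℝ := ψ.sum fun _ a => ‖a‖ ^ 2

/-- Change one qubit of a basis state. -/
def Conf.set {n : ℕ} (c : Conf n) (v : Fin n) (q : Qubit) (b : Bool) : Conf n :=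
  Function.update c v (Function.update (c v) q b)

def idx1 (b : Bool) : Fin 2 := if b then 1 else 0

def idx2 (b₀ b₁ : Bool) : Fin 4 :=
  match b₀, b₁ with
  | false, false => 0
  | false, true => 1
  | true, false => 2
  | true, true => 3

/-- One-qubit gate on qubit `q` of party `v`. -/
def applyGate1 {n : ℕ} (U : Matrix (Fin 2) (Fin 2) ℂ) (v : Fin n) (q : Qubit)
    (ψ : Conf n →₀ ℂ) : Conf n →₀ ℂ :=
  ψ.sum fun c a => ∑ b : Bool,
    Finsupp.single (c.set v q b) (U (idx1 b) (idx1 (c v q)) * a)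

/-- Two-qubit gate on the (distinct) qubits `q₀, q₁` of party `v`. -/
def applyGate2 {n : ℕ} (U : Matrix (Fin 4) (Fin 4) ℂ) (v : Fin n) (q₀ q₁ : Qubit)
    (ψ : Conf n →₀ ℂ) : Conf n →₀ ℂ :=
  ψ.sum fun c a => ∑ b₀ : Bool, ∑ b₁ : Bool,
    Finsupp.single ((c.set v q₀ b₀).set v q₁ b₁)
      (U (idx2 b₀ b₁) (idx2 (c v q₀) (c v q₁)) * a)

/-- Projection onto the basis states in which qubit `q` of party `v` is `b`. -/
def project {n : ℕ} (v : Fin n) (q : Qubit) (b : Bool) (ψ : Conf n →₀ ℂ) : Conf n →₀ ℂ :=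
  ψ.filter fun c => c v q = b

/-- Values of the variables that party `v` can read. -/
def State.look {n : ℕ} (s : State n) (env : PVar → ℤ) (v : Fin n) : PVar ⊕ CVar → ℤ :=
  Sum.elim env (s.mem v)

def QRef.eval (m : PVar ⊕ CVar → ℤ) (q : QRef) : Qubit :=
  ⟨q.name, q.row.eval m, q.col.eval m, q.bit⟩

def Cond.holds (m : PVar ⊕ CVar → ℤ) : Cond → Prop
  | .eq e f => e.eval m = f.eval m
  | .even e => Even (e.eval m)

/-- Assignment to a variable of party `v`. -/
def State.setVar {n : ℕ} (s : State n) (v : Fin n) (x : CVar) (a : ℤ) : State n :=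
  { s with mem := Function.update s.mem v (Function.update (s.mem v) x a) }

/-- Charge one step to party `v`. -/
def State.tick {n : ℕ} (s : State n) (v : Fin n) : State n :=
  { s with steps := Function.update s.steps v (s.steps v + 1) }

/-- Charge one step to every party. -/
def State.tickAll {n : ℕ} (s : State n) : State n :=
  { s with steps := fun v => s.steps v + 1 }

/-- Run a branching process successively for all the elements of a list. -/
def branchFold {α β : Type} (f : α → β → List β) : List α → β → List β
  | [], s => [s]
  | a :: l, s => (f a s).flatMap (branchFold f l)

open scoped Classical in
/-- Execution of local code by party `v`: the list of the branches.  Every command costs one step,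
and so does every entry into a loop and every iteration.  (A program is a finite text that does not
depend on the network or on `N`, so its expressions have bounded size and its gates act on a bounded
number of qubits.)  A gate with a repeated qubit has no effect. -/
def Cmd.exec {n : ℕ} (env : PVar → ℤ) (v : Fin n) : Cmd → State n → List (State n)
  | .skip, s => [s]
  | .assign x e, s => [(s.setVar v x (e.eval (s.look env v))).tick v]
  | .recv x e, s => [(s.setVar v x (s.inbox v (e.eval (s.look env v)))).tick v]
  | .prep q, s =>
      let q' := q.eval (s.look env v)
      [{ s.tick v with ψ := project v q' false s.ψ },
       { s.tick v with ψ := (project v q' true s.ψ).mapDomain fun c => c.set v q' false }]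
  | .xor f ctrl q, s =>
      let ctrl' := fun j => (ctrl j).eval (s.look env v)
      let q' := q.eval (s.look env v)
      [if ∃ j, ctrl' j = q' then s.tick v else
        { s.tick v with
          ψ := s.ψ.mapDomain fun c => c.set v q' (c v q' ^^ f fun j => c v (ctrl' j)) }]
  | .gate1 U e q, s =>
      let m := s.look env v
      [{ s.tick v with ψ := applyGate1 (U (e.eval m)).1 v (q.eval m) s.ψ }]
  | .gate2 U e q₀ q₁, s =>
      let m := s.look env v
      [if q₀.eval m = q₁.eval m then s.tick v else
        { s.tick v with ψ := applyGate2 (U (e.eval m)).1 v (q₀.eval m) (q₁.eval m) s.ψ }]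
  | .measure q x, s =>
      let q' := q.eval (s.look env v)
      [{ (s.setVar v x 0).tick v with ψ := project v q' false s.ψ },
       { (s.setVar v x 1).tick v with ψ := project v q' true s.ψ }]
  | .seq c₁ c₂, s => (c₁.exec env v s).flatMap (c₂.exec env v)
  | .ite b c₁ c₂, s =>
      if b.holds (s.look env v) then c₁.exec env v (s.tick v) else c₂.exec env v (s.tick v)
  | .forUp x lo hi c, s =>
      let a := lo.eval (s.look env v)
      let b := hi.eval (s.look env v)
      branchFold (fun (j : ℕ) s' => c.exec env v ((s'.setVar v x (a + j)).tick v))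
        (List.range (b - a + 1).toNat) (s.tick v)
  | .forDown x hi lo c, s =>
      let a := lo.eval (s.look env v)
      let b := hi.eval (s.look env v)
      branchFold (fun (j : ℕ) s' => c.exec env v ((s'.setVar v x (b - j)).tick v))
        (List.range (b - a + 1).toNat) (s.tick v)

/-- The basis state after all parties have exchanged the registers `a[r][1], a[r][2], …` with the
neighbours connected via the ports `1, 2, …`. -/
def exchConf (a : QName) (r : ℤ) (c : Conf n) : Conf n := fun v q =>
  if q.name = a ∧ q.row = r then
    match remote G σ v q.col with
    | some (u, j) => c u { q with col := j }
    | none => c v q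
  else c v q

/-- Number of bits (sign bit and binary digits) of an integer message. -/
def bitLen (a : ℤ) : ℕ := a.natAbs.size + 1

/-- Execution of a program by all the parties.  Local code of distinct parties acts on distinct
parts of the network, so the order in which the parties are listed is immaterial.  Loop control is
charged to every party, and in a round each party is charged one step, and one more for each of its
ports. -/
def Prog.run : Prog → (PVar → ℤ) → State n → List (State n)
  | .loc c, env, s => branchFold (fun v => c.exec env v) (List.finRange n) s
  | .exchQ a e, env, s =>
      [{ s with
          ψ := s.ψ.mapDomain (exchConf G σ a (e.eval env))
          steps := fun v => s.steps v + G.degree v + 1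
          qsent := fun v => s.qsent v + 2 * G.degree v
          qrecv := fun v => s.qrecv v + 2 * G.degree v
          rounds := s.rounds + 1 }]
  | .exchC x, _, s =>
      [{ s with
          inbox := fun v i =>
            match remote G σ v i with
            | some (u, _) => s.mem u x
            | none => 0
          steps := fun v => s.steps v + G.degree v + 1
          csent := fun v => s.csent v + G.degree v * bitLen (s.mem v x)
          rounds := s.rounds + 1 }]
  | .seq p₁ p₂, env, s => (p₁.run env s).flatMap (p₂.run env)
  | .forUp x lo hi p, env, s =>
      let a := lo.eval env
      let b := hi.eval env
      branchFold (fun (j : ℕ) s' => p.run (Function.update env x (a + j)) s'.tickAll)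
        (List.range (b - a + 1).toNat) s.tickAll
  | .forDown x hi lo p, env, s =>
      let a := lo.eval env
      let b := hi.eval env
      branchFold (fun (j : ℕ) s' => p.run (Function.update env x (b - j)) s'.tickAll)
        (List.range (b - a + 1).toNat) s.tickAll

/-- The initial state: all qubits are `|0⟩`, every party is eligible and knows its number of ports,
and nothing else distinguishes the parties. -/
def initState : State n where
  ψ := Finsupp.single (fun _ _ => false) 1
  mem := fun v x =>
    match x with
    | .status => 1
    | .d => G.degree v
    | _ => 0
  inbox := fun _ _ => 0
  steps := fun _ => 0
  qsent := fun _ => 0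
  qrecv := fun _ => 0
  csent := fun _ => 0
  rounds := 0

/-- The branches at the end of the execution of `p` with common input `N`. -/
def Prog.outcomes (p : Prog) (N : ℕ) : List (State n) :=
  p.run G σ (fun x => match x with | .N => (N : ℤ) | _ => 0) (initState G)

end Semantics

/-- Exactly one party has `status = 1` (eligible), all the others have `status = 0`. -/
def UniqueLeader {n : ℕ} (s : State n) : Prop :=
  ∃ l, s.mem l .status = 1 ∧ ∀ v, v ≠ l → s.mem v .status = 0

open scoped Classical in
/-- Probability of the event `P` over the final branches. -/
def prob {n : ℕ} (L : List (State n)) (P : State n → Prop) : ℝ :=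
  (L.map fun s => if P s then normSq s.ψ else 0).sum

/-! ### Algorithm I -/

/-- The set `{0, 1, ∗, ×}`. -/
inductive Sym
  | zero | one | star | cross

/-- The operator `∘`. -/
def Sym.circ : Sym → Sym → Sym
  | .star, y => y
  | x, .star => x
  | .zero, .zero => .zero
  | .one, .one => .one
  | _, _ => .cross

/-- The symbol with given high and low bit: `0 = 00`, `1 = 01`, `∗ = 10`, `× = 11`. -/
def Sym.ofBits : Bool → Bool → Sym
  | false, false => .zero
  | false, true => .one
  | true, false => .star
  | true, true => .cross

def Sym.bits : Sym → Bool → Bool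
  | .zero, _ => false
  | .one, hi => !hi
  | .star, hi => hi
  | .cross, _ => true

namespace AlgI

def pv (x : PVar) : LExpr := .var (.inl x)
def cv (x : CVar) : LExpr := .var (.inr x)
def num (a : ℤ) : LExpr := .lit a

def R0 : QRef := ⟨.R0, num 0, num 0, false⟩
def R1 : QRef := ⟨.R1, num 0, num 0, false⟩
def S : QRef := ⟨.S, num 0, num 0, false⟩
def X (t i : LExpr) (b : Bool) : QRef := ⟨.X, t, i, b⟩
def A (t i : LExpr) (b : Bool) : QRef := ⟨.A, t, i, b⟩

/-- `|x⟩|b⟩ ↦ |x⟩|b ⊕ x⟩`; this copies `x` if `b = 0`. -/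
def cnot (x q : QRef) : Cmd := .xor (m := 1) (fun b => b 0) (fun _ => x) q

def flip (q : QRef) : Cmd := .xor (m := 0) (fun _ => true) Fin.elim0 q

/-- `|x⟩|y⟩ ↦ |x⟩|y ⊕ x⟩` for two-qubit registers. -/
def copy2 (x q : Bool → QRef) : Cmd := .seq (cnot (x true) (q true)) (cnot (x false) (q false))

def prep2 (q : Bool → QRef) : Cmd := .seq (.prep (q true)) (.prep (q false))

/-- `|x⟩|y⟩|w⟩ ↦ |x⟩|y⟩|w ⊕ (x ∘ y)⟩` for two-qubit registers. -/
def circ2 (x y w : Bool → QRef) : Cmd :=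
  let g (hi : Bool) : Cmd := .xor (m := 4)
    (fun b => ((Sym.ofBits (b 0) (b 1)).circ (Sym.ofBits (b 2) (b 3))).bits hi)
    ![x true, x false, y true, y false] (w hi)
  .seq (g true) (g false)

def eligible : Cond := .eq (cv .status) (num 1)

def ePlus1 (e : LExpr) : LExpr := .add e (num 1)
def eMinus1 (e : LExpr) : LExpr := .sub e (num 1)
/-- `N - 1` -/
def pN1 : Expr PVar := .sub (.var .N) (.lit 1)

def tt : LExpr := pv .t
def ii : LExpr := cv .i
def dd : LExpr := cv .d

/-- Beginning of Subroutine A: prepare the registers `X[t][i]`, and the work registers `A[t][i]`,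
which will hold the partial results of `x₀ ∘ x₁ ∘ ⋯ ∘ x_d`. -/
def subAprep : Prog :=
  .seq (.forUp .t (.lit 1) pN1 (.loc
      (.forUp .i (num 0) dd (.seq (prep2 (X tt ii)) (prep2 (A tt ii))))))
    (.loc (prep2 (X (pv .N) (num 0))))

/-- Copy `R0` to `X[1][0]`, or set `X[1][0]` to `∗`; this is its own inverse. -/
def subAinit : Cmd :=
  .ite eligible (cnot R0 (X (num 1) (num 0) false)) (flip (X (num 1) (num 0) true))

/-- Copy `X[t][0]` to `X[t][1], …, X[t][d]`. -/
def copyOut : Cmd := .forUp .i (num 1) dd (copy2 (X tt (num 0)) (X tt ii))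

/-- Compute `X[t+1][0] = x₀ ∘ x₁ ∘ ⋯ ∘ x_d` from left to right. -/
def collect : Cmd :=
  .seq (copy2 (X tt (num 0)) (A tt (num 0)))
    (.seq (.forUp .i (num 1) dd (circ2 (A tt (eMinus1 ii)) (X tt ii) (A tt ii)))
      (copy2 (A tt dd) (X (ePlus1 tt) (num 0))))

/-- The inverse of `copyOut`: the gates are involutions. -/
def copyOutInv : Cmd := .forDown .i dd (num 1) (copy2 (X tt (num 0)) (X tt ii))

/-- The inverse of `collect`. -/
def collectInv : Cmd :=
  .seq (copy2 (A tt dd) (X (ePlus1 tt) (num 0)))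
    (.seq (.forDown .i dd (num 1) (circ2 (A tt (eMinus1 ii)) (X tt ii) (A tt ii)))
      (copy2 (X tt (num 0)) (A tt (num 0))))

/-- If the content of `X[N][0]` is `×`, turn over `S`. -/
def flipIfCross : Cmd :=
  .xor (m := 2) (fun b => b 0 && b 1) ![X (pv .N) (num 0) true, X (pv .N) (num 0) false] S

/-- Subroutine A: the last loop and the last command invert the computation and communication of
the first ones, which erases the contents of the work registers. -/
def subA : Prog :=
  .seq subAprep
  (.seq (.loc subAinit)
  (.seq (.forUp .t (.lit 1) pN1
    (.seq (.loc copyOut) (.seq (.exchQ .X (.var .t)) (.loc collect))))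
  (.seq (.loc flipIfCross)
  (.seq (.forDown .t pN1 (.lit 1)
    (.seq (.loc collectInv) (.seq (.exchQ .X (.var .t)) (.loc copyOutInv))))
  (.loc subAinit)))))

/-- Subroutine B: it turns a cat state of `k` parties into an inconsistent state. -/
def subB : Cmd :=
  .ite (.even (pv .k)) (.gate1 Ugate (pv .k) R0)
    (.seq (cnot R0 R1) (.gate2 Vgate (pv .k) R0 R1))

/-- Subroutine C: the maximum of `z` over all parties is computed in `zmax`. -/
def subC : Prog :=
  .seq (.loc (.assign .zmax (cv .z)))
    (.forUp .t (.lit 1) pN1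
      (.seq (.exchC .zmax)
        (.loc (.forUp .i (num 1) dd
          (.seq (.recv .y ii) (.assign .zmax (.max (cv .zmax) (cv .y))))))))

/-- Preparation of `R0` and `S`; the content `0` of `S` means consistent. -/
def prepPhase : Cmd :=
  .seq (.prep R0) (.seq (.prep S)
    (.ite eligible (.gate1 (fun _ => hadamard) (num 0) R0) .skip))

/-- Measurement of `S`, and Subroutine B if the result is consistent. -/
def checkPhase : Cmd :=
  .seq (.measure S .s)
    (.ite (.eq (cv .s) (num 0))
      (.ite eligible (.seq (.prep R1) subB) .skip)
      (.prep R1))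

/-- Measurement of `R0` and `R1` by the eligible parties; `z` is the integer with the bits `R0 R1`. -/
def measPhase : Cmd :=
  .ite eligible
    (.seq (.measure R0 .b0) (.seq (.measure R1 .b1)
      (.assign .z (.add (.add (cv .b0) (cv .b0)) (cv .b1)))))
    (.assign .z (num (-1)))

/-- A party that does not have the maximum value becomes ineligible. -/
def dropPhase : Cmd :=
  .ite (.eq (cv .z) (cv .zmax)) .skip (.assign .status (num 0))

/-- One phase. -/
def phase : Prog :=
  .seq (.loc prepPhase) (.seq subA (.seq (.loc checkPhase) (.seq (.loc measPhase) (.seq subC (.loc dropPhase)))))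

end AlgI

/-- Algorithm I. Its output is the variable `status`. -/
def algorithmI : Prog :=
  .seq (.loc (.seq (.prep AlgI.R0) (.seq (.prep AlgI.R1) (.prep AlgI.S))))
    (.forDown .k (.var .N) (.lit 2) AlgI.phase)

end QLE

end

namespace QLE

/-! ### Amplitudes and norms -/

section Amplitudes

variable {n : ℕ}

/-! The invariant of the algorithm (`PhaseState`) is that before the phase with parameter `k` the
number of eligible parties lies between 1 and `k`, and the joint state is a multiple of a single
computational basis state. It holds at the start because `n ≤ N`, and after the phase `k = 2` it
says that exactly one party is eligible.

One phase works as follows. The eligible parties put their `R0` into a uniform superposition.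
Subroutine A floods the network: if the symbols `0`, `1`, `∗`, `×` are read as subsets of `{0, 1}`,
the operation `∘` is union (`holds_circ`), so one round joins the sets of neighbours
(`roundMap_spec`), and by connectedness `N - 1 ≥ n - 1` rounds suffice (`spread`). Undoing the
computation leaves only the flip of the qubits `S` on the inconsistent basis states
(`subAMain_map`). If the measured result is inconsistent, the bits in `R0` differ between eligible
parties. If it is consistent, the eligible parties share a cat state, and after the local gates the
amplitude at which all of them hold the same pair `(r₀, r₁)` is proportional to the sum over `β` of
a `k`-th power of one gate entry, provided that exactly `k` parties are eligible. This sum is 0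
because `ω ^ k = -1` (`sum_finalAmp_pow`). So in both cases `k` eligible parties never all measure
the same value, and keeping only the holders of the maximum eliminates one of them at least
(`triple_phase`). The maximum is held by an eligible party, as the ineligible ones enter with `-1`;
hence an eligible party remains.

To turn this into probability 1, unitarity and the splitting of the norm by measurements give
conservation of the total probability of the branches (`totalProb_run`). It also shows that branches
of amplitude 0 have only such descendants, so that Hoare triples about branches with `ψ ≠ 0`
compose. The parts without measurements are handled as maps on basis states (`Prog.Acts`), for which
undoing a computation is a statement about composition of functions.

The resource bounds are independent of correctness and hold in every branch: loop lengths are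
bounded by `N` or by the degree plus one, messages stay in `[-1, 3]`, and structural recursion over
the program text adds the costs up (`run_netCost`, `algorithmI_resources`). -/

lemma Conf.set_apply (c : Conf n) (v : Fin n) (q : Qubit) (b : Bool) (u : Fin n) (r : Qubit) :
    c.set v q b u r = if u = v ∧ r = q then b else c u r := by
  unfold Conf.set
  by_cases hu : u = v
  · subst hu
    by_cases hr : r = q <;> simp [hr]
  · simp [hu]

@[simp] lemma Conf.set_same (c : Conf n) (v : Fin n) (q : Qubit) (b : Bool) :
    c.set v q b v q = b := by simp [Conf.set_apply]

lemma Conf.set_eq_iff {c c' : Conf n} {v : Fin n} {q : Qubit} {b : Bool} :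
    c.set v q b = c' ↔ c' v q = b ∧ ∀ u r, ¬(u = v ∧ r = q) → c u r = c' u r := by
  constructor
  · rintro rfl
    refine ⟨by simp, fun u r h => by simp [Conf.set_apply, h]⟩
  · rintro ⟨h, h'⟩
    funext u r
    by_cases hu : u = v ∧ r = q
    · rw [hu.1, hu.2, h]; simp
    · rw [← h' u r hu]; simp [Conf.set_apply, hu]

@[simp] lemma Conf.set_set (c : Conf n) (v : Fin n) (q : Qubit) (b b' : Bool) :
    (c.set v q b).set v q b' = c.set v q b' := by
  funext u r; simp only [Conf.set_apply]; split_ifs <;> rfl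

@[simp] lemma Conf.set_eta (c : Conf n) (v : Fin n) (q : Qubit) : c.set v q (c v q) = c := by
  rw [Conf.set_eq_iff]; simp

/-- Negation of one qubit of a basis state. -/
def flipEquiv (v : Fin n) (q : Qubit) : Conf n ≃ Conf n :=
  Function.Involutive.toPerm (fun c => c.set v q (!c v q)) fun c => by simp

lemma flipEquiv_apply (v : Fin n) (q : Qubit) (c : Conf n) :
    flipEquiv v q c = c.set v q (!c v q) := rfl

/-- Whichever value `c` has at `q`, the two settings of `q` are `c` itself and its flip. This splits
the basis states into blocks on which a one-qubit gate acts. -/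
lemma sum_set (v : Fin n) (q : Qubit) (g : Conf n → ℝ) (c : Conf n) :
    ∑ b : Bool, g (c.set v q b) = g c + g (flipEquiv v q c) := by
  rw [flipEquiv_apply, Fintype.sum_bool]
  rcases hb : c v q with _ | _
  · rw [show c.set v q false = c by rw [← hb]; simp]; simp [add_comm]
  · rw [show c.set v q true = c by rw [← hb]; simp]; simp

lemma summable_sum_set (v : Fin n) (q : Qubit) {g : Conf n → ℝ} (hg : Summable g) :
    Summable fun c : Conf n => ∑ b : Bool, g (c.set v q b) := by
  simp_rw [sum_set]
  exact hg.add ((flipEquiv v q).summable_iff.2 hg)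

/-- The flip is a permutation, so summing over blocks counts every basis state twice. It reduces
invariance of the norm to invariance on each block. The sums are infinite because a party has
infinitely many qubit names; finite support gives summability. -/
lemma tsum_sum_set (v : Fin n) (q : Qubit) {g : Conf n → ℝ} (hg : Summable g) :
    ∑' c : Conf n, ∑ b : Bool, g (c.set v q b) = 2 * ∑' c, g c := by
  simp_rw [sum_set]
  have h : Summable fun c => g (flipEquiv v q c) := (flipEquiv v q).summable_iff.2 hg
  rw [hg.tsum_add h, (flipEquiv v q).tsum_eq, two_mul]

lemma summable_normSq (ψ : Conf n →₀ ℂ) : Summable fun c => ‖ψ c‖ ^ 2 :=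
  summable_of_hasFiniteSupport (ψ.hasFiniteSupport.subset fun c h => by
    simp only [Function.mem_support] at h ⊢
    intro h0; simp [h0] at h)

lemma normSq_eq_tsum (ψ : Conf n →₀ ℂ) : normSq ψ = ∑' c, ‖ψ c‖ ^ 2 := by
  rw [normSq, Finsupp.sum, tsum_eq_sum]
  intro c hc
  simp [Finsupp.notMem_support_iff.1 hc]

lemma normSq_nonneg (ψ : Conf n →₀ ℂ) : 0 ≤ normSq ψ :=
  Finset.sum_nonneg fun _ _ => by positivity

@[simp] lemma normSq_zero : normSq (0 : Conf n →₀ ℂ) = 0 := by simp [normSq]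

lemma normSq_eq_zero {ψ : Conf n →₀ ℂ} (h : normSq ψ = 0) : ψ = 0 := by
  rw [normSq, Finsupp.sum, Finset.sum_eq_zero_iff_of_nonneg fun _ _ => by positivity] at h
  ext c
  by_cases hc : c ∈ ψ.support
  · simpa using h c hc
  · simpa using hc

/-- The definition distributes the amplitude of each source state; this form collects the amplitude
at a target. By linearity it suffices to test a single basis state, where both sides vanish unless
source and target agree off `q`. -/
lemma applyGate1_apply (U : Matrix (Fin 2) (Fin 2) ℂ) (v : Fin n) (q : Qubit)
    (ψ : Conf n →₀ ℂ) (c : Conf n) :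
    applyGate1 U v q ψ c = ∑ b : Bool, U (idx1 (c v q)) (idx1 b) * ψ (c.set v q b) := by
  classical
  unfold applyGate1
  induction ψ using Finsupp.induction_linear with
  | zero => simp
  | add f g hf hg =>
    rw [Finsupp.sum_add_index' (by simp) (by intros; simp [mul_add, Finset.sum_add_distrib]),
      Finsupp.add_apply, hf, hg, ← Finset.sum_add_distrib]
    simp [mul_add]
  | single c₀ a =>
    rw [Finsupp.sum_single_index (by simp), Finsupp.finsetSum_apply]
    simp only [Finsupp.single_apply, Conf.set_eq_iff, eq_comm (a := c₀)]
    by_cases h : ∀ u r, ¬(u = v ∧ r = q) → c u r = c₀ u r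
    · have h' : ∀ u r, ¬(u = v ∧ r = q) → c₀ u r = c u r := fun u r hu => (h u r hu).symm
      simp only [eq_true h, eq_true h', and_true, Fintype.sum_bool]
      cases c v q <;> cases c₀ v q <;> simp
    · have h' : ¬∀ u r, ¬(u = v ∧ r = q) → c₀ u r = c u r :=
        fun h' => h fun u r hu => (h' u r hu).symm
      simp only [eq_false h, eq_false h', and_false, if_false, mul_zero, Finset.sum_const_zero]

lemma applyGate2_apply (U : Matrix (Fin 4) (Fin 4) ℂ) (v : Fin n) {q₀ q₁ : Qubit} (hq : q₀ ≠ q₁)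
    (ψ : Conf n →₀ ℂ) (c : Conf n) :
    applyGate2 U v q₀ q₁ ψ c = ∑ b₀ : Bool, ∑ b₁ : Bool,
      U (idx2 (c v q₀) (c v q₁)) (idx2 b₀ b₁) * ψ ((c.set v q₀ b₀).set v q₁ b₁) := by
  classical
  have key : ∀ (c c' : Conf n) (b₀ b₁ : Bool), (c.set v q₀ b₀).set v q₁ b₁ = c' ↔
      (c' v q₀ = b₀ ∧ c' v q₁ = b₁) ∧
        ∀ u r, ¬(u = v ∧ r = q₀) → ¬(u = v ∧ r = q₁) → c u r = c' u r := by
    intro c c' b₀ b₁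
    rw [Conf.set_eq_iff]
    simp only [Conf.set_apply]
    constructor
    · rintro ⟨h1, h⟩
      refine ⟨⟨?_, h1⟩, fun u r h0 h2 => by simpa [h0] using h u r h2⟩
      have := h v q₀ (by simp [hq])
      simpa using this.symm
    · rintro ⟨⟨h0, h1⟩, h⟩
      refine ⟨h1, fun u r h2 => ?_⟩
      split_ifs with hu
      · rw [hu.1, hu.2, h0]
      · exact h u r hu h2
  unfold applyGate2
  induction ψ using Finsupp.induction_linear with
  | zero => simp
  | add f g hf hg =>
    rw [Finsupp.sum_add_index' (by simp) (by intros; simp [mul_add, Finset.sum_add_distrib]),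
      Finsupp.add_apply, hf, hg, ← Finset.sum_add_distrib]
    simp [mul_add, Finset.sum_add_distrib]
  | single c₀ a =>
    rw [Finsupp.sum_single_index (by simp)]
    simp only [Finsupp.finsetSum_apply, Finsupp.single_apply, key, eq_comm (a := c₀)]
    by_cases h : ∀ u r, ¬(u = v ∧ r = q₀) → ¬(u = v ∧ r = q₁) → c u r = c₀ u r
    · have h' : ∀ u r, ¬(u = v ∧ r = q₀) → ¬(u = v ∧ r = q₁) → c₀ u r = c u r :=
        fun u r h0 h1 => (h u r h0 h1).symm
      simp only [eq_true h, eq_true h', and_true, Fintype.sum_bool]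
      cases c v q₀ <;> cases c₀ v q₀ <;> cases c v q₁ <;> cases c₀ v q₁ <;> simp
    · have h' : ¬∀ u r, ¬(u = v ∧ r = q₀) → ¬(u = v ∧ r = q₁) → c₀ u r = c u r :=
        fun h' => h fun u r h0 h1 => (h' u r h0 h1).symm
      simp only [eq_false h, eq_false h', and_false, if_false, mul_zero, Finset.sum_const_zero]

lemma sum_norm_sq_mulVec {ι : Type*} [Fintype ι] [DecidableEq ι] {U : Matrix ι ι ℂ}
    (hU : U ∈ Matrix.unitaryGroup ι ℂ) (x : ι → ℂ) :
    ∑ i, ‖(U.mulVec x) i‖ ^ 2 = ∑ i, ‖x i‖ ^ 2 := by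
  have key : ∀ y : ι → ℂ, ((∑ i, ‖y i‖ ^ 2 : ℝ) : ℂ) = star y ⬝ᵥ y := by
    intro y
    simp [dotProduct, Complex.conj_mul']
  have h : star (U.mulVec x) ⬝ᵥ U.mulVec x = star x ⬝ᵥ x := by
    rw [Matrix.star_mulVec, Matrix.dotProduct_mulVec, Matrix.vecMul_vecMul,
      ← Matrix.star_eq_conjTranspose, Matrix.mem_unitaryGroup_iff'.1 hU, Matrix.vecMul_one]
  rw [← key, ← key] at h
  exact_mod_cast h

/-- The gate multiplies the pair of amplitudes in each block by the unitary matrix, which preserves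
the norm of the pair; `tsum_sum_set` carries this over to the whole vector. -/
lemma normSq_applyGate1 {U : Matrix (Fin 2) (Fin 2) ℂ} (hU : U ∈ Matrix.unitaryGroup (Fin 2) ℂ)
    (v : Fin n) (q : Qubit) (ψ : Conf n →₀ ℂ) : normSq (applyGate1 U v q ψ) = normSq ψ := by
  have h : ∀ c : Conf n, ∑ b : Bool, ‖applyGate1 U v q ψ (c.set v q b)‖ ^ 2 =
      ∑ b : Bool, ‖ψ (c.set v q b)‖ ^ 2 := by
    intro c
    have := sum_norm_sq_mulVec hU ![ψ (c.set v q false), ψ (c.set v q true)]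
    simp only [applyGate1_apply, Fintype.sum_bool, Conf.set_same, Conf.set_set]
    simp only [Matrix.mulVec, dotProduct, Fin.sum_univ_two] at this
    simp only [idx1]
    simp only [Matrix.cons_val_zero, Matrix.cons_val_one] at this
    simp only [if_true, Bool.false_eq_true, if_false]
    have comm : ∀ a b : ℂ, a + b = b + a := add_comm
    rw [comm (U 1 1 * _), comm (U 0 1 * _), add_comm, this, add_comm]
  have h1 := tsum_sum_set v q (summable_normSq (applyGate1 U v q ψ))
  have h2 := tsum_sum_set v q (summable_normSq ψ)
  simp only [h] at h1
  rw [normSq_eq_tsum, normSq_eq_tsum]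
  linarith

lemma normSq_applyGate2 {U : Matrix (Fin 4) (Fin 4) ℂ} (hU : U ∈ Matrix.unitaryGroup (Fin 4) ℂ)
    (v : Fin n) {q₀ q₁ : Qubit} (hq : q₀ ≠ q₁) (ψ : Conf n →₀ ℂ) :
    normSq (applyGate2 U v q₀ q₁ ψ) = normSq ψ := by
  have h : ∀ c : Conf n,
      ∑ b₀ : Bool, ∑ b₁ : Bool, ‖applyGate2 U v q₀ q₁ ψ ((c.set v q₀ b₀).set v q₁ b₁)‖ ^ 2 =
      ∑ b₀ : Bool, ∑ b₁ : Bool, ‖ψ ((c.set v q₀ b₀).set v q₁ b₁)‖ ^ 2 := by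
    intro c
    have e0 : ∀ b₀ b₁, (c.set v q₀ b₀).set v q₁ b₁ v q₀ = b₀ := by
      intros; simp [Conf.set_apply, hq]
    have e1 : ∀ b₀ b₁ b₀' b₁', ((((c.set v q₀ b₀).set v q₁ b₁).set v q₀ b₀').set v q₁ b₁') =
        (c.set v q₀ b₀').set v q₁ b₁' := by
      intros; funext u r; simp only [Conf.set_apply]; split_ifs <;> rfl
    have := sum_norm_sq_mulVec hU ![ψ ((c.set v q₀ false).set v q₁ false),
      ψ ((c.set v q₀ false).set v q₁ true), ψ ((c.set v q₀ true).set v q₁ false),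
      ψ ((c.set v q₀ true).set v q₁ true)]
    simp only [applyGate2_apply _ _ hq, Fintype.sum_bool, Conf.set_same, e0, e1, idx2]
    simp only [Matrix.mulVec, dotProduct, Fin.sum_univ_four, Matrix.cons_val] at this
    have comm : ∀ a b c d : ℂ, a + b + (c + d) = d + c + b + a := by intros; ring
    simp only [comm]
    linarith
  -- Two nested block sums count every basis state four times.
  have aux : ∀ φ : Conf n →₀ ℂ, ∑' c : Conf n, ∑ b₀ : Bool, ∑ b₁ : Bool,
      ‖φ ((c.set v q₀ b₀).set v q₁ b₁)‖ ^ 2 = 2 * (2 * ∑' c, ‖φ c‖ ^ 2) := by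
    intro φ
    rw [tsum_sum_set v q₀ (g := fun c => ∑ b₁ : Bool, ‖φ (c.set v q₁ b₁)‖ ^ 2)
      (summable_sum_set v q₁ (g := fun c => ‖φ c‖ ^ 2) (summable_normSq φ)),
      tsum_sum_set v q₁ (g := fun c => ‖φ c‖ ^ 2) (summable_normSq φ)]
  have h1 := aux (applyGate2 U v q₀ q₁ ψ)
  have h2 := aux ψ
  simp only [h] at h1
  rw [normSq_eq_tsum, normSq_eq_tsum]
  linarith

lemma normSq_mapDomain {f : Conf n → Conf n} (hf : Function.Injective f) (ψ : Conf n →₀ ℂ) :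
    normSq (ψ.mapDomain f) = normSq ψ := by
  rw [normSq, normSq, Finsupp.sum_mapDomain_index_inj hf]

lemma mapDomain_involutive_apply {f : Conf n → Conf n} (hf : Function.Involutive f)
    (ψ : Conf n →₀ ℂ) (c : Conf n) : ψ.mapDomain f c = ψ (f c) := by
  conv_lhs => rw [← hf c]
  exact Finsupp.mapDomain_apply hf.injective ψ (f c)

lemma project_apply (v : Fin n) (q : Qubit) (b : Bool) (ψ : Conf n →₀ ℂ) (c : Conf n) :
    project v q b ψ c = if c v q = b then ψ c else 0 := by
  simp [project, Finsupp.filter_apply]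

lemma normSq_project_add (v : Fin n) (q : Qubit) (ψ : Conf n →₀ ℂ) :
    normSq (project v q false ψ) + normSq (project v q true ψ) = normSq ψ := by
  rw [normSq_eq_tsum, normSq_eq_tsum, normSq_eq_tsum,
    ← (summable_normSq _).tsum_add (summable_normSq _)]
  congr 1; funext c
  rw [project_apply, project_apply]
  cases c v q <;> simp

/-- Effect on the amplitudes of a reset of `q` in which `q` was found in state `b`. -/
noncomputable def reset (v : Fin n) (q : Qubit) (b : Bool) (ψ : Conf n →₀ ℂ) : Conf n →₀ ℂ :=
  (project v q b ψ).mapDomain fun c => c.set v q false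

lemma reset_false (v : Fin n) (q : Qubit) (ψ : Conf n →₀ ℂ) :
    reset v q false ψ = project v q false ψ := by
  rw [reset]
  conv_rhs => rw [← Finsupp.mapDomain_id (v := project v q false ψ)]
  refine Finsupp.mapDomain_congr fun c hc => ?_
  have : c v q = false := by
    by_contra h
    rw [Finsupp.mem_support_iff, project_apply, if_neg h] at hc
    exact hc rfl
  rw [← this]; simp

/-- Setting `q` to 0 is not injective, but on the support of the projection it coincides with the
flip, which is. So no amplitudes are merged and the norm survives. -/
lemma reset_true (v : Fin n) (q : Qubit) (ψ : Conf n →₀ ℂ) :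
    reset v q true ψ = (project v q true ψ).mapDomain (flipEquiv v q) := by
  refine Finsupp.mapDomain_congr fun c hc => ?_
  have : c v q = true := by
    by_contra h
    rw [Finsupp.mem_support_iff, project_apply, if_neg h] at hc
    exact hc rfl
  simp [flipEquiv_apply, this]

lemma reset_apply (v : Fin n) (q : Qubit) (b : Bool) (ψ : Conf n →₀ ℂ) (c : Conf n) :
    reset v q b ψ c = if c v q = false then ψ (c.set v q b) else 0 := by
  cases b
  · rw [reset_false, project_apply]
    split_ifs with h
    · rw [← h]; simp
    · rfl
  · rw [reset_true, mapDomain_involutive_apply (f := flipEquiv v q) (fun c => by simp [flipEquiv_apply])]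
    rw [project_apply, flipEquiv_apply]
    cases c v q <;> simp

lemma normSq_reset_add (v : Fin n) (q : Qubit) (ψ : Conf n →₀ ℂ) :
    normSq (reset v q false ψ) + normSq (reset v q true ψ) = normSq ψ := by
  rw [reset_false, reset_true, normSq_mapDomain (flipEquiv v q).injective, normSq_project_add]

/-- The permutation `|x⟩|b⟩ ↦ |x⟩|b ⊕ f(x)⟩` of the basis states of one party; it is the identity
if the target is among the controls. -/
def xorMap {m : ℕ} (f : (Fin m → Bool) → Bool) (ctrl : Fin m → Qubit) (q : Qubit)
    (l : Qubit → Bool) : Qubit → Bool :=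
  open scoped Classical in
  if ∃ j, ctrl j = q then l else Function.update l q (l q ^^ f fun j => l (ctrl j))

lemma xorMap_involutive {m : ℕ} (f : (Fin m → Bool) → Bool) (ctrl : Fin m → Qubit) (q : Qubit) :
    Function.Involutive (xorMap f ctrl q) := by
  intro l
  by_cases h : ∃ j, ctrl j = q
  · simp [xorMap, h]
  · have h' : ∀ j, ctrl j ≠ q := by simpa using h
    simp [xorMap, h']

/-- Apply a map to the qubits of party `v`. -/
def onParty (v : Fin n) (g : (Qubit → Bool) → (Qubit → Bool)) (c : Conf n) : Conf n :=
  Function.update c v (g (c v))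

lemma onParty_comp (v : Fin n) (g h : (Qubit → Bool) → (Qubit → Bool)) :
    onParty v g ∘ onParty v h = onParty v (g ∘ h) := by
  funext c; simp [onParty]

@[simp] lemma onParty_id (v : Fin n) : onParty v id = id := by
  funext c; simp [onParty]

lemma onParty_involutive (v : Fin n) {g : (Qubit → Bool) → (Qubit → Bool)}
    (hg : Function.Involutive g) : Function.Involutive (onParty v g) := by
  intro c
  change (onParty v g ∘ onParty v g) c = c
  rw [onParty_comp, hg.comp_self, onParty_id]; rfl

lemma exec_xor_psi {m : ℕ} (f : (Fin m → Bool) → Bool) (ctrl : Fin m → Qubit) (q : Qubit)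
    (v : Fin n) : (fun c : Conf n => onParty v (xorMap f ctrl q) c) =
    open scoped Classical in if ∃ j, ctrl j = q then id else
      fun c => c.set v q (c v q ^^ f fun j => c v (ctrl j)) := by
  funext c
  split_ifs with h
  · simp [onParty, xorMap, h]
  · simp [onParty, xorMap, h, Conf.set]

end Amplitudes


/-! ### Conservation of probability -/

section Conservation

variable {n : ℕ}

/-- Sum of the probabilities of the branches in a list. -/
noncomputable def totalProb (L : List (State n)) : ℝ := (L.map fun s => normSq s.ψ).sum

@[simp] lemma totalProb_singleton (s : State n) : totalProb [s] = normSq s.ψ := by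
  simp [totalProb]

lemma totalProb_flatMap {f : State n → List (State n)} (hf : ∀ s, totalProb (f s) = normSq s.ψ)
    (L : List (State n)) : totalProb (L.flatMap f) = totalProb L := by
  induction L with
  | nil => rfl
  | cons s L ih =>
    have := hf s
    simp only [totalProb, List.flatMap_cons, List.map_append, List.sum_append, List.map_cons,
      List.sum_cons] at *
    rw [this, ih]

lemma totalProb_branchFold {α : Type} {f : α → State n → List (State n)}
    (hf : ∀ a s, totalProb (f a s) = normSq s.ψ) (l : List α) (s : State n) :
    totalProb (branchFold f l s) = normSq s.ψ := by
  induction l generalizing s with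
  | nil => simp [branchFold]
  | cons a l ih => rw [branchFold, totalProb_flatMap ih, hf]

/-- Squared norms are nonnegative, so a vanishing sum forces every branch to vanish. Together with
conservation this shows that a branch of probability 0 has only descendants of probability 0. -/
lemma psi_eq_zero_of_totalProb {L : List (State n)} (h : totalProb L = 0) {s : State n}
    (hs : s ∈ L) : s.ψ = 0 := by
  induction L with
  | nil => simp at hs
  | cons t L ih =>
    have h1 : normSq t.ψ + totalProb L = 0 := by simpa [totalProb] using h
    have h2 : 0 ≤ totalProb L := List.sum_nonneg (by
      simp only [List.mem_map]; rintro _ ⟨s, -, rfl⟩; exact normSq_nonneg _)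
    have h3 := normSq_nonneg t.ψ
    rcases List.mem_cons.1 hs with rfl | hs
    · exact normSq_eq_zero (by linarith)
    · exact ih (by linarith) hs

lemma exec_prep (env : PVar → ℤ) (v : Fin n) (q : QRef) (s : State n) :
    (Cmd.prep q).exec env v s =
      [{ s.tick v with ψ := reset v (q.eval (s.look env v)) false s.ψ },
       { s.tick v with ψ := reset v (q.eval (s.look env v)) true s.ψ }] := by
  rw [reset_false]; rfl

lemma exec_xor (env : PVar → ℤ) (v : Fin n) {m : ℕ} (f : (Fin m → Bool) → Bool)
    (ctrl : Fin m → QRef) (q : QRef) (s : State n) :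
    (Cmd.xor f ctrl q).exec env v s =
      [{ s.tick v with ψ := s.ψ.mapDomain (onParty v (xorMap f
          (fun j => (ctrl j).eval (s.look env v)) (q.eval (s.look env v)))) }] := by
  rw [Cmd.exec, show onParty v (xorMap f (fun j => (ctrl j).eval (s.look env v))
    (q.eval (s.look env v))) = _ from exec_xor_psi _ _ _ _]
  split_ifs with h
  · rw [Finsupp.mapDomain_id]; rfl
  · rfl

/-- Gates act by unitaries or permutations of the basis; measurements and resets split the vector
into two parts whose squared norms add up. -/
theorem totalProb_exec (env : PVar → ℤ) (v : Fin n) (c : Cmd) (s : State n) :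
    totalProb (c.exec env v s) = normSq s.ψ := by
  induction c generalizing s with
  | skip => simp [Cmd.exec]
  | assign x e => simp [Cmd.exec, State.tick, State.setVar]
  | recv x e => simp [Cmd.exec, State.tick, State.setVar]
  | prep q =>
    rw [exec_prep, ← normSq_reset_add v (q.eval (s.look env v)) s.ψ]
    simp [totalProb]
  | xor f ctrl q =>
    rw [exec_xor]
    simpa using normSq_mapDomain (onParty_involutive v (xorMap_involutive _ _ _)).injective s.ψ
  | gate1 U e q =>
    simpa [Cmd.exec] using normSq_applyGate1 (U _).2 v _ s.ψ
  | gate2 U e q₀ q₁ =>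
    rw [Cmd.exec]
    split_ifs with h
    · simp [State.tick]
    · simpa using normSq_applyGate2 (U _).2 v h s.ψ
  | measure q x =>
    rw [← normSq_project_add v (q.eval (s.look env v)) s.ψ]
    simp [Cmd.exec, totalProb]
  | seq c₁ c₂ h₁ h₂ => rw [Cmd.exec, totalProb_flatMap h₂, h₁]
  | ite b c₁ c₂ h₁ h₂ =>
    rw [Cmd.exec]
    split_ifs
    · exact h₁ _
    · exact h₂ _
  | forUp x lo hi c h =>
    rw [Cmd.exec]
    refine (totalProb_branchFold ?_ _ _).trans rfl
    exact fun a s => h _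
  | forDown x hi lo c h =>
    rw [Cmd.exec]
    refine (totalProb_branchFold ?_ _ _).trans rfl
    exact fun a s => h _

/-! ### Links, ports and the exchange of registers -/

variable (G : SimpleGraph (Fin n)) [DecidableRel G.Adj] (σ : PortNumbering G)

lemma remote_neighbor {v : Fin n} (w : G.neighborSet v) :
    remote G σ v ((σ v w : ℕ) + 1) =
      some (w.1, ((σ w.1 ⟨v, SimpleGraph.Adj.symm w.2⟩ : ℕ) : ℤ) + 1) := by
  have hlt := (σ v w).2
  rw [remote, dif_pos (by omega)]
  have e : (⟨(((σ v w : ℕ) : ℤ) + 1 - 1).toNat, by omega⟩ : Fin (G.degree v)) = σ v w := by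
    apply Fin.ext
    simp
  have key : ∀ u : G.neighborSet v, u = w →
      some (u.1, ((σ u.1 ⟨v, SimpleGraph.Adj.symm u.2⟩ : ℕ) : ℤ) + 1) =
      some (w.1, ((σ w.1 ⟨v, SimpleGraph.Adj.symm w.2⟩ : ℕ) : ℤ) + 1) := by
    rintro _ rfl; rfl
  exact key _ (by rw [e, Equiv.symm_apply_apply])

/-- Every valid port of `v` is `σ v w + 1` for a neighbour `w`, and `remote_neighbor` can then be
applied from both ends of the link. The resulting symmetry is what makes an exchange reversible. -/
lemma remote_eq_some {v u : Fin n} {i j : ℤ} (h : remote G σ v i = some (u, j)) :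
    G.Adj v u ∧ remote G σ u j = some (v, i) := by
  obtain ⟨w, rfl⟩ : ∃ w : G.neighborSet v, i = (σ v w : ℕ) + 1 := by
    have hi : 1 ≤ i ∧ i ≤ G.degree v := by
      unfold remote at h
      split_ifs at h with hi
      exact hi
    refine ⟨(σ v).symm ⟨(i - 1).toNat, by omega⟩, ?_⟩
    rw [Equiv.apply_symm_apply]
    simp only
    omega
  rw [remote_neighbor, Option.some.injEq, Prod.mk.injEq] at h
  obtain ⟨rfl, rfl⟩ := h
  exact ⟨w.2, remote_neighbor G σ ⟨v, SimpleGraph.Adj.symm w.2⟩⟩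

lemma remote_isSome {v : Fin n} {i : ℤ} (h : 1 ≤ i ∧ i ≤ G.degree v) :
    ∃ u j, remote G σ v i = some (u, j) := by
  rw [remote, dif_pos h]
  exact ⟨_, _, rfl⟩

lemma remote_port {v u : Fin n} {i j : ℤ} (h : remote G σ v i = some (u, j)) :
    1 ≤ i ∧ i ≤ G.degree v := by
  unfold remote at h
  split_ifs at h with hi
  exact hi

lemma exists_port {v u : Fin n} (h : G.Adj v u) :
    ∃ i j, remote G σ v i = some (u, j) := by
  exact ⟨_, _, remote_neighbor G σ ⟨u, h⟩⟩

/-- Along each link the two registers are swapped, by symmetry of `remote`. Hence an exchange is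
unitary, and a second one undoes it, as the uncomputation in Subroutine A requires. -/
lemma exchConf_involutive (a : QName) (r : ℤ) : Function.Involutive (exchConf G σ a r) := by
  intro c
  funext v q
  unfold exchConf
  by_cases hq : q.name = a ∧ q.row = r
  · simp only [hq, and_self, if_true]
    rcases hr : remote G σ v q.col with _ | ⟨u, j⟩
    · rfl
    · obtain ⟨rfl, rfl⟩ := hq
      simp [(remote_eq_some G σ hr).2]
  · simp [hq]

theorem totalProb_run (p : Prog) (env : PVar → ℤ) (s : State n) :
    totalProb (p.run G σ env s) = normSq s.ψ := by
  induction p generalizing env s with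
  | loc c => exact totalProb_branchFold (fun v => totalProb_exec env v c) _ _
  | exchQ a e =>
    simpa [Prog.run] using normSq_mapDomain (exchConf_involutive G σ a _).injective s.ψ
  | exchC x => simp [Prog.run]
  | seq p₁ p₂ h₁ h₂ => rw [Prog.run, totalProb_flatMap (h₂ env), h₁]
  | forUp x lo hi p h =>
    rw [Prog.run]
    refine (totalProb_branchFold ?_ _ _).trans rfl
    exact fun a s => h _ _
  | forDown x hi lo p h =>
    rw [Prog.run]
    refine (totalProb_branchFold ?_ _ _).trans rfl
    exact fun a s => h _ _

end Conservation

/-! ### Hoare triples -/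

section Hoare

variable {n : ℕ}

/-- The part of the state that influences the execution. -/
structure Core (n : ℕ) where
  ψ : Conf n →₀ ℂ
  mem : Fin n → CVar → ℤ
  inbox : Fin n → ℤ → ℤ

def State.core (s : State n) : Core n := ⟨s.ψ, s.mem, s.inbox⟩

def Core.look (κ : Core n) (env : PVar → ℤ) (v : Fin n) : PVar ⊕ CVar → ℤ :=
  Sum.elim env (κ.mem v)

def Core.setVar (κ : Core n) (v : Fin n) (x : CVar) (a : ℤ) : Core n :=
  { κ with mem := Function.update κ.mem v (Function.update (κ.mem v) x a) }

lemma Core.setVar_mem (κ : Core n) (v : Fin n) (x : CVar) (a : ℤ) (u : Fin n) (x' : CVar) :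
    (κ.setVar v x a).mem u x' = if u = v ∧ x' = x then a else κ.mem u x' := by
  unfold Core.setVar
  by_cases hu : u = v
  · subst hu
    by_cases hr : x' = x <;> simp [hr]
  · simp [hu]

/-- `c`, executed by party `v` with the common variables `env`, leads from states with `P` to
states with `Q` in all branches of positive probability. -/
def Cmd.Triple (env : PVar → ℤ) (v : Fin n) (P : Core n → Prop) (c : Cmd)
    (Q : Core n → Prop) : Prop :=
  ∀ s : State n, P s.core → ∀ s' ∈ c.exec env v s, s'.ψ ≠ 0 → Q s'.core

/-- Induction on the list with the invariant indexed by the number of elements processed.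
Conservation `hf` is needed because the hypothesis on a step speaks only of nonzero results. -/
lemma branchFold_triple {α : Type} {f : α → State n → List (State n)}
    (hf : ∀ a s, totalProb (f a s) = normSq s.ψ) (I : ℕ → Core n → Prop) {l : List α}
    (h : ∀ j (hj : j < l.length) s, I j s.core → ∀ s' ∈ f l[j] s, s'.ψ ≠ 0 → I (j + 1) s'.core)
    {s : State n} (hs : I 0 s.core) {s' : State n} (hs' : s' ∈ branchFold f l s)
    (h0 : s'.ψ ≠ 0) : I l.length s'.core := by
  induction l generalizing s I with
  | nil =>
    simp only [branchFold, List.mem_singleton] at hs'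
    subst hs'; exact hs
  | cons a l ih =>
    simp only [branchFold, List.mem_flatMap] at hs'
    obtain ⟨s₁, h₁, h₂⟩ := hs'
    -- If the intermediate branch were zero, the total probability of its descendants would be zero,
    -- and so would be `s'.ψ`.
    have hne : s₁.ψ ≠ 0 := by
      intro hz
      refine h0 (psi_eq_zero_of_totalProb (L := branchFold f l s₁) ?_ h₂)
      rw [totalProb_branchFold hf, hz, normSq_zero]
    refine ih (I := fun j => I (j + 1)) (fun j hj s hs => ?_) (h 0 (by simp) s hs s₁ h₁ hne) h₂
    exact h (j + 1) (by simpa using hj) s hs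

namespace Cmd.Triple

variable {env : PVar → ℤ} {v : Fin n} {P Q R : Core n → Prop}

lemma conseq {P' Q' : Core n → Prop} {c : Cmd} (h : Triple env v P c Q)
    (hP : ∀ κ, P' κ → P κ) (hQ : ∀ κ, Q κ → Q' κ) : Triple env v P' c Q' :=
  fun s hs s' hs' h0 => hQ _ (h s (hP _ hs) s' hs' h0)

lemma pre {P' : Core n → Prop} {c : Cmd} (h : Triple env v P c Q)
    (hP : ∀ κ, P' κ → P κ) : Triple env v P' c Q := h.conseq hP fun _ => id

lemma post {Q' : Core n → Prop} {c : Cmd} (h : Triple env v P c Q)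
    (hQ : ∀ κ, Q κ → Q' κ) : Triple env v P c Q' := h.conseq (fun _ => id) hQ

lemma seq {c₁ c₂ : Cmd} (h₁ : Triple env v P c₁ Q) (h₂ : Triple env v Q c₂ R) :
    Triple env v P (.seq c₁ c₂) R := by
  intro s hs s' hs' h0
  rw [Cmd.exec, List.mem_flatMap] at hs'
  obtain ⟨s₁, hs₁, hs'⟩ := hs'
  have hne : s₁.ψ ≠ 0 := by
    intro hz
    refine h0 (psi_eq_zero_of_totalProb ?_ hs')
    rw [totalProb_exec, hz, normSq_zero]
  exact h₂ s₁ (h₁ s hs s₁ hs₁ hne) s' hs' h0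

lemma skip (h : ∀ κ, P κ → Q κ) : Triple env v P .skip Q := by
  intro s hs s' hs' h0
  rw [Cmd.exec, List.mem_singleton] at hs'
  subst hs'; exact h _ hs

lemma assign {x : CVar} {e : LExpr}
    (h : ∀ κ, P κ → Q (κ.setVar v x (e.eval (κ.look env v)))) :
    Triple env v P (.assign x e) Q := by
  intro s hs s' hs' h0
  rw [Cmd.exec, List.mem_singleton] at hs'
  subst hs'; exact h s.core hs

lemma recv {x : CVar} {e : LExpr}
    (h : ∀ κ, P κ → Q (κ.setVar v x (κ.inbox v (e.eval (κ.look env v))))) :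
    Triple env v P (.recv x e) Q := by
  intro s hs s' hs' h0
  rw [Cmd.exec, List.mem_singleton] at hs'
  subst hs'; exact h s.core hs

lemma prep {q : QRef}
    (h : ∀ κ b, P κ → reset v (q.eval (κ.look env v)) b κ.ψ ≠ 0 →
      Q ⟨reset v (q.eval (κ.look env v)) b κ.ψ, κ.mem, κ.inbox⟩) :
    Triple env v P (.prep q) Q := by
  intro s hs s' hs' h0
  rw [exec_prep, List.mem_cons, List.mem_singleton] at hs'
  rcases hs' with rfl | rfl
  · exact h s.core false hs h0
  · exact h s.core true hs h0

lemma xor {m : ℕ} {f : (Fin m → Bool) → Bool} {ctrl : Fin m → QRef} {q : QRef}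
    (h : ∀ κ, P κ → Q ⟨κ.ψ.mapDomain (onParty v (xorMap f
          (fun j => (ctrl j).eval (κ.look env v)) (q.eval (κ.look env v)))), κ.mem, κ.inbox⟩) :
    Triple env v P (.xor f ctrl q) Q := by
  intro s hs s' hs' h0
  rw [exec_xor, List.mem_singleton] at hs'
  subst hs'; exact h s.core hs

lemma gate1 {U : ℤ → Matrix.unitaryGroup (Fin 2) ℂ} {e : LExpr} {q : QRef}
    (h : ∀ κ, P κ → Q ⟨applyGate1 (U (e.eval (κ.look env v))).1 v (q.eval (κ.look env v)) κ.ψ,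
      κ.mem, κ.inbox⟩) :
    Triple env v P (.gate1 U e q) Q := by
  intro s hs s' hs' h0
  rw [Cmd.exec, List.mem_singleton] at hs'
  subst hs'; exact h s.core hs

lemma gate2 {U : ℤ → Matrix.unitaryGroup (Fin 4) ℂ} {e : LExpr} {q₀ q₁ : QRef}
    (hq : ∀ κ, P κ → q₀.eval (κ.look env v) ≠ q₁.eval (κ.look env v))
    (h : ∀ κ, P κ → Q ⟨applyGate2 (U (e.eval (κ.look env v))).1 v
      (q₀.eval (κ.look env v)) (q₁.eval (κ.look env v)) κ.ψ, κ.mem, κ.inbox⟩) :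
    Triple env v P (.gate2 U e q₀ q₁) Q := by
  intro s hs s' hs' h0
  have hq' : q₀.eval (s.look env v) ≠ q₁.eval (s.look env v) := hq s.core hs
  rw [Cmd.exec, List.mem_singleton, if_neg hq'] at hs'
  subst hs'; exact h s.core hs

lemma measure {q : QRef} {x : CVar}
    (h : ∀ κ b, P κ → project v (q.eval (κ.look env v)) b κ.ψ ≠ 0 →
      Q ⟨project v (q.eval (κ.look env v)) b κ.ψ,
        (κ.setVar v x (if b then 1 else 0)).mem, κ.inbox⟩) :
    Triple env v P (.measure q x) Q := by
  intro s hs s' hs' h0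
  rw [Cmd.exec, List.mem_cons, List.mem_singleton] at hs'
  rcases hs' with rfl | rfl
  · exact h s.core false hs h0
  · exact h s.core true hs h0

lemma ite {b : Cond} {c₁ c₂ : Cmd}
    (h₁ : Triple env v (fun κ => P κ ∧ b.holds (κ.look env v)) c₁ Q)
    (h₂ : Triple env v (fun κ => P κ ∧ ¬b.holds (κ.look env v)) c₂ Q) :
    Triple env v P (.ite b c₁ c₂) Q := by
  intro s hs s' hs' h0
  rw [Cmd.exec] at hs'
  split_ifs at hs' with hb
  · exact h₁ (s.tick v) ⟨hs, hb⟩ s' hs' h0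
  · exact h₂ (s.tick v) ⟨hs, hb⟩ s' hs' h0

/-- The loop overwrites its counter at the start of each iteration, so the invariant must be
insensitive to that variable (`hI`); the body gets the current value as an extra premise. -/
lemma forUp {x : CVar} {lo hi : LExpr} {c : Cmd} (a b : ℤ) (I : ℕ → Core n → Prop)
    (hI : ∀ j κ y, I j κ → I j (κ.setVar v x y))
    (h : ∀ j : ℕ, a + j ≤ b → Triple env v (fun κ => I j κ ∧ κ.mem v x = a + j) c (I (j + 1)))
    (hP : ∀ κ, P κ → lo.eval (κ.look env v) = a ∧ hi.eval (κ.look env v) = b ∧ I 0 κ) :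
    Triple env v P (.forUp x lo hi c) (I (b - a + 1).toNat) := by
  intro s hs s' hs' h0
  obtain ⟨ha, hb, h1⟩ := hP _ hs
  change lo.eval (s.look env v) = a at ha
  change hi.eval (s.look env v) = b at hb
  rw [Cmd.exec] at hs'
  simp only [ha, hb] at hs'
  have := branchFold_triple
    (f := fun (j : ℕ) s' => c.exec env v ((s'.setVar v x (a + j)).tick v))
    (fun a s => totalProb_exec env v c _) I (s := s.tick v)
    (fun j hj s hs s' hs' h0 => ?_) h1 hs' h0
  · simpa using this
  · rw [List.length_range] at hj
    rw [List.getElem_range] at hs'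
    exact h j (by omega) ((s.setVar v x _).tick v) ⟨hI j s.core _ hs,
      by simp [State.core, State.tick, State.setVar]⟩ s' hs' h0

lemma forDown {x : CVar} {lo hi : LExpr} {c : Cmd} (a b : ℤ) (I : ℕ → Core n → Prop)
    (hI : ∀ j κ y, I j κ → I j (κ.setVar v x y))
    (h : ∀ j : ℕ, a ≤ b - j → Triple env v (fun κ => I j κ ∧ κ.mem v x = b - j) c (I (j + 1)))
    (hP : ∀ κ, P κ → lo.eval (κ.look env v) = a ∧ hi.eval (κ.look env v) = b ∧ I 0 κ) :
    Triple env v P (.forDown x hi lo c) (I (b - a + 1).toNat) := by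
  intro s hs s' hs' h0
  obtain ⟨ha, hb, h1⟩ := hP _ hs
  change lo.eval (s.look env v) = a at ha
  change hi.eval (s.look env v) = b at hb
  rw [Cmd.exec] at hs'
  simp only [ha, hb] at hs'
  have := branchFold_triple
    (f := fun (j : ℕ) s' => c.exec env v ((s'.setVar v x (b - j)).tick v))
    (fun a s => totalProb_exec env v c _) I (s := s.tick v)
    (fun j hj s hs s' hs' h0 => ?_) h1 hs' h0
  · simpa using this
  · rw [List.length_range] at hj
    rw [List.getElem_range] at hs'
    exact h j (by omega) ((s.setVar v x _).tick v) ⟨hI j s.core _ hs,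
      by simp [State.core, State.tick, State.setVar]⟩ s' hs' h0

end Cmd.Triple

variable (G : SimpleGraph (Fin n)) [DecidableRel G.Adj] (σ : PortNumbering G)

/-- `p` leads from states with `P` to states with `Q` in all branches of positive probability. -/
def Prog.Triple (env : PVar → ℤ) (P : Core n → Prop) (p : Prog) (Q : Core n → Prop) : Prop :=
  ∀ s : State n, P s.core → ∀ s' ∈ p.run G σ env s, s'.ψ ≠ 0 → Q s'.core

namespace Prog.Triple

variable {G σ} {env : PVar → ℤ} {P Q R : Core n → Prop}

lemma conseq {P' Q' : Core n → Prop} {p : Prog} (h : Triple G σ env P p Q)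
    (hP : ∀ κ, P' κ → P κ) (hQ : ∀ κ, Q κ → Q' κ) : Triple G σ env P' p Q' :=
  fun s hs s' hs' h0 => hQ _ (h s (hP _ hs) s' hs' h0)

lemma pre {P' : Core n → Prop} {p : Prog} (h : Triple G σ env P p Q)
    (hP : ∀ κ, P' κ → P κ) : Triple G σ env P' p Q := h.conseq hP fun _ => id

lemma post {Q' : Core n → Prop} {p : Prog} (h : Triple G σ env P p Q)
    (hQ : ∀ κ, Q κ → Q' κ) : Triple G σ env P p Q' := h.conseq (fun _ => id) hQ

lemma seq {p₁ p₂ : Prog} (h₁ : Triple G σ env P p₁ Q) (h₂ : Triple G σ env Q p₂ R) :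
    Triple G σ env P (.seq p₁ p₂) R := by
  intro s hs s' hs' h0
  rw [Prog.run, List.mem_flatMap] at hs'
  obtain ⟨s₁, hs₁, hs'⟩ := hs'
  have hne : s₁.ψ ≠ 0 := by
    intro hz
    refine h0 (psi_eq_zero_of_totalProb ?_ hs')
    rw [totalProb_run, hz, normSq_zero]
  exact h₂ s₁ (h₁ s hs s₁ hs₁ hne) s' hs' h0

lemma exchQ {a : QName} {e : Expr PVar}
    (h : ∀ κ, P κ → Q ⟨κ.ψ.mapDomain (exchConf G σ a (e.eval env)), κ.mem, κ.inbox⟩) :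
    Triple G σ env P (.exchQ a e) Q := by
  intro s hs s' hs' h0
  rw [Prog.run, List.mem_singleton] at hs'
  subst hs'; exact h s.core hs

lemma exchC {x : CVar}
    (h : ∀ κ, P κ → Q ⟨κ.ψ, κ.mem, fun v i =>
            match remote G σ v i with
            | some (u, _) => κ.mem u x
            | none => 0⟩) :
    Triple G σ env P (.exchC x) Q := by
  intro s hs s' hs' h0
  rw [Prog.run, List.mem_singleton] at hs'
  subst hs'; exact h s.core hs

/-- The invariant is indexed by the set of parties that have already run the code. Since the list of
parties has no duplicates, the next one is never in that set. -/
lemma loc {c : Cmd} (I : Finset (Fin n) → Core n → Prop)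
    (h : ∀ D v, v ∉ D → Cmd.Triple env v (I D) c (I (insert v D))) :
    Triple G σ env (I ∅) (.loc c) (I Finset.univ) := by
  intro s hs s' hs' h0
  rw [Prog.run] at hs'
  have := branchFold_triple (fun v s => totalProb_exec env v c s)
    (fun j => I (((List.finRange n).take j).toFinset)) (s := s)
    (fun j hj s hs s' hs' h0 => ?_) (by simpa using hs) hs' h0
  · rwa [List.take_length, List.toFinset_finRange] at this
  · have hnd := List.nodup_finRange n
    have := h _ (List.finRange n)[j] ?_ s hs s' hs' h0
    · rw [← List.take_concat_get' _ _ hj, List.toFinset_append]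
      rwa [List.toFinset_cons, List.toFinset_nil, Finset.union_comm, insert_empty_eq,
        ← Finset.insert_eq]
    · rw [List.mem_toFinset]
      intro hmem
      have h2 : ((List.finRange n).take (j+1)).Nodup := hnd.sublist (List.take_sublist _ _)
      rw [← List.take_concat_get' _ _ hj, List.nodup_append] at h2
      exact h2.2.2 _ hmem _ (List.mem_singleton_self _) rfl

lemma forUp {x : PVar} {lo hi : Expr PVar} {p : Prog} (I : ℕ → Core n → Prop)
    (h : ∀ j : ℕ, lo.eval env + j ≤ hi.eval env →
      Triple G σ (Function.update env x (lo.eval env + j)) (I j) p (I (j + 1))) :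
    Triple G σ env (I 0) (.forUp x lo hi p) (I (hi.eval env - lo.eval env + 1).toNat) := by
  intro s hs s' hs' h0
  rw [Prog.run] at hs'
  have := branchFold_triple
    (f := fun (j : ℕ) s' => p.run G σ (Function.update env x (lo.eval env + j)) s'.tickAll)
    (fun a s => totalProb_run G σ p _ _) I (s := s.tickAll)
    (fun j hj s hs s' hs' h0 => ?_) hs hs' h0
  · simpa using this
  · rw [List.length_range] at hj
    rw [List.getElem_range] at hs'
    exact h j (by omega) s.tickAll hs s' hs' h0

lemma forDown {x : PVar} {lo hi : Expr PVar} {p : Prog} (I : ℕ → Core n → Prop)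
    (h : ∀ j : ℕ, lo.eval env ≤ hi.eval env - j →
      Triple G σ (Function.update env x (hi.eval env - j)) (I j) p (I (j + 1))) :
    Triple G σ env (I 0) (.forDown x hi lo p) (I (hi.eval env - lo.eval env + 1).toNat) := by
  intro s hs s' hs' h0
  rw [Prog.run] at hs'
  have := branchFold_triple
    (f := fun (j : ℕ) s' => p.run G σ (Function.update env x (hi.eval env - j)) s'.tickAll)
    (fun a s => totalProb_run G σ p _ _) I (s := s.tickAll)
    (fun j hj s hs s' hs' h0 => ?_) hs hs' h0
  · simpa using this
  · rw [List.length_range] at hj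
    rw [List.getElem_range] at hs'
    exact h j (by omega) s.tickAll hs s' hs' h0

end Prog.Triple

end Hoare


/-! ### Resources -/

section Resources

variable {n : ℕ} (G : SimpleGraph (Fin n)) [DecidableRel G.Adj] (σ : PortNumbering G)

/-- Ranges of the classical variables. -/
structure MemRange (s : State n) : Prop where
  d : ∀ v, s.mem v .d = G.degree v
  b0 : ∀ v, 0 ≤ s.mem v .b0 ∧ s.mem v .b0 ≤ 1
  b1 : ∀ v, 0 ≤ s.mem v .b1 ∧ s.mem v .b1 ≤ 1
  z : ∀ v, -1 ≤ s.mem v .z ∧ s.mem v .z ≤ 3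
  zmax : ∀ v, -1 ≤ s.mem v .zmax ∧ s.mem v .zmax ≤ 3
  y : ∀ v, -1 ≤ s.mem v .y ∧ s.mem v .y ≤ 3
  inbox : ∀ v i, -1 ≤ s.inbox v i ∧ s.inbox v i ≤ 3

/-- Bound on the number of steps of local code whose loops have at most `L` iterations. -/
def Cmd.cost (L : ℕ) : Cmd → ℕ
  | .skip => 0
  | .assign _ _ | .recv _ _ | .prep _ | .xor _ _ _ | .gate1 _ _ _ | .gate2 _ _ _ _
  | .measure _ _ => 1
  | .seq c₁ c₂ => c₁.cost L + c₂.cost L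
  | .ite _ c₁ c₂ => 1 + (c₁.cost L + c₂.cost L)
  | .forUp _ _ _ c | .forDown _ _ _ c => 1 + L * (1 + c.cost L)

/-- The local code respects the ranges of the variables, and its loops have at most
`degree + 1` iterations. -/
def Cmd.Safe (env : PVar → ℤ) (v : Fin n) : Cmd → Prop
  | .assign x e =>
      ∀ s : State n, MemRange G s → MemRange G (s.setVar v x (e.eval (s.look env v)))
  | .recv x e =>
      ∀ s : State n, MemRange G s → MemRange G (s.setVar v x (s.inbox v (e.eval (s.look env v))))
  | .measure _ x => x = .b0 ∨ x = .b1 ∨ x = .s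
  | .seq c₁ c₂ | .ite _ c₁ c₂ => c₁.Safe env v ∧ c₂.Safe env v
  | .forUp x lo hi c | .forDown x hi lo c => x = .i ∧
      (∀ s : State n, MemRange G s →
        (hi.eval (s.look env v) - lo.eval (s.look env v) + 1).toNat ≤ G.degree v + 1) ∧
      c.Safe env v
  | _ => True

variable {G} in
lemma MemRange.setVar {s : State n} (h : MemRange G s) (v : Fin n) {x : CVar} {a : ℤ}
    (hd : x ≠ .d) (hb : x = .b0 ∨ x = .b1 → 0 ≤ a ∧ a ≤ 1)
    (hz : x = .z ∨ x = .zmax ∨ x = .y → -1 ≤ a ∧ a ≤ 3) : MemRange G (s.setVar v x a) := by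
  have key : ∀ u x', (s.setVar v x a).mem u x' = if u = v ∧ x' = x then a else s.mem u x' :=
    Core.setVar_mem s.core v x a
  refine ⟨fun u => ?_, fun u => ?_, fun u => ?_, fun u => ?_, fun u => ?_, fun u => ?_, h.inbox⟩
  · rw [key, if_neg (fun hu => hd hu.2.symm)]; exact h.d u
  all_goals rw [key]; split_ifs with hu
  · exact hb (.inl hu.2.symm)
  · exact h.b0 u
  · exact hb (.inr hu.2.symm)
  · exact h.b1 u
  · exact hz (.inl hu.2.symm)
  · exact h.z u
  · exact hz (.inr (.inl hu.2.symm))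
  · exact h.zmax u
  · exact hz (.inr (.inr hu.2.symm))
  · exact h.y u

/-- Local code of `v` that leads from `s` to `s'` in at most `K` steps. -/
structure LocalCost (v : Fin n) (K : ℕ) (s s' : State n) : Prop where
  range : MemRange G s'
  steps : s'.steps v ≤ s.steps v + K
  steps' : ∀ u ≠ v, s'.steps u = s.steps u
  qsent : s'.qsent = s.qsent
  qrecv : s'.qrecv = s.qrecv
  csent : s'.csent = s.csent
  rounds : s'.rounds = s.rounds

variable {G}

lemma LocalCost.trans {v : Fin n} {K K' : ℕ} {s s' s'' : State n} (h : LocalCost G v K s s')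
    (h' : LocalCost G v K' s' s'') : LocalCost G v (K + K') s s'' :=
  ⟨h'.range, by have := h.steps; have := h'.steps; omega,
    fun u hu => (h'.steps' u hu).trans (h.steps' u hu), h'.qsent.trans h.qsent,
    h'.qrecv.trans h.qrecv, h'.csent.trans h.csent, h'.rounds.trans h.rounds⟩

lemma LocalCost.mono {v : Fin n} {K K' : ℕ} {s s' : State n} (h : LocalCost G v K s s')
    (hK : K ≤ K') : LocalCost G v K' s s' :=
  { h with steps := h.steps.trans (by omega) }

lemma LocalCost.of_tick {v : Fin n} {s s' : State n} (h : MemRange G s')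
    (h1 : s'.steps = (s.tick v).steps) (h2 : s'.qsent = s.qsent) (h3 : s'.qrecv = s.qrecv)
    (h4 : s'.csent = s.csent) (h5 : s'.rounds = s.rounds) : LocalCost G v 1 s s' :=
  ⟨h, by rw [h1]; simp [State.tick], fun u hu => by rw [h1]; simp [State.tick, hu],
    h2, h3, h4, h5⟩

lemma branchFold_localCost {v : Fin n} {K : ℕ} {α : Type} {f : α → State n → List (State n)}
    (hf : ∀ a s, MemRange G s → ∀ s' ∈ f a s, LocalCost G v K s s') (l : List α) (s : State n)
    (hs : MemRange G s) (s' : State n) (hs' : s' ∈ branchFold f l s) :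
    LocalCost G v (l.length * K) s s' := by
  induction l generalizing s with
  | nil =>
    simp only [branchFold, List.mem_singleton] at hs'
    subst hs'
    exact ⟨hs, by simp, fun _ _ => rfl, rfl, rfl, rfl, rfl⟩
  | cons a l ih =>
    simp only [branchFold, List.mem_flatMap] at hs'
    obtain ⟨s₁, h₁, h₂⟩ := hs'
    have h₃ := hf a s hs s₁ h₁
    refine (h₃.trans (ih s₁ h₃.range h₂)).mono (le_of_eq ?_)
    rw [List.length_cons]; ring

/-- The bound `degree + 1` for all local loops is attained by the loop over the columns `0, …, d` of
the work registers. -/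
theorem exec_localCost (env : PVar → ℤ) (v : Fin n) (c : Cmd) (hc : c.Safe G env v)
    (s : State n) (hs : MemRange G s) (s' : State n) (hs' : s' ∈ c.exec env v s) :
    LocalCost G v (c.cost (G.degree v + 1)) s s' := by
  -- Upward and downward loops differ only in the value `e j` assigned to the counter, so one
  -- estimate covers both: one step for the entry and one more for each iteration.
  have loop : ∀ (c : Cmd) (x : CVar) (e : ℕ → ℤ) (m : ℕ), m ≤ G.degree v + 1 → x = .i →
      (∀ s, MemRange G s → ∀ s' ∈ c.exec env v s,
        LocalCost G v (c.cost (G.degree v + 1)) s s') → ∀ s : State n, MemRange G s →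
      ∀ s' ∈ branchFold (fun (j : ℕ) s' => c.exec env v ((s'.setVar v x (e j)).tick v))
        (List.range m) (s.tick v),
      LocalCost G v (1 + (G.degree v + 1) * (1 + c.cost (G.degree v + 1))) s s' := by
    rintro c x e m hm rfl h s hs s' hs'
    have h1 : LocalCost G v 1 s (s.tick v) := .of_tick ⟨hs.1, hs.2, hs.3, hs.4, hs.5, hs.6, hs.7⟩
      rfl rfl rfl rfl rfl
    refine (h1.trans (branchFold_localCost (K := 1 + c.cost (G.degree v + 1)) ?_ _ _ h1.range
      s' hs')).mono ?_
    · intro a s hs s' hs'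
      have h2 : LocalCost G v 1 s ((s.setVar v .i (e a)).tick v) := by
        have := hs.setVar v (x := .i) (a := e a) (by simp) (by simp) (by simp)
        exact .of_tick ⟨this.1, this.2, this.3, this.4, this.5, this.6, this.7⟩ rfl rfl rfl rfl rfl
      exact h2.trans (h _ h2.range s' hs')
    · rw [List.length_range]; gcongr
  induction c generalizing s s' with
  | skip =>
    simp only [Cmd.exec, List.mem_singleton] at hs'
    subst hs'
    exact ⟨hs, by simp, fun _ _ => rfl, rfl, rfl, rfl, rfl⟩
  | assign x e =>
    simp only [Cmd.exec, List.mem_singleton] at hs'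
    subst hs'
    have := hc s hs
    exact .of_tick ⟨this.1, this.2, this.3, this.4, this.5, this.6, this.7⟩ rfl rfl rfl rfl rfl
  | recv x e =>
    simp only [Cmd.exec, List.mem_singleton] at hs'
    subst hs'
    have := hc s hs
    exact .of_tick ⟨this.1, this.2, this.3, this.4, this.5, this.6, this.7⟩ rfl rfl rfl rfl rfl
  | prep q =>
    rw [exec_prep, List.mem_cons, List.mem_singleton] at hs'
    rcases hs' with rfl | rfl <;>
      exact .of_tick ⟨hs.1, hs.2, hs.3, hs.4, hs.5, hs.6, hs.7⟩ rfl rfl rfl rfl rfl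
  | xor f ctrl q =>
    rw [exec_xor, List.mem_singleton] at hs'
    subst hs'
    exact .of_tick ⟨hs.1, hs.2, hs.3, hs.4, hs.5, hs.6, hs.7⟩ rfl rfl rfl rfl rfl
  | gate1 U e q =>
    simp only [Cmd.exec, List.mem_singleton] at hs'
    subst hs'
    exact .of_tick ⟨hs.1, hs.2, hs.3, hs.4, hs.5, hs.6, hs.7⟩ rfl rfl rfl rfl rfl
  | gate2 U e q₀ q₁ =>
    simp only [Cmd.exec, List.mem_singleton] at hs'
    split_ifs at hs' <;> subst hs' <;>
      exact .of_tick ⟨hs.1, hs.2, hs.3, hs.4, hs.5, hs.6, hs.7⟩ rfl rfl rfl rfl rfl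
  | measure q x =>
    have h : ∀ a : ℤ, 0 ≤ a → a ≤ 1 → MemRange G (s.setVar v x a) := by
      intro a h0 h1
      rcases hc with rfl | rfl | rfl <;> exact hs.setVar v (by simp) (by simp [h0, h1]) (by simp)
    simp only [Cmd.exec, List.mem_cons, List.not_mem_nil, or_false] at hs'
    rcases hs' with rfl | rfl
    · have := h 0 (by norm_num) (by norm_num)
      exact .of_tick ⟨this.1, this.2, this.3, this.4, this.5, this.6, this.7⟩ rfl rfl rfl rfl rfl
    · have := h 1 (by norm_num) (by norm_num)
      exact .of_tick ⟨this.1, this.2, this.3, this.4, this.5, this.6, this.7⟩ rfl rfl rfl rfl rfl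
  | seq c₁ c₂ h₁ h₂ =>
    rw [Cmd.exec, List.mem_flatMap] at hs'
    obtain ⟨s₁, hs₁, hs'⟩ := hs'
    have := h₁ hc.1 s hs s₁ hs₁
    exact this.trans (h₂ hc.2 s₁ this.range s' hs')
  | ite b c₁ c₂ h₁ h₂ =>
    rw [Cmd.exec] at hs'
    have h1 : LocalCost G v 1 s (s.tick v) := .of_tick ⟨hs.1, hs.2, hs.3, hs.4, hs.5, hs.6, hs.7⟩
      rfl rfl rfl rfl rfl
    rw [Cmd.cost]
    split_ifs at hs'
    · exact (h1.trans (h₁ hc.1 _ h1.range s' hs')).mono (by omega)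
    · exact (h1.trans (h₂ hc.2 _ h1.range s' hs')).mono (by omega)
  | forUp x lo hi c h =>
    rw [Cmd.exec] at hs'
    exact loop c x _ _ (hc.2.1 s hs) hc.1 (h hc.2.2) s hs s' hs'
  | forDown x hi lo c h =>
    rw [Cmd.exec] at hs'
    exact loop c x _ _ (hc.2.1 s hs) hc.1 (h hc.2.2) s hs s' hs'

/-! ### Costs of programs run by the whole network -/

variable (G)

/-- Bound on the number of steps of a party with `L - 1` ports if the loops of the program have at
most `N` iterations. -/
def Prog.cost (N L : ℕ) : Prog → ℕ
  | .loc c => c.cost L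
  | .exchQ _ _ | .exchC _ => L
  | .seq p₁ p₂ => p₁.cost N L + p₂.cost N L
  | .forUp _ _ _ p | .forDown _ _ _ p => 1 + N * (1 + p.cost N L)

/-- Bound on the number of rounds if the loops of the program have at most `N` iterations. -/
def Prog.roundCost (N : ℕ) : Prog → ℕ
  | .loc _ => 0
  | .exchQ _ _ | .exchC _ => 1
  | .seq p₁ p₂ => p₁.roundCost N + p₂.roundCost N
  | .forUp _ _ _ p | .forDown _ _ _ p => N * p.roundCost N

/-- The program respects the ranges of the variables, and its loops have at most `N` iterations. -/
def Prog.Safe (N : ℕ) : Prog → Prop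
  | .loc c => ∀ env v, c.Safe G env v
  | .exchQ _ _ => True
  | .exchC x => x = .zmax
  | .seq p₁ p₂ => p₁.Safe N ∧ p₂.Safe N
  | .forUp x lo hi p | .forDown x hi lo p => x ≠ .N ∧
      (∀ env, env .N = (N : ℤ) → (hi.eval env - lo.eval env + 1).toNat ≤ N) ∧ p.Safe N

/-- Invariant for the counters. -/
structure Sound (s : State n) : Prop where
  range : MemRange G s
  qubits : ∀ v, s.qsent v + s.qrecv v ≤ 4 * G.degree v * s.rounds
  total : ∀ v, s.qsent v + s.csent v ≤ 5 * G.degree v * s.rounds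

structure NetCost (K : ℕ → ℕ) (r : ℕ) (s s' : State n) : Prop where
  sound : Sound G s'
  steps : ∀ v, s'.steps v ≤ s.steps v + K (G.degree v + 1)
  rounds : s'.rounds ≤ s.rounds + r

variable {G}

lemma NetCost.trans {K K' : ℕ → ℕ} {r r' : ℕ} {s s' s'' : State n} (h : NetCost G K r s s')
    (h' : NetCost G K' r' s' s'') : NetCost G (fun L => K L + K' L) (r + r') s s'' :=
  ⟨h'.sound, fun v => by have := h.steps v; have := h'.steps v; omega,
    by have := h.rounds; have := h'.rounds; omega⟩

lemma NetCost.mono {K K' : ℕ → ℕ} {r r' : ℕ} {s s' : State n} (h : NetCost G K r s s')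
    (hK : ∀ L, K L ≤ K' L) (hr : r ≤ r') : NetCost G K' r' s s' :=
  ⟨h.sound, fun v => (h.steps v).trans (by have := hK (G.degree v + 1); omega),
    h.rounds.trans (by omega)⟩

lemma branchFold_netCost {K : ℕ → ℕ} {r : ℕ} {α : Type} {f : α → State n → List (State n)}
    (hf : ∀ a s, Sound G s → ∀ s' ∈ f a s, NetCost G K r s s') (l : List α) (s : State n)
    (hs : Sound G s) (s' : State n) (hs' : s' ∈ branchFold f l s) :
    NetCost G (fun L => l.length * K L) (l.length * r) s s' := by
  induction l generalizing s with
  | nil =>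
    simp only [branchFold, List.mem_singleton] at hs'
    subst hs'
    exact ⟨hs, by simp, by simp⟩
  | cons a l ih =>
    simp only [branchFold, List.mem_flatMap] at hs'
    obtain ⟨s₁, h₁, h₂⟩ := hs'
    have h₃ := hf a s hs s₁ h₁
    refine (h₃.trans (ih s₁ h₃.sound h₂)).mono (fun L => le_of_eq ?_) (le_of_eq ?_) <;>
    · rw [List.length_cons]; ring

lemma branchFold_finRange_localCost {K : ℕ → ℕ} {f : Fin n → State n → List (State n)}
    (hf : ∀ v s, MemRange G s → ∀ s' ∈ f v s, LocalCost G v (K (G.degree v + 1)) s s')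
    (l : List (Fin n)) (hl : l.Nodup) (s : State n)
    (hs : Sound G s) (s' : State n) (hs' : s' ∈ branchFold f l s) :
    Sound G s' ∧ (∀ v, s'.steps v ≤ s.steps v + if v ∈ l then K (G.degree v + 1) else 0) ∧
      s'.rounds = s.rounds := by
  induction l generalizing s with
  | nil =>
    simp only [branchFold, List.mem_singleton] at hs'
    subst hs'
    exact ⟨hs, by simp, by simp⟩
  | cons a l ih =>
    simp only [branchFold, List.mem_flatMap] at hs'
    obtain ⟨s₁, h₁, h₂⟩ := hs'
    have h₃ := hf a s hs.range s₁ h₁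
    rw [List.nodup_cons] at hl
    obtain ⟨h4, h5, h6⟩ := ih hl.2 s₁ ⟨h₃.range,
      by rw [h₃.qsent, h₃.qrecv, h₃.rounds]; exact hs.qubits,
      by rw [h₃.qsent, h₃.csent, h₃.rounds]; exact hs.total⟩ h₂
    refine ⟨h4, fun v => ?_, h6.trans h₃.rounds⟩
    have := h5 v
    by_cases hv : v = a
    · subst hv
      have h7 := h₃.steps
      simp only [hl.1, if_false] at this
      simp only [List.mem_cons_self, if_true]
      omega
    · rw [h₃.steps' v hv] at this
      simpa [hv] using this

/-- A sign bit and two binary digits. -/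
lemma bitLen_le {a : ℤ} (h : -1 ≤ a ∧ a ≤ 3) : bitLen a ≤ 3 := by
  obtain ⟨h1, h2⟩ := h
  unfold bitLen
  have : a.natAbs.size ≤ 2 := Nat.size_le.2 (by omega)
  omega

theorem run_netCost (N : ℕ) (p : Prog) (hp : p.Safe G N) (env : PVar → ℤ) (henv : env .N = N)
    (s : State n) (hs : Sound G s) (s' : State n) (hs' : s' ∈ p.run G σ env s) :
    NetCost G (p.cost N) (p.roundCost N) s s' := by
  have loop : ∀ (p : Prog) (x : PVar) (e : ℕ → ℤ) (m : ℕ), m ≤ N → x ≠ .N →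
      (∀ env : PVar → ℤ, env .N = N → ∀ s, Sound G s → ∀ s' ∈ p.run G σ env s,
        NetCost G (p.cost N) (p.roundCost N) s s') →
      ∀ env : PVar → ℤ, env .N = N → ∀ s : State n, Sound G s →
      ∀ s' ∈ branchFold (fun (j : ℕ) s' => p.run G σ (Function.update env x (e j)) s'.tickAll)
        (List.range m) s.tickAll,
      NetCost G (fun L => 1 + N * (1 + p.cost N L)) (N * p.roundCost N) s s' := by
    intro p x e m hm hx h env henv s hs s' hs'
    have tick : ∀ s : State n, Sound G s → NetCost G (fun _ => 1) 0 s s.tickAll := fun s hs =>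
      ⟨⟨⟨hs.1.1, hs.1.2, hs.1.3, hs.1.4, hs.1.5, hs.1.6, hs.1.7⟩, hs.2, hs.3⟩,
        fun v => le_rfl, le_rfl⟩
    refine ((tick s hs).trans (branchFold_netCost (K := fun L => 1 + p.cost N L)
      (r := 0 + p.roundCost N) ?_ _ _ (tick s hs).sound s' hs')).mono ?_ ?_
    · intro a s hs s' hs'
      refine (tick s hs).trans (h _ ?_ _ (tick s hs).sound s' hs')
      rw [Function.update_of_ne hx.symm, henv]
    · intro L
      rw [List.length_range]; gcongr
    · rw [List.length_range, zero_add, zero_add]; gcongr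
  induction p generalizing env s s' with
  | loc c =>
    rw [Prog.run] at hs'
    obtain ⟨h1, h2, h3⟩ := branchFold_finRange_localCost (K := fun L => c.cost L)
      (fun v s hs s' hs' => exec_localCost env v c (hp env v) s hs s' hs') _
      (List.nodup_finRange n) s hs s' hs'
    exact ⟨h1, by simpa [Prog.cost] using h2, h3.le⟩
  | exchQ a e =>
    simp only [Prog.run, List.mem_singleton] at hs'
    subst hs'
    refine ⟨⟨⟨hs.1.1, hs.1.2, hs.1.3, hs.1.4, hs.1.5, hs.1.6, hs.1.7⟩, fun v => ?_, fun v => ?_⟩,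
      fun v => le_rfl, le_rfl⟩
    · have := hs.qubits v
      simp only
      linarith
    · have := hs.total v
      simp only
      linarith
  | exchC x =>
    obtain rfl : x = .zmax := hp
    simp only [Prog.run, List.mem_singleton] at hs'
    subst hs'
    refine ⟨⟨⟨hs.1.1, hs.1.2, hs.1.3, hs.1.4, hs.1.5, hs.1.6, fun v i => ?_⟩,
      fun v => ?_, fun v => ?_⟩, fun v => le_rfl, le_rfl⟩
    · simp only
      split
      · exact hs.range.zmax _
      · norm_num
    · have := hs.qubits v
      simp only
      linarith
    -- A classical round costs at most 3 bits per port and a quantum round 2 qubits per port; the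
    -- factor 5 in `Sound` covers either kind.
    · have := hs.total v
      have h3 := Nat.mul_le_mul_left (G.degree v) (bitLen_le (hs.range.zmax v))
      simp only
      linarith
  | seq p₁ p₂ h₁ h₂ =>
    rw [Prog.run, List.mem_flatMap] at hs'
    obtain ⟨s₁, hs₁, hs'⟩ := hs'
    have := h₁ hp.1 env henv s hs s₁ hs₁
    exact this.trans (h₂ hp.2 env henv s₁ this.sound s' hs')
  | forUp x lo hi p h =>
    rw [Prog.run] at hs'
    exact loop p x _ _ (hp.2.1 env henv) hp.1 (h hp.2.2) env henv s hs s' hs'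
  | forDown x hi lo p h =>
    rw [Prog.run] at hs'
    exact loop p x _ _ (hp.2.1 env henv) hp.1 (h hp.2.2) env henv s hs s' hs'

-- The only values that could grow are those of `z`, `zmax`, `y` and the messages. They stay in
-- `[-1, 3]` because `z` is `-1` or a two-bit number, and copying or taking maxima does not leave
-- the interval.
open AlgI in
lemma algorithmI_safe (N : ℕ) : algorithmI.Safe G N := by
  have hz1 : ∀ (env : PVar → ℤ) (v : Fin n), (Cmd.assign .z (.add (.add (cv .b0) (cv .b0))
      (cv .b1))).Safe G env v := by
    intro env v s hs
    refine hs.setVar v (by simp) (by simp) fun _ => ?_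
    have h0 := hs.b0 v
    have h1 := hs.b1 v
    simp only [Expr.eval, cv, State.look, Sum.elim_inr]
    omega
  have hz2 : ∀ (env : PVar → ℤ) (v : Fin n), (Cmd.assign .z (num (-1))).Safe G env v :=
    fun env v s hs => hs.setVar v (by simp) (by simp) fun _ => by simp [Expr.eval, num]
  have hz3 : ∀ (env : PVar → ℤ) (v : Fin n), (Cmd.assign .zmax (cv .z)).Safe G env v :=
    fun env v s hs => hs.setVar v (by simp) (by simp) fun _ => hs.z v
  have hz4 : ∀ (env : PVar → ℤ) (v : Fin n),
      (Cmd.assign .zmax (.max (cv .zmax) (cv .y))).Safe G env v := by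
    intro env v s hs
    refine hs.setVar v (by simp) (by simp) fun _ => ?_
    have h0 := hs.zmax v
    have h1 := hs.y v
    simp only [Expr.eval, cv, State.look, Sum.elim_inr]
    omega
  have hz5 : ∀ (env : PVar → ℤ) (v : Fin n), (Cmd.recv .y ii).Safe G env v :=
    fun env v s hs => hs.setVar v (by simp) (by simp) fun _ => hs.inbox v _
  have hz6 : ∀ (env : PVar → ℤ) (v : Fin n), (Cmd.assign .status (num 0)).Safe G env v :=
    fun env v s hs => hs.setVar v (by simp) (by simp) (by simp)
  have hl : ∀ (env : PVar → ℤ) (v : Fin n) (s : State n), MemRange G s →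
      dd.eval (s.look env v) = G.degree v := fun env v s hs => hs.d v
  simp only [algorithmI, phase, Prog.Safe, Cmd.Safe, prepPhase, subA, subAprep, checkPhase,
    measPhase, subC, dropPhase, prep2, subAinit, cnot, AlgI.flip, copyOut, copy2, collect, circ2,
    flipIfCross, collectInv, copyOutInv, subB, pN1, true_and, and_true, implies_true, and_self,
    ne_eq, reduceCtorEq, not_false_eq_true, or_true, true_or]
  have loops : ∀ (env : PVar → ℤ) (v : Fin n) (s : State n), MemRange G s →
      (dd.eval (s.look env v) - (num 1).eval (s.look env v) + 1).toNat ≤ G.degree v + 1 ∧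
      (dd.eval (s.look env v) - (num 0).eval (s.look env v) + 1).toNat ≤ G.degree v + 1 := by
    intro env v s hs
    rw [hl env v s hs]
    simp only [Expr.eval, num]
    omega
  and_intros
  all_goals first
    | (intro env henv; simp only [Expr.eval, henv]; omega)
    | (intro env v
       and_intros
       all_goals first
         | exact hz1 env v
         | exact hz2 env v
         | exact hz3 env v
         | exact hz4 env v
         | exact hz5 env v
         | exact hz6 env v
         | exact fun s hs => (loops env v s hs).1
         | exact fun s hs => (loops env v s hs).2)

lemma sound_initState : Sound G (initState G) :=
  ⟨⟨fun _ => rfl, by simp [initState], by simp [initState], by simp [initState],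
    by simp [initState], by simp [initState], by simp [initState]⟩, by simp [initState],
    by simp [initState]⟩

open AlgI in
theorem algorithmI_resources (N : ℕ) (hN : 1 ≤ N) (s : State n)
    (hs : s ∈ algorithmI.outcomes G σ N) :
    s.rounds ≤ 1000 * N ^ 2 ∧
    (∀ v, s.steps v ≤ 1000 * (max G.maxDegree 1 * N ^ 2)) ∧
    (∀ v, s.qsent v + s.qrecv v ≤ 1000 * (G.degree v * N ^ 2)) ∧
    ∑ v, (s.qsent v + s.csent v) ≤ 1000 * (G.edgeFinset.card * N ^ 2) := by
  have h := run_netCost σ N algorithmI (algorithmI_safe N) _ rfl _ sound_initState s hs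
  -- Each of at most `N` phases has three communicating loops: forward and backward in Subroutine A,
  -- and Subroutine C.
  have hr : s.rounds ≤ 3 * N ^ 2 := by
    refine h.rounds.trans (le_of_eq ?_)
    simp [initState, algorithmI, phase, Prog.roundCost, subA, subAprep, subC]
    ring
  refine ⟨by omega, fun v => ?_, fun v => ?_, ?_⟩
  · have h1 := h.steps v
    have h2 : algorithmI.cost N (G.degree v + 1) ≤ 500 * ((G.degree v + 1) * N ^ 2) := by
      simp only [algorithmI, phase, Prog.cost, Cmd.cost, prepPhase, subA, subAprep, checkPhase,
        measPhase, subC, dropPhase, prep2, subAinit, cnot, AlgI.flip, copyOut, copy2, collect,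
        circ2, flipIfCross, collectInv, copyOutInv, subB]
      have hL : 1 ≤ G.degree v + 1 := by omega
      generalize G.degree v + 1 = L at hL ⊢
      -- With `N, L ≥ 1` every monomial of the cost polynomial is dominated by `L * N ^ 2`; then
      -- only its coefficients have to be added up.
      have e1 : N * N ≤ L * N ^ 2 := by nlinarith [Nat.mul_le_mul_right (N ^ 2) hL]
      have e2 : N ≤ N * N := Nat.le_mul_of_pos_left _ hN
      have e3 : N * L ≤ L * N ^ 2 := by nlinarith [Nat.mul_le_mul_left L e2]
      have e4 : L ≤ N * L := Nat.le_mul_of_pos_left _ hN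
      ring_nf
      ring_nf at e1 e2 e3 e4
      linarith
    have h3 : G.degree v ≤ G.maxDegree := G.degree_le_maxDegree v
    -- The maximum with 1 is needed for the isolated vertex, whose party still performs steps.
    have h4 : G.degree v + 1 ≤ 2 * max G.maxDegree 1 := by omega
    have h5 := Nat.mul_le_mul_right (N ^ 2) h4
    simp only [initState] at h1
    linarith
  · have h1 := h.sound.qubits v
    have h2 := Nat.mul_le_mul_left (4 * G.degree v) hr
    have h3 : 0 ≤ G.degree v * N ^ 2 := Nat.zero_le _
    linarith
  · calc ∑ v, (s.qsent v + s.csent v) ≤ ∑ v, 5 * G.degree v * s.rounds :=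
        Finset.sum_le_sum fun v _ => h.sound.total v
      _ = 5 * (2 * G.edgeFinset.card) * s.rounds := by
        rw [← G.sum_degrees_eq_twice_card_edges, Finset.mul_sum, Finset.sum_mul]
      _ ≤ 5 * (2 * G.edgeFinset.card) * (3 * N ^ 2) := Nat.mul_le_mul_left _ hr
      _ ≤ _ := by
        have h3 : 0 ≤ G.edgeFinset.card * N ^ 2 := Nat.zero_le _
        linarith

end Resources


/-! ### Reversible classical code -/

section Reversible

variable {n : ℕ}

/-- Composition of `g 0, …, g (k - 1)`, with `g 0` applied first. -/
def iter {α : Type*} (g : ℕ → α → α) : ℕ → α → α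
  | 0 => id
  | k + 1 => g k ∘ iter g k

lemma iter_succ' {α : Type*} (g : ℕ → α → α) (k : ℕ) :
    iter g (k + 1) = iter (fun j => g (j + 1)) k ∘ g 0 := by
  induction k with
  | zero => rfl
  | succ k ih =>
    rw [iter, ih]; rfl

lemma iter_congr {α : Type*} {g h : ℕ → α → α} {k : ℕ} (H : ∀ j < k, g j = h j) :
    iter g k = iter h k := by
  induction k with
  | zero => rfl
  | succ k ih => rw [iter, iter, H k (by omega), ih fun j hj => H j (by omega)]

/-- The first factor of the reversed product meets the last factor of the forward product and
cancels it; the rest is the same statement with one factor fewer. -/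
lemma iter_reverse_comp {α : Type*} {g h : ℕ → α → α} (k : ℕ)
    (H : ∀ j < k, h j ∘ g j = id) : iter (fun j => h (k - 1 - j)) k ∘ iter g k = id := by
  induction k with
  | zero => rfl
  | succ k ih =>
    rw [iter_succ', iter]
    have h1 : iter (fun j => h (k + 1 - 1 - (j + 1))) k = iter (fun j => h (k - 1 - j)) k :=
      iter_congr fun j _ => by congr 1; omega
    have h2 : h k ∘ g k = id := H k (by omega)
    funext x
    have h2' : ∀ y, h k (g k y) = y := fun y => congrFun h2 y
    simp only [Function.comp, Nat.add_sub_cancel, Nat.sub_zero, h2']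
    exact congrFun (h1 ▸ ih fun j hj => H j (by omega)) x

lemma iter_induction {α : Type*} {g : ℕ → α → α} (P : (α → α) → Prop) (h0 : P id)
    (h : ∀ j f, P f → P (g j ∘ f)) (k : ℕ) : P (iter g k) := by
  induction k with
  | zero => exact h0
  | succ k ih => exact h k _ ih

/-- The quantum state is `φ`, and the memories and messages are `mem` and `ib` but for the variable
`i` of the parties in `U`. -/
def IsState (U : Set (Fin n)) (φ : Conf n →₀ ℂ) (mem : Fin n → CVar → ℤ) (ib : Fin n → ℤ → ℤ)
    (κ : Core n) : Prop :=
  κ.ψ = φ ∧ κ.inbox = ib ∧ ∀ u x, ¬(u ∈ U ∧ x = .i) → κ.mem u x = mem u x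

/-- Whenever the memory of `v` satisfies `M`, the code `c` applies `g` to the qubits of `v` and
changes at most the variable `i`. -/
def Cmd.Acts (env : PVar → ℤ) (v : Fin n) (M : (CVar → ℤ) → Prop) (c : Cmd)
    (g : (Qubit → Bool) → (Qubit → Bool)) : Prop :=
  ∀ φ mem ib, Cmd.Triple env v (fun κ => IsState {v} φ mem ib κ ∧ M (κ.mem v)) c
    (fun κ => IsState {v} (φ.mapDomain (onParty v g)) mem ib κ ∧ M (κ.mem v))

namespace Cmd.Acts

variable {env : PVar → ℤ} {v : Fin n} {M : (CVar → ℤ) → Prop}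

lemma xor {m : ℕ} {f : (Fin m → Bool) → Bool} {ctrl : Fin m → QRef} {q : QRef}
    (ctrl' : Fin m → Qubit) (q' : Qubit)
    (h : ∀ mv, M mv → (∀ j, (ctrl j).eval (Sum.elim env mv) = ctrl' j) ∧
      q.eval (Sum.elim env mv) = q') :
    Acts env v M (.xor f ctrl q) (xorMap f ctrl' q') := by
  intro φ mem ib
  refine Cmd.Triple.xor ?_
  rintro κ ⟨⟨rfl, h1, h2⟩, h3⟩
  obtain ⟨h4, h5⟩ := h _ h3
  refine ⟨⟨?_, h1, h2⟩, h3⟩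
  simp only [Core.look, h4, h5]

lemma seq {c₁ c₂ : Cmd} {g₁ g₂ : (Qubit → Bool) → (Qubit → Bool)} (h₁ : Acts env v M c₁ g₁)
    (h₂ : Acts env v M c₂ g₂) : Acts env v M (.seq c₁ c₂) (g₂ ∘ g₁) := by
  intro φ mem ib
  refine (h₁ φ mem ib).seq ((h₂ _ mem ib).post fun κ => ?_)
  rw [← Finsupp.mapDomain_comp, onParty_comp]
  exact id

lemma ite_pos {b : Cond} {c₁ c₂ : Cmd} {g : (Qubit → Bool) → (Qubit → Bool)}
    (hb : ∀ mv, M mv → b.holds (Sum.elim env mv)) (h : Acts env v M c₁ g) :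
    Acts env v M (.ite b c₁ c₂) g := by
  intro φ mem ib
  exact .ite ((h φ mem ib).pre fun κ hκ => hκ.1)
    fun s hs => absurd (hb _ hs.1.2) hs.2

lemma ite_neg {b : Cond} {c₁ c₂ : Cmd} {g : (Qubit → Bool) → (Qubit → Bool)}
    (hb : ∀ mv, M mv → ¬b.holds (Sum.elim env mv)) (h : Acts env v M c₂ g) :
    Acts env v M (.ite b c₁ c₂) g := by
  intro φ mem ib
  exact .ite (fun s hs => absurd hs.2 (hb _ hs.1.2)) ((h φ mem ib).pre fun κ hκ => hκ.1)

lemma isState_setVar {φ : Conf n →₀ ℂ} {mem : Fin n → CVar → ℤ} {ib : Fin n → ℤ → ℤ}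
    {κ : Core n} (h : IsState {v} φ mem ib κ) (a : ℤ) :
    IsState {v} φ mem ib (κ.setVar v .i a) := by
  refine ⟨h.1, h.2.1, fun u x hux => ?_⟩
  rw [Core.setVar_mem, if_neg (by simpa using hux)]
  exact h.2.2 u x hux

lemma mem_setVar (κ : Core n) (x : CVar) (a : ℤ) :
    (κ.setVar v x a).mem v = Function.update (κ.mem v) x a := by
  simp [Core.setVar]

lemma forUp {lo hi : LExpr} {c : Cmd} (a b : ℤ) (g : ℕ → (Qubit → Bool) → (Qubit → Bool))
    (hM : ∀ mv a, M mv → M (Function.update mv .i a))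
    (hb : ∀ mv, M mv → lo.eval (Sum.elim env mv) = a ∧ hi.eval (Sum.elim env mv) = b)
    (h : ∀ j : ℕ, a + j ≤ b → Acts env v (fun mv => M mv ∧ mv .i = a + j) c (g j)) :
    Acts env v M (.forUp .i lo hi c) (iter g (b - a + 1).toNat) := by
  intro φ mem ib
  refine Cmd.Triple.forUp (I := fun j κ => IsState {v} (φ.mapDomain (onParty v (iter g j))) mem ib κ
    ∧ M (κ.mem v)) a b (fun j κ y hκ => ?_) (fun j hj => ?_) fun κ hκ => ?_
  · exact ⟨isState_setVar hκ.1 y, by rw [mem_setVar]; exact hM _ _ hκ.2⟩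
  · refine (h j hj _ mem ib).conseq (fun κ hκ => ⟨hκ.1.1, hκ.1.2, hκ.2⟩) fun κ hκ => ?_
    refine ⟨?_, hκ.2.1⟩
    rw [iter, ← onParty_comp, Finsupp.mapDomain_comp]
    exact hκ.1
  · refine ⟨(hb _ hκ.2).1, (hb _ hκ.2).2, ?_, hκ.2⟩
    rw [iter, onParty_id, Finsupp.mapDomain_id]
    exact hκ.1

lemma forDown {lo hi : LExpr} {c : Cmd} (a b : ℤ) (g : ℕ → (Qubit → Bool) → (Qubit → Bool))
    (hM : ∀ mv a, M mv → M (Function.update mv .i a))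
    (hb : ∀ mv, M mv → lo.eval (Sum.elim env mv) = a ∧ hi.eval (Sum.elim env mv) = b)
    (h : ∀ j : ℕ, a ≤ b - j → Acts env v (fun mv => M mv ∧ mv .i = b - j) c (g j)) :
    Acts env v M (.forDown .i hi lo c) (iter g (b - a + 1).toNat) := by
  intro φ mem ib
  refine Cmd.Triple.forDown (I := fun j κ => IsState {v} (φ.mapDomain (onParty v (iter g j))) mem ib
    κ ∧ M (κ.mem v)) a b (fun j κ y hκ => ?_) (fun j hj => ?_) fun κ hκ => ?_
  · exact ⟨isState_setVar hκ.1 y, by rw [mem_setVar]; exact hM _ _ hκ.2⟩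
  · refine (h j hj _ mem ib).conseq (fun κ hκ => ⟨hκ.1.1, hκ.1.2, hκ.2⟩) fun κ hκ => ?_
    refine ⟨?_, hκ.2.1⟩
    rw [iter, ← onParty_comp, Finsupp.mapDomain_comp]
    exact hκ.1
  · refine ⟨(hb _ hκ.2).1, (hb _ hκ.2).2, ?_, hκ.2⟩
    rw [iter, onParty_id, Finsupp.mapDomain_id]
    exact hκ.1

end Cmd.Acts

/-! ### Programs that act by maps on basis states -/

variable (G : SimpleGraph (Fin n)) [DecidableRel G.Adj] (σ : PortNumbering G)

/-- The program applies `F` to the basis states and changes at most the variables `i`, provided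
that the memory of each party `v` satisfies `M v`. -/
def Prog.Acts (env : PVar → ℤ) (M : Fin n → (CVar → ℤ) → Prop) (p : Prog)
    (F : Conf n → Conf n) : Prop :=
  ∀ φ mem ib, Prog.Triple G σ env
    (fun κ => IsState Set.univ φ mem ib κ ∧ ∀ v, M v (κ.mem v)) p
    (fun κ => IsState Set.univ (φ.mapDomain F) mem ib κ ∧ ∀ v, M v (κ.mem v))

/-- Apply `g v` to the qubits of party `v`, for all `v`. -/
def onAll (g : Fin n → (Qubit → Bool) → (Qubit → Bool)) (c : Conf n) : Conf n :=
  fun v => g v (c v)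

namespace Prog.Acts

variable {G σ} {env : PVar → ℤ} {M : Fin n → (CVar → ℤ) → Prop}

/-- The maps of different parties touch disjoint sets of qubits. After the parties in `D` have
acted, the total effect is `onAll` with the identity outside `D`. -/
lemma loc {c : Cmd} {g : Fin n → (Qubit → Bool) → (Qubit → Bool)}
    (h : ∀ v, Cmd.Acts env v (M v) c (g v)) : Acts G σ env M (.loc c) (onAll g) := by
  intro φ mem ib
  refine (Prog.Triple.loc (fun D κ => IsState Set.univ
    (φ.mapDomain (onAll fun v => if v ∈ D then g v else id)) mem ib κ ∧
      ∀ v, M v (κ.mem v)) ?_).conseq (fun κ hκ => ?_) (fun κ hκ => ?_)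
  · intro D v hv s ⟨⟨h1, h2, h3⟩, h4⟩ s' hs' h0
    obtain ⟨⟨h5, h6, h7⟩, h8⟩ := h v _ s.core.mem s.core.inbox s
      ⟨⟨h1, rfl, fun _ _ _ => rfl⟩, h4 v⟩ s' hs' h0
    refine ⟨⟨?_, h6.trans h2, fun u x hx => ?_⟩, fun u => ?_⟩
    · rw [h5, ← Finsupp.mapDomain_comp]
      congr 1
      funext c u
      by_cases hu : u = v
      · subst hu; simp [onParty, onAll, hv]
      · simp [onParty, onAll, hu]
    · rw [h7 u x fun hh => hx ⟨trivial, hh.2⟩, h3 u x hx]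
    · by_cases hu : u = v
      · subst hu; exact h8
      · have : s'.core.mem u = s.core.mem u := funext fun x => h7 u x fun hh => hu hh.1
        rw [this]; exact h4 u
  · refine ⟨?_, hκ.2⟩
    have : (onAll fun v => if v ∈ (∅ : Finset (Fin n)) then g v else id) = id := by
      funext c v; simp [onAll]
    rw [this, Finsupp.mapDomain_id]
    exact hκ.1
  · simpa using hκ

lemma exchQ {a : QName} {e : Expr PVar} :
    Acts G σ env M (.exchQ a e) (exchConf G σ a (e.eval env)) := by
  intro φ mem ib
  refine Prog.Triple.exchQ ?_
  rintro κ ⟨⟨rfl, h1, h2⟩, h3⟩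
  exact ⟨⟨rfl, h1, h2⟩, h3⟩

lemma seq {p₁ p₂ : Prog} {F₁ F₂ : Conf n → Conf n} (h₁ : Acts G σ env M p₁ F₁)
    (h₂ : Acts G σ env M p₂ F₂) : Acts G σ env M (.seq p₁ p₂) (F₂ ∘ F₁) := by
  intro φ mem ib
  refine (h₁ φ mem ib).seq ((h₂ _ mem ib).post fun κ => ?_)
  rw [← Finsupp.mapDomain_comp]
  exact id

lemma forUp {x : PVar} {lo hi : Expr PVar} {p : Prog} (F : ℕ → Conf n → Conf n)
    (h : ∀ j : ℕ, lo.eval env + j ≤ hi.eval env →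
      Acts G σ (Function.update env x (lo.eval env + j)) M p (F j)) :
    Acts G σ env M (.forUp x lo hi p) (iter F (hi.eval env - lo.eval env + 1).toNat) := by
  intro φ mem ib
  refine (Prog.Triple.forUp (I := fun j κ => IsState Set.univ (φ.mapDomain (iter F j)) mem ib κ ∧
    ∀ v, M v (κ.mem v)) fun j hj => (h j hj _ mem ib).post fun κ => ?_).pre fun κ => ?_
  · rw [← Finsupp.mapDomain_comp]
    exact id
  · rw [iter, Finsupp.mapDomain_id]; exact id

lemma forDown {x : PVar} {lo hi : Expr PVar} {p : Prog} (F : ℕ → Conf n → Conf n)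
    (h : ∀ j : ℕ, lo.eval env ≤ hi.eval env - j →
      Acts G σ (Function.update env x (hi.eval env - j)) M p (F j)) :
    Acts G σ env M (.forDown x hi lo p) (iter F (hi.eval env - lo.eval env + 1).toNat) := by
  intro φ mem ib
  refine (Prog.Triple.forDown (I := fun j κ => IsState Set.univ (φ.mapDomain (iter F j)) mem ib κ ∧
    ∀ v, M v (κ.mem v)) fun j hj => (h j hj _ mem ib).post fun κ => ?_).pre fun κ => ?_
  · rw [← Finsupp.mapDomain_comp]
    exact id
  · rw [iter, Finsupp.mapDomain_id]; exact id

end Prog.Acts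

end Reversible

/-! ### Spreading of information -/

/-- What a party learns from its neighbours in each round is known to all parties after `N - 1`
rounds. -/
theorem spread {n N : ℕ} {G : SimpleGraph (Fin n)} (hG : G.Connected) (hN : n ≤ N)
    {P : ℕ → Fin n → Prop} (h : ∀ j v, j < N - 1 → (P (j + 1) v ↔ P j v ∨ ∃ u, G.Adj v u ∧ P j u))
    (v : Fin n) : P (N - 1) v ↔ ∃ u, P 0 u := by
  constructor
  · have : ∀ j ≤ N - 1, ∀ v, P j v → ∃ u, P 0 u := by
      intro j
      induction j with
      | zero => exact fun _ v hv => ⟨v, hv⟩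
      | succ j ih =>
        intro hj v hv
        rcases (h j v (by omega)).1 hv with hv | ⟨u, -, hu⟩
        · exact ih (by omega) v hv
        · exact ih (by omega) u hu
    exact this _ le_rfl v
  · rintro ⟨u, hu⟩
    have mono : ∀ i j v, i ≤ j → j ≤ N - 1 → P i v → P j v := by
      intro i j v hij
      induction j, hij using Nat.le_induction with
      | base => exact fun _ => id
      | succ j hij ih => exact fun hj hv => (h j v (by omega)).2 (.inl (ih (by omega) hv))
    -- Knowledge at the end of a walk moves one edge backwards in each round, hence arrives at its
    -- start after as many rounds as it has edges.
    have walk : ∀ {v u : Fin n} (w : G.Walk v u), w.length ≤ N - 1 → P 0 u → P w.length v := by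
      intro v u w
      induction w with
      | nil => exact fun _ => id
      | cons hadj w ih =>
        intro hl hu
        rw [SimpleGraph.Walk.length_cons] at hl ⊢
        exact (h _ _ (by omega)).2 (.inr ⟨_, hadj, ih (by omega) hu⟩)
    -- A path visits no vertex twice, so it has at most `n - 1 ≤ N - 1` edges; `mono` fills the
    -- remaining rounds.
    obtain ⟨w, hw⟩ := (hG.preconnected v u).exists_isPath
    have hlen := hw.length_lt
    rw [Fintype.card_fin] at hlen
    exact mono _ _ v (by omega) le_rfl (walk w (by omega) hu)


/-! ### The gates of Subroutine A -/

section Gates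

lemma xorMap_of_notMem {m : ℕ} {f : (Fin m → Bool) → Bool} {ctrl : Fin m → Qubit} {q : Qubit}
    (h : ∀ j, ctrl j ≠ q) (l : Qubit → Bool) :
    xorMap f ctrl q l = Function.update l q (l q ^^ f fun j => l (ctrl j)) := by
  rw [xorMap, if_neg (by simpa using h)]

lemma xorMap_apply_of_ne {m : ℕ} (f : (Fin m → Bool) → Bool) (ctrl : Fin m → Qubit) {q r : Qubit}
    (h : r ≠ q) (l : Qubit → Bool) : xorMap f ctrl q l r = l r := by
  unfold xorMap
  split_ifs
  · rfl
  · simp [h]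

/-- Neither gate reads or writes the target of the other. The gates on the high and the low bit of a
register are of this kind, so their product is again an involution. -/
lemma xorMap_comm {m m' : ℕ} {f : (Fin m → Bool) → Bool} {ctrl : Fin m → Qubit} {q : Qubit}
    {f' : (Fin m' → Bool) → Bool} {ctrl' : Fin m' → Qubit} {q' : Qubit}
    (h : ∀ j, ctrl j ≠ q') (h' : ∀ j, ctrl' j ≠ q) (hq : q ≠ q') :
    xorMap f ctrl q ∘ xorMap f' ctrl' q' = xorMap f' ctrl' q' ∘ xorMap f ctrl q := by
  funext l r
  by_cases h1 : ∃ j, ctrl j = q <;> by_cases h2 : ∃ j, ctrl' j = q' <;>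
    simp only [Function.comp, xorMap, h1, h2, if_true, if_false]
  have e1 : ∀ j, ctrl j ≠ q := by simpa using h1
  have e2 : ∀ j, ctrl' j ≠ q' := by simpa using h2
  simp only [Function.update_apply, h, h', if_false, hq, hq.symm]
  by_cases hr : r = q
  · subst hr; simp [hq]
  · simp [hr]

/-- `g` neither reads nor changes the qubit `q`. -/
def Ignores (q : Qubit) (g : (Qubit → Bool) → (Qubit → Bool)) : Prop :=
  ∀ l b, g (Function.update l q b) = Function.update (g l) q b

lemma Ignores.id (q : Qubit) : Ignores q id := fun _ _ => rfl

lemma Ignores.comp {q : Qubit} {g h : (Qubit → Bool) → (Qubit → Bool)} (hg : Ignores q g)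
    (hh : Ignores q h) : Ignores q (g ∘ h) := fun l b => by
  simp only [Function.comp, hh l b, hg (h l) b]

lemma Ignores.iter {q : Qubit} {g : ℕ → (Qubit → Bool) → (Qubit → Bool)}
    (hg : ∀ j, Ignores q (g j)) (k : ℕ) : Ignores q (iter g k) :=
  iter_induction _ (.id q) (fun j _ hf => (hg j).comp hf) k

lemma Ignores.xorMap {m : ℕ} {f : (Fin m → Bool) → Bool} {ctrl : Fin m → Qubit} {q r : Qubit}
    (h : ∀ j, ctrl j ≠ r) (hq : q ≠ r) : Ignores r (xorMap f ctrl q) := by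
  intro l b
  unfold QLE.xorMap
  split_ifs with hc
  · rfl
  · simp only [Function.update_apply, h, hq, if_false]
    exact (Function.update_comm hq _ _ _).symm

/-- A two-qubit register. -/
abbrev reg (nm : QName) (t i : ℤ) (b : Bool) : Qubit := ⟨nm, t, i, b⟩

def cnotMap (x q : Qubit) : (Qubit → Bool) → (Qubit → Bool) :=
  xorMap (m := 1) (fun b => b 0) (fun _ => x) q

def flipMap (q : Qubit) : (Qubit → Bool) → (Qubit → Bool) :=
  xorMap (m := 0) (fun _ => true) Fin.elim0 q

def copy2Map (x q : Bool → Qubit) : (Qubit → Bool) → (Qubit → Bool) :=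
  cnotMap (x false) (q false) ∘ cnotMap (x true) (q true)

def circGate (x y w : Bool → Qubit) (hi : Bool) : (Qubit → Bool) → (Qubit → Bool) :=
  xorMap (m := 4)
    (fun b => ((Sym.ofBits (b 0) (b 1)).circ (Sym.ofBits (b 2) (b 3))).bits hi)
    ![x true, x false, y true, y false] (w hi)

def circ2Map (x y w : Bool → Qubit) : (Qubit → Bool) → (Qubit → Bool) :=
  circGate x y w false ∘ circGate x y w true

lemma comp_involutive {α : Type*} {f g : α → α} (hf : Function.Involutive f)
    (hg : Function.Involutive g) (h : f ∘ g = g ∘ f) : (f ∘ g) ∘ (f ∘ g) = id := by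
  conv_lhs => rw [h]
  funext x
  have h' : ∀ x, f (g x) = g (f x) := congrFun h
  simp [h', hf _, hg _]

lemma copy2Map_comp_self {x q : Bool → Qubit} (h : ∀ b b', x b ≠ q b')
    (hq : q false ≠ q true) : copy2Map x q ∘ copy2Map x q = id :=
  comp_involutive (xorMap_involutive _ _ _) (xorMap_involutive _ _ _)
    (xorMap_comm (fun _ => h _ _) (fun _ => h _ _) hq)

lemma circ_ctrl_ne {x y : Bool → Qubit} {r : Qubit} (hx : ∀ b, x b ≠ r) (hy : ∀ b, y b ≠ r)
    (j : Fin 4) : ![x true, x false, y true, y false] j ≠ r := by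
  fin_cases j <;> simp [hx, hy]

lemma circ2Map_comp_self {x y w : Bool → Qubit} (hx : ∀ b b', x b ≠ w b')
    (hy : ∀ b b', y b ≠ w b') (hw : w false ≠ w true) :
    circ2Map x y w ∘ circ2Map x y w = id :=
  comp_involutive (xorMap_involutive _ _ _) (xorMap_involutive _ _ _)
    (xorMap_comm (circ_ctrl_ne (fun _ => hx _ _) fun _ => hy _ _)
      (circ_ctrl_ne (fun _ => hx _ _) fun _ => hy _ _) hw)

lemma copy2Map_ignores {x q : Bool → Qubit} {r : Qubit} (hx : ∀ b, x b ≠ r) (hq : ∀ b, q b ≠ r) :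
    Ignores r (copy2Map x q) :=
  (Ignores.xorMap (fun _ => hx _) (hq _)).comp (Ignores.xorMap (fun _ => hx _) (hq _))

lemma circ2Map_ignores {x y w : Bool → Qubit} {r : Qubit} (hx : ∀ b, x b ≠ r) (hy : ∀ b, y b ≠ r)
    (hw : ∀ b, w b ≠ r) : Ignores r (circ2Map x y w) :=
  (Ignores.xorMap (circ_ctrl_ne hx hy) (hw _)).comp (Ignores.xorMap (circ_ctrl_ne hx hy) (hw _))

lemma cnotMap_apply {x q : Qubit} (h : x ≠ q) (l : Qubit → Bool) (r : Qubit) :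
    cnotMap x q l r = if r = q then l q ^^ l x else l r := by
  rw [cnotMap, xorMap_of_notMem (fun _ => h), Function.update_apply]

lemma copy2Map_apply {x q : Bool → Qubit} (h : ∀ b b', x b ≠ q b') (hq : q false ≠ q true)
    (l : Qubit → Bool) (b : Bool) : copy2Map x q l (q b) = (l (q b) ^^ l (x b)) := by
  rw [copy2Map, Function.comp, cnotMap_apply (h _ _), cnotMap_apply (h _ _), cnotMap_apply (h _ _),
    cnotMap_apply (h _ _)]
  cases b <;> simp [hq, hq.symm, h]

lemma copy2Map_apply_of_ne {x q : Bool → Qubit} (l : Qubit → Bool) {r : Qubit} (hr : ∀ b, r ≠ q b) :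
    copy2Map x q l r = l r := by
  rw [copy2Map, Function.comp, cnotMap, cnotMap, xorMap_apply_of_ne _ _ (hr _),
    xorMap_apply_of_ne _ _ (hr _)]

lemma circ2Map_apply_of_ne {x y w : Bool → Qubit} (l : Qubit → Bool) {r : Qubit}
    (hr : ∀ b, r ≠ w b) : circ2Map x y w l r = l r := by
  rw [circ2Map, Function.comp, circGate, circGate, xorMap_apply_of_ne _ _ (hr _),
    xorMap_apply_of_ne _ _ (hr _)]

lemma circ2Map_apply {x y w : Bool → Qubit} (hx : ∀ b b', x b ≠ w b')
    (hy : ∀ b b', y b ≠ w b') (hw : w false ≠ w true) (l : Qubit → Bool) (b : Bool) :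
    circ2Map x y w l (w b) = (l (w b) ^^ ((Sym.ofBits (l (x true)) (l (x false))).circ
      (Sym.ofBits (l (y true)) (l (y false)))).bits b) := by
  have h : ∀ b, ∀ j, ![x true, x false, y true, y false] j ≠ w b :=
    fun b => circ_ctrl_ne (fun _ => hx _ _) fun _ => hy _ _
  rw [circ2Map, Function.comp, circGate, circGate, xorMap_of_notMem (h _), xorMap_of_notMem (h _)]
  cases b <;> simp [hw, hw.symm, hx, hy]

/-- The two-qubit register `r` holds a symbol that stands for a set of bits containing `b`, where
`0`, `1`, `∗`, `×` stand for `{0}`, `{1}`, `∅`, `{0, 1}`. -/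
def Holds (b : Bool) (l : Qubit → Bool) (r : Bool → Qubit) : Prop :=
  if b then l (r false) = true else l (r true) = l (r false)

/-- Under the reading of symbols as sets of bits, `∘` is union. Thus each bit can be followed
separately as a Boolean predicate, which is the form that `spread` needs. -/
lemma holds_circ {b : Bool} {l l' : Qubit → Bool} {x y w : Bool → Qubit}
    (h : ∀ b, l' (w b) = ((Sym.ofBits (l (x true)) (l (x false))).circ
      (Sym.ofBits (l (y true)) (l (y false)))).bits b) :
    Holds b l' w ↔ Holds b l x ∨ Holds b l y := by
  unfold Holds
  rw [h, h]
  cases b <;> cases l (x true) <;> cases l (x false) <;> cases l (y true) <;> cases l (y false) <;>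
    simp [Sym.ofBits, Sym.circ, Sym.bits]

lemma holds_congr {b : Bool} {l l' : Qubit → Bool} {r r' : Bool → Qubit}
    (h : ∀ b, l (r b) = l' (r' b)) : Holds b l r ↔ Holds b l' r' := by
  unfold Holds
  rw [h, h]

lemma eq_cross_iff {l : Qubit → Bool} {r : Bool → Qubit} :
    (l (r true) && l (r false)) = true ↔ Holds false l r ∧ Holds true l r := by
  unfold Holds
  cases l (r true) <;> cases l (r false) <;> simp

end Gates

/-! ### Rounds of Subroutine A -/

section Rounds

def copyOutMap (T : ℤ) (d : ℕ) : (Qubit → Bool) → (Qubit → Bool) :=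
  iter (fun j => copy2Map (reg .X T 0) (reg .X T (1 + j))) d

def circStep (T : ℤ) (j : ℕ) : (Qubit → Bool) → (Qubit → Bool) :=
  circ2Map (reg .A T (1 + j - 1)) (reg .X T (1 + j)) (reg .A T (1 + j))

def collectMap (T : ℤ) (d : ℕ) : (Qubit → Bool) → (Qubit → Bool) :=
  copy2Map (reg .A T d) (reg .X (T + 1) 0) ∘ iter (circStep T) d ∘
    copy2Map (reg .X T 0) (reg .A T 0)

def copyOutInvMap (T : ℤ) (d : ℕ) : (Qubit → Bool) → (Qubit → Bool) :=
  iter (fun j => copy2Map (reg .X T 0) (reg .X T (1 + (d - 1 - j : ℕ)))) d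

def collectInvMap (T : ℤ) (d : ℕ) : (Qubit → Bool) → (Qubit → Bool) :=
  copy2Map (reg .X T 0) (reg .A T 0) ∘ iter (fun j => circStep T (d - 1 - j)) d ∘
    copy2Map (reg .A T d) (reg .X (T + 1) 0)

lemma copyOutInvMap_comp (T : ℤ) (d : ℕ) : copyOutInvMap T d ∘ copyOutMap T d = id :=
  iter_reverse_comp (h := fun j : ℕ => copy2Map (reg .X T 0) (reg .X T (1 + j))) d fun j _ =>
    copy2Map_comp_self (fun b b' h => by simp [reg] at h; omega) (by simp [reg])

lemma collectInvMap_comp (T : ℤ) (d : ℕ) : collectInvMap T d ∘ collectMap T d = id := by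
  have h1 : copy2Map (reg .X T 0) (reg .A T 0) ∘ copy2Map (reg .X T 0) (reg .A T 0) = id :=
    copy2Map_comp_self (fun b b' h => by simp [reg] at h) (by simp [reg])
  have h2 : copy2Map (reg .A T d) (reg .X (T + 1) 0) ∘ copy2Map (reg .A T d) (reg .X (T + 1) 0)
      = id :=
    copy2Map_comp_self (fun b b' h => by simp [reg] at h) (by simp [reg])
  have h3 : iter (fun j => circStep T (d - 1 - j)) d ∘ iter (circStep T) d = id :=
    iter_reverse_comp d fun j _ => circ2Map_comp_self (fun b b' h => by simp [reg] at h)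
      (fun b b' h => by simp [reg] at h) (by simp [reg])
  funext l
  have h1' : ∀ l, _ = l := congrFun h1
  have h2' : ∀ l, _ = l := congrFun h2
  have h3' : ∀ l, _ = l := congrFun h3
  simp only [Function.comp] at h1' h2' h3'
  simp only [collectInvMap, collectMap, Function.comp, h1', h2', h3', id]

lemma copyOutMap_apply (T : ℤ) (d : ℕ) (l : Qubit → Bool) :
    (∀ i : ℤ, 1 ≤ i → i ≤ d → ∀ b, copyOutMap T d l (reg .X T i b) =
      (l (reg .X T i b) ^^ l (reg .X T 0 b))) ∧
    ∀ q : Qubit, ¬(q.name = .X ∧ q.row = T ∧ 1 ≤ q.col ∧ q.col ≤ d) →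
      copyOutMap T d l q = l q := by
  induction d with
  | zero => exact ⟨fun i h1 h2 => by omega, fun q _ => rfl⟩
  | succ d ih =>
    obtain ⟨ih1, ih2⟩ := ih
    have e : copyOutMap T (d + 1) = copy2Map (reg .X T 0) (reg .X T (1 + d)) ∘ copyOutMap T d := rfl
    rw [e]
    refine ⟨fun i h1 h2 b => ?_, fun q hq => ?_⟩
    · by_cases hi : i = 1 + d
      · subst hi
        rw [Function.comp, copy2Map_apply (fun b b' h => by simp [reg] at h ; omega) (by simp [reg]),
          ih2 _ (by simp), ih2 _ (by simp)]
      · rw [Function.comp, copy2Map_apply_of_ne _ fun b' => by simp [reg, hi], ih1 i h1 (by omega)]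
    · rw [Function.comp, copy2Map_apply_of_ne, ih2 q fun h => hq ⟨h.1, h.2.1, h.2.2.1, by omega⟩]
      rintro b rfl
      exact hq ⟨rfl, rfl, by simp, by simp; omega⟩

/-- The cell `A[T][i]` receives the union of `A[T][0]` and the first `i` received symbols. The cells
must be blank beforehand because the gate adds its result by XOR. -/
lemma iter_circStep_apply (T : ℤ) (d : ℕ) (l : Qubit → Bool)
    (hl : ∀ i : ℤ, 1 ≤ i → i ≤ d → ∀ b, l (reg .A T i b) = false) :
    (∀ i : ℤ, 0 ≤ i → i ≤ d → ∀ b, Holds b (iter (circStep T) d l) (reg .A T i) ↔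
      Holds b l (reg .A T 0) ∨ ∃ i' : ℤ, 1 ≤ i' ∧ i' ≤ i ∧ Holds b l (reg .X T i')) ∧
    ∀ q : Qubit, ¬(q.name = .A ∧ q.row = T ∧ 1 ≤ q.col ∧ q.col ≤ d) →
      iter (circStep T) d l q = l q := by
  induction d with
  | zero =>
    refine ⟨fun i h1 h2 b => ?_, fun q _ => rfl⟩
    obtain rfl : i = 0 := by push_cast at h2; omega
    have : ¬∃ i' : ℤ, 1 ≤ i' ∧ i' ≤ 0 ∧ Holds b l (reg .X T i') := by
      rintro ⟨i', h1, h2, -⟩; omega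
    simp [iter, this]
  | succ d ih =>
    obtain ⟨ih1, ih2⟩ := ih fun i h1 h2 => hl i h1 (by push_cast; omega)
    have e : iter (circStep T) (d + 1) = circStep T d ∘ iter (circStep T) d := rfl
    have hne : ∀ q : Qubit, ¬(q.name = .A ∧ q.row = T ∧ q.col = 1 + d) →
        circStep T d (iter (circStep T) d l) q = iter (circStep T) d l q := by
      intro q hq
      refine circ2Map_apply_of_ne _ ?_
      rintro b rfl
      exact hq ⟨rfl, rfl, rfl⟩
    rw [e]
    refine ⟨fun i h1 h2 b => ?_, fun q hq => ?_⟩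
    · by_cases hi : i = 1 + d
      · subst hi
        have h3 : ∀ b, circStep T d (iter (circStep T) d l) (reg .A T (1 + d) b) = _ :=
          circ2Map_apply (fun b b' h => by simp [reg] at h)
            (fun b b' h => by simp [reg] at h) (by simp [reg]) _
        have h4 : ∀ b, iter (circStep T) d l (reg .A T (1 + d) b) = false := fun b => by
          rw [ih2 _ (by simp), hl _ (by omega) (by push_cast; omega)]
        have h5 : Holds b (iter (circStep T) d l) (reg .X T (1 + d)) ↔
            Holds b l (reg .X T (1 + d)) := holds_congr fun b => ih2 _ (by simp)
        simp only [h4, Bool.false_xor] at h3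
        rw [Function.comp, holds_circ h3, h5, ih1 _ (by omega) (by omega), or_assoc]
        apply or_congr_right
        constructor
        · rintro (⟨i', h6, h7, h8⟩ | h)
          · exact ⟨i', h6, by omega, h8⟩
          · exact ⟨_, by omega, le_rfl, h⟩
        · rintro ⟨i', h6, h7, h8⟩
          by_cases hi' : i' = 1 + d
          · subst hi'; exact .inr h8
          · exact .inl ⟨i', h6, by omega, h8⟩
      · rw [← ih1 i h1 (by push_cast at h2; omega)]
        exact holds_congr fun b => hne _ (by simp [hi])
    · rw [Function.comp, hne q fun h => hq ⟨h.1, h.2.1, by omega, by push_cast; omega⟩,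
        ih2 q fun h => hq ⟨h.1, h.2.1, h.2.2.1, by push_cast; omega⟩]

lemma collectMap_apply (T : ℤ) (d : ℕ) (l : Qubit → Bool)
    (hA : ∀ i : ℤ, 0 ≤ i → i ≤ d → ∀ b, l (reg .A T i b) = false)
    (hX : ∀ b, l (reg .X (T + 1) 0 b) = false) :
    (∀ b, Holds b (collectMap T d l) (reg .X (T + 1) 0) ↔
      ∃ i : ℤ, 0 ≤ i ∧ i ≤ d ∧ Holds b l (reg .X T i)) ∧
    ∀ q : Qubit, ¬(q.name = .A ∧ q.row = T) → ¬(q.name = .X ∧ q.row = T + 1 ∧ q.col = 0) →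
      collectMap T d l q = l q := by
  obtain ⟨l₁, hl₁⟩ : ∃ l₁, l₁ = copy2Map (reg .X T 0) (reg .A T 0) l := ⟨_, rfl⟩
  have h1 : ∀ b, l₁ (reg .A T 0 b) = l (reg .X T 0 b) := fun b => by
    rw [hl₁, copy2Map_apply (fun b b' h => by simp [reg] at h) (by simp [reg]),
      hA 0 le_rfl (by omega), Bool.false_xor]
  have h2 : ∀ q : Qubit, ¬(q.name = .A ∧ q.row = T ∧ q.col = 0) → l₁ q = l q := by
    intro q hq
    rw [hl₁]
    refine copy2Map_apply_of_ne _ ?_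
    rintro b rfl
    exact hq ⟨rfl, rfl, rfl⟩
  obtain ⟨h3, h4⟩ := iter_circStep_apply T d l₁ fun i hi hi' b => by
    rw [h2 _ (by simp; omega), hA i (by omega) hi']
  have e : collectMap T d l = copy2Map (reg .A T d) (reg .X (T + 1) 0) (iter (circStep T) d l₁) := by
    rw [hl₁]; rfl
  have h5 : ∀ b, collectMap T d l (reg .X (T + 1) 0 b) =
      iter (circStep T) d l₁ (reg .A T d b) := by
    intro b
    rw [e, copy2Map_apply (fun b b' h => by simp [reg] at h) (by simp [reg]),
      h4 _ (by simp), h2 _ (by simp), hX, Bool.false_xor]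
  refine ⟨fun b => ?_, fun q hq hq' => ?_⟩
  · rw [holds_congr h5, h3 d (by omega) le_rfl, holds_congr h1]
    constructor
    · rintro (h | ⟨i, h6, h7, h8⟩)
      · exact ⟨0, le_rfl, by omega, h⟩
      · exact ⟨i, by omega, h7, (holds_congr fun b => h2 _ (by simp)).1 h8⟩
    · rintro ⟨i, h6, h7, h8⟩
      by_cases hi : i = 0
      · subst hi; exact .inl h8
      · exact .inr ⟨i, by omega, h7, (holds_congr fun b => h2 _ (by simp)).2 h8⟩
  · rw [e, copy2Map_apply_of_ne, h4 q fun h => hq ⟨h.1, h.2.1⟩, h2 q fun h => hq ⟨h.1, h.2.1⟩]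
    rintro b rfl
    exact hq' ⟨rfl, rfl, rfl⟩

variable {n : ℕ} (G : SimpleGraph (Fin n)) [DecidableRel G.Adj] (σ : PortNumbering G)

def roundMap (T : ℤ) : Conf n → Conf n :=
  onAll (fun v => collectMap T (G.degree v)) ∘
    (exchConf G σ .X T ∘ onAll fun v => copyOutMap T (G.degree v))

def roundInvMap (T : ℤ) : Conf n → Conf n :=
  onAll (fun v => copyOutInvMap T (G.degree v)) ∘
    (exchConf G σ .X T ∘ onAll fun v => collectInvMap T (G.degree v))

lemma onAll_comp_eq_id {g h : Fin n → (Qubit → Bool) → (Qubit → Bool)}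
    (H : ∀ v, g v ∘ h v = id) : onAll g ∘ onAll h = id := by
  funext c v
  exact congrFun (H v) (c v)

/-- The factors of the inverse occur in reverse order, and the exchange in the middle is its own
inverse. -/
lemma roundInvMap_comp (T : ℤ) : roundInvMap G σ T ∘ roundMap G σ T = id := by
  funext c
  have h1 : ∀ c : Conf n, _ = c := congrFun (onAll_comp_eq_id fun v : Fin n =>
    collectInvMap_comp T (G.degree v))
  have h2 : ∀ c : Conf n, _ = c := congrFun (onAll_comp_eq_id fun v : Fin n =>
    copyOutInvMap_comp T (G.degree v))
  simp only [Function.comp] at h1 h2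
  simp only [roundInvMap, roundMap, Function.comp, h1, h2, exchConf_involutive G σ .X T _, id]

/-- The registers that the rounds `T, T + 1, …, N - 1` assume to be `0`. -/
def ZeroFrom (N T : ℤ) (c : Conf n) : Prop :=
  (∀ v (t i : ℤ) b, T ≤ t → t ≤ N - 1 → 0 ≤ i → i ≤ G.degree v →
    (¬(t = T ∧ i = 0) → c v (reg .X t i b) = false) ∧ c v (reg .A t i b) = false) ∧
  (T < N → ∀ v b, c v (reg .X N 0 b) = false)

lemma remote_zero (v : Fin n) : remote G σ v 0 = none := by
  rw [remote, dif_neg (by omega)]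

/-- After copying, all columns `0, …, d` of row `T` hold the own symbol. The exchange replaces the
columns `1, …, d` by the symbols of the neighbours and keeps column 0, which is not a port. Their
union is then written into the blank cell `X[T+1][0]`. -/
theorem roundMap_spec {N T : ℤ} (hT : T ≤ N - 1) {c : Conf n} (hc : ZeroFrom G N T c) :
    ZeroFrom G N (T + 1) (roundMap G σ T c) ∧
    ∀ b v, Holds b (roundMap G σ T c v) (reg .X (T + 1) 0) ↔
      Holds b (c v) (reg .X T 0) ∨ ∃ u, G.Adj v u ∧ Holds b (c u) (reg .X T 0) := by
  obtain ⟨c₁, hc₁⟩ : ∃ c₁, c₁ = onAll (fun v => copyOutMap T (G.degree v)) c := ⟨_, rfl⟩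
  obtain ⟨c₂, hc₂⟩ : ∃ c₂, c₂ = exchConf G σ .X T c₁ := ⟨_, rfl⟩
  have e : roundMap G σ T c = onAll (fun v => collectMap T (G.degree v)) c₂ := by
    rw [hc₂, hc₁]; rfl
  have h1 : ∀ v (i : ℤ) b, 0 ≤ i → i ≤ G.degree v →
      c₁ v (reg .X T i b) = c v (reg .X T 0 b) := by
    intro v i b h0 hi
    rw [hc₁]
    change copyOutMap T (G.degree v) (c v) _ = _
    by_cases hi0 : i = 0
    · subst hi0
      exact (copyOutMap_apply T (G.degree v) (c v)).2 _ (by simp)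
    · rw [(copyOutMap_apply T (G.degree v) (c v)).1 i (by omega) hi,
        (hc.1 v T i b le_rfl hT h0 hi).1 (by omega), Bool.false_xor]
  have h2 : ∀ v (q : Qubit), ¬(q.name = .X ∧ q.row = T) → c₂ v q = c v q := by
    intro v q hq
    rw [hc₂, exchConf, if_neg hq, hc₁]
    exact (copyOutMap_apply T (G.degree v) (c v)).2 _ fun h => hq ⟨h.1, h.2.1⟩
  have h3 : ∀ v b, c₂ v (reg .X T 0 b) = c v (reg .X T 0 b) := by
    intro v b
    rw [hc₂, exchConf, if_pos ⟨rfl, rfl⟩]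
    simp only [reg, remote_zero]
    exact h1 v 0 b le_rfl (by omega)
  have h4 : ∀ v i u j, remote G σ v i = some (u, j) →
      ∀ b, c₂ v (reg .X T i b) = c u (reg .X T 0 b) := by
    intro v i u j hr b
    rw [hc₂, exchConf, if_pos ⟨rfl, rfl⟩]
    simp only [reg, hr]
    have := remote_port G σ (remote_eq_some G σ hr).2
    exact h1 u j b (by omega) this.2
  have h5 : ∀ v, _ := fun v => collectMap_apply T (G.degree v) (c₂ v)
    (fun i h0 hi b => by rw [h2 _ _ (by simp)]; exact (hc.1 v T i b le_rfl hT h0 hi).2)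
    (fun b => by
      rw [h2 _ _ (by simp)]
      by_cases hTN : T + 1 = N
      · rw [hTN]; exact hc.2 (by omega) v b
      · exact (hc.1 v (T + 1) 0 b (by omega) (by omega) le_rfl (by omega)).1 (by omega))
  have h6 : ∀ v (q : Qubit), q.row ≠ T → ¬(q.name = .X ∧ q.row = T + 1 ∧ q.col = 0) →
      roundMap G σ T c v q = c v q := by
    intro v q hq hq'
    rw [e, ← h2 v q fun h => hq h.2]
    exact (h5 v).2 q (fun h => hq h.2) hq'
  refine ⟨⟨fun v t i b ht ht' hi hi' => ⟨fun hti => ?_, ?_⟩, fun hTN v b => ?_⟩, fun b v => ?_⟩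
  · rw [h6 v _ (by simp; omega) (by simpa [reg] using hti)]
    exact (hc.1 v t i b (by omega) ht' hi hi').1 (by omega)
  · rw [h6 v _ (by simp; omega) (by simp)]
    exact (hc.1 v t i b (by omega) ht' hi hi').2
  · rw [h6 v _ (by simp; omega) (by simp; omega)]
    exact hc.2 (by omega) v b
  · rw [e]
    change Holds b (collectMap T (G.degree v) (c₂ v)) _ ↔ _
    rw [(h5 v).1]
    constructor
    · rintro ⟨i, h0, hi, h⟩
      by_cases hi0 : i = 0
      · subst hi0
        exact .inl ((holds_congr fun b => h3 v b).1 h)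
      · obtain ⟨u, j, hr⟩ := remote_isSome G σ (v := v) (i := i) ⟨by omega, hi⟩
        exact .inr ⟨u, (remote_eq_some G σ hr).1, (holds_congr fun b => h4 v i u j hr b).1 h⟩
    · rintro (h | ⟨u, hu, h⟩)
      · exact ⟨0, le_rfl, by omega, (holds_congr fun b => h3 v b).2 h⟩
      · obtain ⟨i, j, hr⟩ := exists_port G σ hu
        have := remote_port G σ hr
        exact ⟨i, by omega, this.2, (holds_congr fun b => h4 v i u j hr b).2 h⟩

end Rounds


/-! ### Correctness of Subroutine A -/

section SubroutineA

variable {n : ℕ} (G : SimpleGraph (Fin n)) [DecidableRel G.Adj] (σ : PortNumbering G)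

open AlgI

abbrev qR0 : Qubit := ⟨.R0, 0, 0, false⟩
abbrev qR1 : Qubit := ⟨.R1, 0, 0, false⟩
abbrev qS : Qubit := ⟨.S, 0, 0, false⟩

/-- The memory of `v` in the course of Subroutine A. -/
def MemA (st : Fin n → ℤ) (v : Fin n) (mv : CVar → ℤ) : Prop :=
  mv .d = G.degree v ∧ mv .status = st v

def initMap (b : Prop) [Decidable b] : (Qubit → Bool) → (Qubit → Bool) :=
  if b then cnotMap qR0 (reg .X 1 0 false) else flipMap (reg .X 1 0 true)

def flipIfCrossMap (N : ℤ) : (Qubit → Bool) → (Qubit → Bool) :=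
  xorMap (m := 2) (fun b => b 0 && b 1) ![reg .X N 0 true, reg .X N 0 false] qS

variable {G} in
lemma memA_update {st : Fin n → ℤ} {v : Fin n} {mv : CVar → ℤ} (h : MemA G st v mv) (a : ℤ) :
    MemA G st v (Function.update mv .i a) := by
  simpa [MemA] using h

lemma acts_cnot {env : PVar → ℤ} {v : Fin n} {M : (CVar → ℤ) → Prop} {x q : QRef} (x' q' : Qubit)
    (h : ∀ mv, M mv → x.eval (Sum.elim env mv) = x' ∧ q.eval (Sum.elim env mv) = q') :
    Cmd.Acts env v M (cnot x q) (cnotMap x' q') :=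
  .xor _ _ fun mv hm => ⟨fun _ => (h mv hm).1, (h mv hm).2⟩

lemma acts_copy2 {env : PVar → ℤ} {v : Fin n} {M : (CVar → ℤ) → Prop} {x q : Bool → QRef}
    (x' q' : Bool → Qubit) (h : ∀ mv, M mv → ∀ b, (x b).eval (Sum.elim env mv) = x' b ∧
      (q b).eval (Sum.elim env mv) = q' b) :
    Cmd.Acts env v M (copy2 x q) (copy2Map x' q') :=
  (acts_cnot _ _ fun mv hm => h mv hm true).seq (acts_cnot _ _ fun mv hm => h mv hm false)

lemma acts_circ2 {env : PVar → ℤ} {v : Fin n} {M : (CVar → ℤ) → Prop} {x y w : Bool → QRef}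
    (x' y' w' : Bool → Qubit) (h : ∀ mv, M mv → ∀ b, (x b).eval (Sum.elim env mv) = x' b ∧
      (y b).eval (Sum.elim env mv) = y' b ∧ (w b).eval (Sum.elim env mv) = w' b) :
    Cmd.Acts env v M (circ2 x y w) (circ2Map x' y' w') := by
  refine .seq (.xor _ _ fun mv hm => ⟨fun j => ?_, (h mv hm true).2.2⟩)
    (.xor _ _ fun mv hm => ⟨fun j => ?_, (h mv hm false).2.2⟩)
  all_goals
    have h0 := h mv hm true
    have h1 := h mv hm false
    fin_cases j <;> simp [h0, h1]

lemma acts_subAinit (env : PVar → ℤ) (st : Fin n → ℤ) (v : Fin n) :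
    Cmd.Acts env v (MemA G st v) subAinit (initMap (st v = 1)) := by
  unfold initMap
  split_ifs with h
  · refine .ite_pos (fun mv hm => ?_) (acts_cnot _ _ fun mv hm => ⟨rfl, rfl⟩)
    exact hm.2.trans h
  · refine .ite_neg (fun mv hm hb => ?_) (.xor _ _ fun mv hm => ⟨fun j => j.elim0, rfl⟩)
    exact h (hm.2.symm.trans hb)

lemma acts_copyOut {env : PVar → ℤ} (st : Fin n → ℤ) (v : Fin n) :
    Cmd.Acts env v (MemA G st v) copyOut (copyOutMap (env .t) (G.degree v)) := by
  have := Cmd.Acts.forUp (env := env) (v := v) (M := MemA G st v) (lo := num 1) (hi := dd)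
    (c := copy2 (X tt (num 0)) (X tt ii)) 1 (G.degree v)
    (fun j => copy2Map (reg .X (env .t) 0) (reg .X (env .t) (1 + j)))
    (fun mv a h => memA_update h a) (fun mv h => ⟨rfl, h.1⟩)
    (fun j _ => acts_copy2 _ _ fun mv hm b => ⟨rfl, ?_⟩)
  · rw [show ((G.degree v : ℤ) - 1 + 1).toNat = G.degree v by omega] at this
    exact this
  · rw [← hm.2]; rfl

lemma acts_copyOutInv {env : PVar → ℤ} (st : Fin n → ℤ) (v : Fin n) :
    Cmd.Acts env v (MemA G st v) copyOutInv (copyOutInvMap (env .t) (G.degree v)) := by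
  have := Cmd.Acts.forDown (env := env) (v := v) (M := MemA G st v) (lo := num 1) (hi := dd)
    (c := copy2 (X tt (num 0)) (X tt ii)) 1 (G.degree v)
    (fun j => copy2Map (reg .X (env .t) 0) (reg .X (env .t) (1 + (G.degree v - 1 - j : ℕ))))
    (fun mv a h => memA_update h a) (fun mv h => ⟨rfl, h.1⟩)
    (fun j hj => acts_copy2 _ _ fun mv hm b => ⟨rfl, ?_⟩)
  · rw [show ((G.degree v : ℤ) - 1 + 1).toNat = G.degree v by omega] at this
    exact this
  · rw [show (1 : ℤ) + (G.degree v - 1 - j : ℕ) = G.degree v - j by omega, ← hm.2]; rfl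

lemma acts_collect {env : PVar → ℤ} (st : Fin n → ℤ) (v : Fin n) :
    Cmd.Acts env v (MemA G st v) collect (collectMap (env .t) (G.degree v)) := by
  have := Cmd.Acts.forUp (env := env) (v := v) (M := MemA G st v) (lo := num 1) (hi := dd)
    (c := circ2 (A tt (eMinus1 ii)) (X tt ii) (A tt ii)) 1 (G.degree v) (circStep (env .t))
    (fun mv a h => memA_update h a) (fun mv h => ⟨rfl, h.1⟩)
    (fun j _ => acts_circ2 _ _ _ fun mv hm b => ⟨?_, ?_, ?_⟩)
  · rw [show ((G.degree v : ℤ) - 1 + 1).toNat = G.degree v by omega] at this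
    have h1 : Cmd.Acts env v (MemA G st v) (copy2 (X tt (num 0)) (A tt (num 0)))
        (copy2Map (reg .X (env .t) 0) (reg .A (env .t) 0)) :=
      acts_copy2 _ _ fun mv hm b => ⟨rfl, rfl⟩
    have h2 : Cmd.Acts env v (MemA G st v) (copy2 (A tt dd) (X (ePlus1 tt) (num 0)))
        (copy2Map (reg .A (env .t) (G.degree v)) (reg .X (env .t + 1) 0)) :=
      acts_copy2 _ _ fun mv hm b => ⟨by rw [← hm.1]; rfl, rfl⟩
    have h3 := h1.seq (this.seq h2)
    rw [Function.comp_assoc] at h3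
    exact h3
  all_goals rw [← hm.2]; rfl

lemma acts_collectInv {env : PVar → ℤ} (st : Fin n → ℤ) (v : Fin n) :
    Cmd.Acts env v (MemA G st v) collectInv (collectInvMap (env .t) (G.degree v)) := by
  have := Cmd.Acts.forDown (env := env) (v := v) (M := MemA G st v) (lo := num 1) (hi := dd)
    (c := circ2 (A tt (eMinus1 ii)) (X tt ii) (A tt ii)) 1 (G.degree v)
    (fun j => circStep (env .t) (G.degree v - 1 - j))
    (fun mv a h => memA_update h a) (fun mv h => ⟨rfl, h.1⟩)
    (fun j hj => acts_circ2 _ _ _ fun mv hm b => ⟨?_, ?_, ?_⟩)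
  · rw [show ((G.degree v : ℤ) - 1 + 1).toNat = G.degree v by omega] at this
    have h1 : Cmd.Acts env v (MemA G st v) (copy2 (X tt (num 0)) (A tt (num 0)))
        (copy2Map (reg .X (env .t) 0) (reg .A (env .t) 0)) :=
      acts_copy2 _ _ fun mv hm b => ⟨rfl, rfl⟩
    have h2 : Cmd.Acts env v (MemA G st v) (copy2 (A tt dd) (X (ePlus1 tt) (num 0)))
        (copy2Map (reg .A (env .t) (G.degree v)) (reg .X (env .t + 1) 0)) :=
      acts_copy2 _ _ fun mv hm b => ⟨by rw [← hm.1]; rfl, rfl⟩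
    have h3 := h2.seq (this.seq h1)
    rw [Function.comp_assoc] at h3
    exact h3
  all_goals
    rw [show (1 : ℤ) + (G.degree v - 1 - j : ℕ) = G.degree v - j by omega, ← hm.2]; rfl

/-- The computation of Subroutine A up to the flip of `S`. -/
def upMap (st : Fin n → ℤ) (N : ℕ) : Conf n → Conf n :=
  iter (fun j => roundMap G σ (1 + j)) (N - 1) ∘ onAll fun v => initMap (st v = 1)

def downMap (st : Fin n → ℤ) (N : ℕ) : Conf n → Conf n :=
  (onAll fun v => initMap (st v = 1)) ∘
    iter (fun j => roundInvMap G σ (1 + (N - 1 - 1 - j : ℕ))) (N - 1)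

/-- Subroutine A after the preparation of the registers. -/
def subAMain : Prog :=
  .seq (.loc subAinit)
  (.seq (.forUp .t (.lit 1) pN1
    (.seq (.loc copyOut) (.seq (.exchQ .X (.var .t)) (.loc collect))))
  (.seq (.loc flipIfCross)
  (.seq (.forDown .t pN1 (.lit 1)
    (.seq (.loc collectInv) (.seq (.exchQ .X (.var .t)) (.loc copyOutInv))))
  (.loc subAinit))))

theorem acts_subAMain {env : PVar → ℤ} {N : ℕ} (henv : env .N = N) (st : Fin n → ℤ) :
    Prog.Acts G σ env (MemA G st) subAMain
      (downMap G σ st N ∘ onAll (fun _ => flipIfCrossMap N) ∘ upMap G σ st N) := by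
  have hup := Prog.Acts.forUp (G := G) (σ := σ) (env := env) (M := MemA G st) (x := .t)
    (lo := .lit 1) (hi := pN1)
    (p := .seq (.loc copyOut) (.seq (.exchQ .X (.var .t)) (.loc collect)))
    (fun j => roundMap G σ (1 + j)) fun j _ => by
      have := ((Prog.Acts.loc (G := G) (σ := σ)
        fun v => acts_copyOut G (env := Function.update env .t (1 + j)) st v).seq
        (.seq (.exchQ (a := .X) (e := .var .t)) (.loc fun v => acts_collect G st v)))
      simp only [Expr.eval, Function.update_self, Function.comp_assoc] at this ⊢
      exact this
  have hdown := Prog.Acts.forDown (G := G) (σ := σ) (env := env) (M := MemA G st) (x := .t)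
    (lo := .lit 1) (hi := pN1)
    (p := .seq (.loc collectInv) (.seq (.exchQ .X (.var .t)) (.loc copyOutInv)))
    (fun j => roundInvMap G σ (1 + (N - 1 - 1 - j : ℕ))) fun j hj => by
      have := ((Prog.Acts.loc (G := G) (σ := σ)
        fun v => acts_collectInv G (env := Function.update env .t (pN1.eval env - j)) st v).seq
        (.seq (.exchQ (a := .X) (e := .var .t)) (.loc fun v => acts_copyOutInv G st v)))
      simp only [pN1, Expr.eval, henv] at hj this ⊢
      rw [show (1 : ℤ) + (N - 1 - 1 - j : ℕ) = N - 1 - j by omega]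
      simp only [Function.update_self, Function.comp_assoc] at this
      exact this
  have hlen : (pN1.eval env - (Expr.lit 1 : Expr PVar).eval env + 1).toNat = N - 1 := by
    simp only [pN1, Expr.eval, henv]
    omega
  rw [hlen] at hup hdown
  have hflip : Prog.Acts G σ env (MemA G st) (.loc flipIfCross)
      (onAll fun _ => flipIfCrossMap N) := by
    refine .loc fun v => .xor _ _ fun mv hm => ⟨fun j => ?_, rfl⟩
    fin_cases j <;> simp [X, QRef.eval, pv, num, Expr.eval, henv]
  exact (Prog.Acts.loc fun v => acts_subAinit G env st v).seq
    (hup.seq (hflip.seq (hdown.seq (.loc fun v => acts_subAinit G env st v))))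

/-- The eligible parties have different contents of `R0`. -/
def Inconsistent (E : Fin n → Prop) (c : Conf n) : Prop :=
  ∀ b, ∃ u, E u ∧ c u qR0 = b

open scoped Classical in
/-- Turn over all qubits `S` if the state is inconsistent. -/
noncomputable def markMap (E : Fin n → Prop) (c : Conf n) : Conf n := fun v =>
  Function.update (c v) qS (c v qS ^^ decide (Inconsistent E c))

lemma ignores_initMap (b : Prop) [Decidable b] : Ignores qS (initMap b) := by
  unfold initMap
  split_ifs
  · exact .xorMap (by simp) (by simp)
  · exact .xorMap (by simp) (by simp)

lemma ignores_circStep (T : ℤ) (j : ℕ) : Ignores qS (circStep T j) :=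
  circ2Map_ignores (by simp) (by simp) (by simp)

lemma ignores_copyOutInvMap (T : ℤ) (d : ℕ) : Ignores qS (copyOutInvMap T d) :=
  .iter (fun j => copy2Map_ignores (by simp) (by simp)) d

lemma ignores_copyOutMap (T : ℤ) (d : ℕ) : Ignores qS (copyOutMap T d) :=
  .iter (fun j => copy2Map_ignores (by simp) (by simp)) d

lemma ignores_collectInvMap (T : ℤ) (d : ℕ) : Ignores qS (collectInvMap T d) :=
  (copy2Map_ignores (by simp) (by simp)).comp
    ((Ignores.iter (fun j => ignores_circStep T _) d).comp (copy2Map_ignores (by simp) (by simp)))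

lemma ignores_collectMap (T : ℤ) (d : ℕ) : Ignores qS (collectMap T d) :=
  (copy2Map_ignores (by simp) (by simp)).comp
    ((Ignores.iter (fun j => ignores_circStep T j) d).comp (copy2Map_ignores (by simp) (by simp)))

/-- `F` commutes with every change of the qubits `S`. -/
def IgnoresS (F : Conf n → Conf n) : Prop :=
  ∀ c (z : Fin n → Bool), F (fun v => Function.update (c v) qS (z v)) =
    fun v => Function.update (F c v) qS (z v)

lemma IgnoresS.comp {F F' : Conf n → Conf n} (h : IgnoresS F) (h' : IgnoresS F') :
    IgnoresS (F ∘ F') := fun c z => by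
  simp only [Function.comp, h' c z, h (F' c) z]

lemma IgnoresS.iter {F : ℕ → Conf n → Conf n} (h : ∀ j, IgnoresS (F j)) (k : ℕ) :
    IgnoresS (iter F k) :=
  iter_induction _ (fun _ _ => rfl) (fun j _ hf => (h j).comp hf) k

lemma IgnoresS.onAll {g : Fin n → (Qubit → Bool) → (Qubit → Bool)} (h : ∀ v, Ignores qS (g v)) :
    IgnoresS (onAll g) := fun c z => funext fun v => h v (c v) (z v)

lemma IgnoresS.exchConf (T : ℤ) : IgnoresS (exchConf G σ .X T) := by
  intro c z
  funext v q
  by_cases hq : q = qS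
  · subst hq; simp [QLE.exchConf]
  · simp only [QLE.exchConf, Function.update_apply, hq, if_false]
    split_ifs with h
    · rcases hr : remote G σ v q.col with _ | ⟨u, j⟩
      · rfl
      · simp [h]
    · rfl

lemma IgnoresS.roundMap (T : ℤ) : IgnoresS (roundMap G σ T) :=
  (onAll fun _ => ignores_collectMap T _).comp
    ((exchConf G σ T).comp (onAll fun _ => ignores_copyOutMap T _))

lemma IgnoresS.roundInvMap (T : ℤ) : IgnoresS (roundInvMap G σ T) :=
  (onAll fun _ => ignores_copyOutInvMap T _).comp
    ((exchConf G σ T).comp (onAll fun _ => ignores_collectInvMap T _))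

lemma IgnoresS.apply {F : Conf n → Conf n} (h : IgnoresS F) (c : Conf n) (v : Fin n) :
    F c v qS = c v qS := by
  have := h c fun v => c v qS
  simp only [Function.update_eq_self] at this
  rw [this]; simp

lemma ignoresS_upMap (st : Fin n → ℤ) (N : ℕ) : IgnoresS (upMap G σ st N) :=
  (IgnoresS.iter (fun _ => .roundMap G σ _) _).comp (.onAll fun _ => ignores_initMap _)

lemma ignoresS_downMap (st : Fin n → ℤ) (N : ℕ) : IgnoresS (downMap G σ st N) :=
  (IgnoresS.onAll fun _ => ignores_initMap _).comp (.iter (fun _ => .roundInvMap G σ _) _)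

lemma initMap_involutive (b : Prop) [Decidable b] : Function.Involutive (initMap b) := by
  unfold initMap
  split_ifs
  · exact xorMap_involutive _ _ _
  · exact xorMap_involutive _ _ _

lemma downMap_upMap (st : Fin n → ℤ) (N : ℕ) (c : Conf n) :
    downMap G σ st N (upMap G σ st N c) = c := by
  have h1 := congrFun (iter_reverse_comp (g := fun j : ℕ => roundMap G σ (1 + j))
    (h := fun j : ℕ => roundInvMap G σ (1 + j)) (N - 1) fun j _ => roundInvMap_comp G σ _)
    (onAll (fun v => initMap (st v = 1)) c)
  simp only [Function.comp, id] at h1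
  simp only [downMap, upMap, Function.comp, h1]
  exact congrFun (onAll_comp_eq_id fun v => (initMap_involutive _).comp_self) c

-- The predicate that the symbol in `X[1+j][0]` contains the bit `b` spreads to the neighbours in
-- every round, so in the end each party knows whether some eligible party holds `b`. The symbol is
-- `×` exactly if this is so for both bits.
variable {G} in
theorem upMap_cross {N : ℕ} (hG : G.Connected) (hN : n ≤ N) (st : Fin n → ℤ) {c : Conf n}
    (hc : ∀ v b, (∀ nm ∈ [QName.X, QName.A], ∀ t i : ℤ, 1 ≤ t → t ≤ N - 1 → 0 ≤ i →
      i ≤ G.degree v → c v (reg nm t i b) = false) ∧ c v (reg .X N 0 b) = false) (v : Fin n) :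
    (upMap G σ st N c v (reg .X N 0 true) && upMap G σ st N c v (reg .X N 0 false)) = true ↔
      Inconsistent (fun u => st u = 1) c := by
  have hN1 : 1 ≤ N := by have := v.2; omega
  obtain ⟨c₀, hc₀⟩ : ∃ c₀ : Conf n, c₀ = onAll (fun v => initMap (st v = 1)) c := ⟨_, rfl⟩
  have hX : ∀ v b, c v (reg .X 1 0 b) = false := by
    intro v b
    -- If `N = 1` there are no rounds, and the input cell `X[1][0]` is the output cell `X[N][0]`.
    by_cases h : N = 1
    · have := (hc v b).2
      rwa [h] at this
    · exact (hc v b).1 .X (by simp) 1 0 le_rfl (by omega) le_rfl (by omega)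
  have h1 : ∀ v q, ¬(q.name = .X ∧ q.row = 1 ∧ q.col = 0) → c₀ v q = c v q := by
    intro v q hq
    rw [hc₀]
    change initMap (st v = 1) (c v) q = _
    unfold initMap
    split_ifs
    · exact xorMap_apply_of_ne _ _ (by rintro rfl; exact hq ⟨rfl, rfl, rfl⟩) _
    · exact xorMap_apply_of_ne _ _ (by rintro rfl; exact hq ⟨rfl, rfl, rfl⟩) _
  have h2 : ∀ b u, Holds b (c₀ u) (reg .X 1 0) ↔ st u = 1 ∧ c u qR0 = b := by
    intro b u
    rw [hc₀]
    change Holds b (initMap (st u = 1) (c u)) (reg .X 1 0) ↔ _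
    unfold initMap Holds
    by_cases h : st u = 1
    · simp only [h, if_true, true_and, cnotMap_apply (x := qR0) (q := reg .X 1 0 false) (by simp)]
      cases b <;> simp [hX]
    · simp only [h, if_false, false_and, flipMap, xorMap_of_notMem (fun j => j.elim0)]
      cases b <;> simp [hX]
  have h3 : ZeroFrom G N 1 c₀ := by
    refine ⟨fun v t i b ht ht' hi hi' => ⟨fun hti => ?_, ?_⟩, fun hlt v b => ?_⟩
    · rw [h1 _ _ (by simpa using hti)]
      exact (hc v b).1 .X (by simp) t i ht ht' hi hi'
    · rw [h1 _ _ (by simp)]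
      exact (hc v b).1 .A (by simp) t i ht ht' hi hi'
    · rw [h1 _ _ (by simp; omega)]
      exact (hc v b).2
  have h4 : ∀ j : ℕ, j ≤ N - 1 →
      ZeroFrom G N (1 + j) (iter (fun j : ℕ => roundMap G σ (1 + j)) j c₀) := by
    intro j
    induction j with
    | zero => intro _; simpa [iter] using h3
    | succ j ih =>
      intro hj
      have := (roundMap_spec G σ (N := N) (T := 1 + j) (by omega) (ih (by omega))).1
      rw [show (1 : ℤ) + (j + 1 : ℕ) = 1 + j + 1 by push_cast; ring]
      exact this
  have h5 : ∀ b v, Holds b (upMap G σ st N c v) (reg .X N 0) ↔ ∃ u, st u = 1 ∧ c u qR0 = b := by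
    intro b v
    have := spread hG hN (P := fun j v =>
      Holds b (iter (fun j : ℕ => roundMap G σ (1 + j)) j c₀ v) (reg .X (1 + j) 0))
      (fun j v hj => by
        rw [show (1 : ℤ) + (j + 1 : ℕ) = 1 + j + 1 by push_cast; ring]
        exact (roundMap_spec G σ (N := N) (T := 1 + j) (by omega) (h4 j (by omega))).2 b v) v
    rw [show (1 : ℤ) + (N - 1 : ℕ) = N by omega] at this
    simp only [upMap, Function.comp, ← hc₀]
    rw [this]
    simp [iter, h2]
  rw [eq_cross_iff, h5, h5]
  simp [Inconsistent]

-- The computation never reads or writes `S`, so the flip of `S` can be moved past the inverse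
-- computation; forward and inverse computation then cancel.
variable {G} in
theorem subAMain_map {N : ℕ} (hG : G.Connected) (hN : n ≤ N) (st : Fin n → ℤ) {c : Conf n}
    (hc : ∀ v b, (∀ nm ∈ [QName.X, QName.A], ∀ t i : ℤ, 1 ≤ t → t ≤ N - 1 → 0 ≤ i →
      i ≤ G.degree v → c v (reg nm t i b) = false) ∧ c v (reg .X N 0 b) = false) :
    (downMap G σ st N ∘ onAll (fun _ => flipIfCrossMap N) ∘ upMap G σ st N) c =
      markMap (fun u => st u = 1) c := by
  have h1 : onAll (fun _ => flipIfCrossMap N) (upMap G σ st N c) = fun v =>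
      Function.update (upMap G σ st N c v) qS
        (markMap (fun u => st u = 1) c v qS) := by
    funext v
    rw [markMap, Function.update_self]
    change flipIfCrossMap N (upMap G σ st N c v) = _
    rw [flipIfCrossMap, xorMap_of_notMem (fun j => by fin_cases j <;> simp),
      (ignoresS_upMap G σ st N).apply]
    congr 2
    rw [Bool.eq_iff_iff]
    simp only [decide_eq_true_iff]
    rw [← upMap_cross σ hG hN st hc v]
    simp
  rw [Function.comp, Function.comp, h1, ignoresS_downMap, downMap_upMap]
  funext v
  simp [markMap]

end SubroutineA


/-! ### Preparation -/

section Preparation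

variable {n : ℕ}

/-- The basis states `c` and `c'` agree, except possibly on the qubits `R0` of the parties in
`W`. -/
def Agree (W : Fin n → Prop) (c c' : Conf n) : Prop :=
  ∀ v q, ¬(W v ∧ q = qR0) → c' v q = c v q

open scoped Classical in
/-- The uniform superposition, with amplitudes `a`, of the basis states that agree with `c` except
possibly on the qubits `R0` of the parties in `W`. -/
def IsUniform (W : Fin n → Prop) (a : ℂ) (c : Conf n) (ψ : Conf n →₀ ℂ) : Prop :=
  ∀ c', ψ c' = if Agree W c c' then a else 0

lemma agree_set_iff {W : Fin n → Prop} {c c' : Conf n} {v : Fin n} {q : Qubit}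
    (hq : ¬(W v ∧ q = qR0)) (b : Bool) :
    Agree W c (c'.set v q b) ↔ c v q = b ∧ ∀ u r, ¬(W u ∧ r = qR0) → ¬(u = v ∧ r = q) →
      c' u r = c u r := by
  constructor
  · intro h
    refine ⟨by simpa using (h v q hq).symm, fun u r h1 h2 => ?_⟩
    simpa [Conf.set_apply, h2] using h u r h1
  · rintro ⟨h1, h2⟩ u r h
    rw [Conf.set_apply]
    split_ifs with hu
    · rw [hu.1, hu.2, h1]
    · exact h2 u r h hu

/-- The qubit `q` has the same content in all basis states of the superposition, so the reset finds
this value in the only nonzero branch, and no coherence is lost. -/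
lemma IsUniform.reset {W : Fin n → Prop} {a : ℂ} {c : Conf n} {ψ : Conf n →₀ ℂ}
    (h : IsUniform W a c ψ) {v : Fin n} {q : Qubit} (hq : ¬(W v ∧ q = qR0)) {b : Bool}
    (h0 : reset v q b ψ ≠ 0) : IsUniform W a (c.set v q false) (QLE.reset v q b ψ) := by
  classical
  have hb : c v q = b := by
    by_contra hb
    refine h0 (Finsupp.ext fun c' => ?_)
    rw [reset_apply, h, if_neg (c := Agree _ _ _) fun hA => hb ((agree_set_iff hq b).1 hA).1]
    simp
  intro c'
  rw [reset_apply, h, ← ite_and]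
  refine if_congr ?_ rfl rfl
  rw [agree_set_iff hq]
  constructor
  · rintro ⟨h1, -, h2⟩ u r hr
    rw [Conf.set_apply]
    split_ifs with hu
    · rw [hu.1, hu.2, h1]
    · exact h2 u r hr hu
  · intro hA
    refine ⟨by simpa using hA v q hq, hb, fun u r h1 h2 => ?_⟩
    simpa [Conf.set_apply, h2] using hA u r h1

/-- Since `R0` is 0 before, only the first column of the Hadamard matrix enters, and both its
entries are `1/√2`. -/
lemma IsUniform.hadamard {W : Fin n → Prop} {a : ℂ} {c : Conf n} {ψ : Conf n →₀ ℂ}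
    (h : IsUniform W a c ψ) {v : Fin n} (hv : ¬W v) (hc : c v qR0 = false) :
    IsUniform (fun u => u = v ∨ W u) (((1 / Real.sqrt 2 : ℝ) : ℂ) * a) c
      (applyGate1 hadMat v qR0 ψ) := by
  classical
  intro c'
  have hq : ¬(W v ∧ qR0 = qR0) := fun h => hv h.1
  have h1 : ¬Agree W c (c'.set v qR0 true) := by
    rw [agree_set_iff hq, hc]; simp
  have h2 : Agree W c (c'.set v qR0 false) ↔ Agree (fun u => u = v ∨ W u) c c' := by
    rw [agree_set_iff hq]
    constructor
    · rintro ⟨-, h⟩ u r hr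
      refine h u r (fun h => hr ⟨.inr h.1, h.2⟩) fun h => hr ⟨.inl h.1, h.2⟩
    · intro h
      refine ⟨hc, fun u r h1 h2 => h u r ?_⟩
      rintro ⟨rfl | hu, hr⟩
      · exact h2 ⟨rfl, hr⟩
      · exact h1 ⟨hu, hr⟩
  have h3 : ∀ i, hadMat i (idx1 false) = ((1 / Real.sqrt 2 : ℝ) : ℂ) := by
    intro i
    fin_cases i <;> simp [hadMat, idx1]
  rw [applyGate1_apply, Fintype.sum_bool, h, h, if_neg h1, h3]
  simp only [h2, mul_zero, zero_add, mul_ite]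

variable (G : SimpleGraph (Fin n)) [DecidableRel G.Adj] (σ : PortNumbering G)

/-- The parties know their degrees, and `status` has the values `st`. -/
def KnowsStatus (st : Fin n → ℤ) (κ : Core n) : Prop :=
  ∀ v, κ.mem v .d = G.degree v ∧ κ.mem v .status = st v

variable {G} in
lemma KnowsStatus.setVar {st : Fin n → ℤ} {κ : Core n} (h : KnowsStatus G st κ) (v : Fin n)
    {x : CVar} (a : ℤ) (hd : x ≠ .d) (hs : x ≠ .status) : KnowsStatus G st (κ.setVar v x a) := by
  intro u
  rw [Core.setVar_mem, Core.setVar_mem, if_neg fun h => hd h.2.symm, if_neg fun h => hs h.2.symm]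
  exact h u

/-- A uniform superposition in which the qubits in `Z` are `0`. -/
def Prepared (st : Fin n → ℤ) (W : Fin n → Prop) (Z : Fin n → Qubit → Prop) (κ : Core n) : Prop :=
  KnowsStatus G st κ ∧ ∃ a c, IsUniform W a c κ.ψ ∧ ∀ v q, Z v q → c v q = false

variable {G} {st : Fin n → ℤ} {W : Fin n → Prop} {Z Z' : Fin n → Qubit → Prop}
  {env : PVar → ℤ}

lemma Prepared.mono {κ : Core n} (h : Prepared G st W Z' κ) (hZ : ∀ v q, Z v q → Z' v q) :
    Prepared G st W Z κ := by
  obtain ⟨h1, a, c, h2, h3⟩ := h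
  exact ⟨h1, a, c, h2, fun v q hv => h3 v q (hZ v q hv)⟩

lemma Prepared.setVar {κ : Core n} (h : Prepared G st W Z κ) (v : Fin n)
    {x : CVar} (a : ℤ) (hd : x ≠ .d) (hs : x ≠ .status) : Prepared G st W Z (κ.setVar v x a) :=
  ⟨h.1.setVar v a hd hs, h.2⟩

lemma triple_prep {v : Fin n} {M : (CVar → ℤ) → Prop} {q : QRef} (q' : Qubit)
    (hq : ¬(W v ∧ q' = qR0)) (hq' : ∀ mv, M mv → q.eval (Sum.elim env mv) = q') :
    Cmd.Triple env v (fun κ => Prepared G st W Z κ ∧ M (κ.mem v)) (.prep q)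
      (fun κ => Prepared G st W (fun u r => Z u r ∨ u = v ∧ r = q') κ ∧ M (κ.mem v)) := by
  refine .prep ?_
  rintro κ b ⟨⟨h1, a, c, h2, h3⟩, h4⟩ h0
  have e : q.eval (κ.look env v) = q' := hq' _ h4
  rw [e] at h0 ⊢
  refine ⟨⟨h1, a, _, h2.reset hq h0, fun u r hr => ?_⟩, h4⟩
  rw [Conf.set_apply]
  split_ifs with hu
  · rfl
  · exact h3 u r (hr.resolve_right hu)

open AlgI

lemma triple_prep2 {v : Fin n} {M : (CVar → ℤ) → Prop} {q : Bool → QRef} (nm : QName) (t i : ℤ)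
    (hq : nm ≠ .R0) (hq' : ∀ mv, M mv → ∀ b, (q b).eval (Sum.elim env mv) = reg nm t i b) :
    Cmd.Triple env v (fun κ => Prepared G st W Z κ ∧ M (κ.mem v)) (prep2 q)
      (fun κ => Prepared G st W (fun u r => Z u r ∨ u = v ∧ ∃ b, r = reg nm t i b) κ ∧
        M (κ.mem v)) := by
  have h : ∀ b, ¬(W v ∧ reg nm t i b = qR0) := fun b h => hq (congrArg Qubit.name h.2)
  refine ((triple_prep _ (h true) fun mv hm => hq' mv hm true).seq
    (triple_prep _ (h false) fun mv hm => hq' mv hm false)).post fun κ hκ => ⟨hκ.1.mono ?_, hκ.2⟩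
  rintro u r (hr | ⟨hu, b, hr⟩)
  · exact .inl (.inl hr)
  · cases b
    · exact .inr ⟨hu, hr⟩
    · exact .inl (.inr ⟨hu, hr⟩)

lemma triple_prepPhase : Prog.Triple G σ env (Prepared G st (fun _ => False) fun _ _ => False)
    (.loc prepPhase) (Prepared G st (fun v => st v = 1) fun _ q => q = qS) := by
  refine (Prog.Triple.loc (fun D κ => Prepared G st (fun v => v ∈ D ∧ st v = 1)
    (fun v q => v ∈ D ∧ q = qS) κ) fun D v hv => ?_).conseq (fun κ h => ?_) (fun κ h => ?_)
  · have h1 := triple_prep (G := G) (st := st) (W := fun v => v ∈ D ∧ st v = 1)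
      (Z := fun v q => v ∈ D ∧ q = qS) (env := env) (v := v) (M := fun _ => True) (q := R0)
      qR0 (fun h => hv h.1.1) fun _ _ => rfl
    refine (h1.pre fun κ h => ⟨h, trivial⟩).seq ((triple_prep (M := fun _ => True) (q := S) qS
      (by simp) fun _ _ => rfl).seq (.ite (.gate1 ?_) (.skip ?_)))
    · rintro κ ⟨⟨⟨h2, a, c, h3, h4⟩, -⟩, h5⟩
      have hst : st v = 1 := (h2 v).2.symm.trans h5
      refine ⟨h2, ((1 / Real.sqrt 2 : ℝ) : ℂ) * a, c, ?_, ?_⟩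
      · convert h3.hadamard (v := v) (fun h => hv h.1) (h4 v qR0 (.inl (.inr ⟨rfl, rfl⟩))) using 1
        swap
        · rfl
        funext u
        by_cases hu : u = v
        · subst hu; simp [hst]
        · simp [hu]
      · rintro u q ⟨hu, rfl⟩
        rcases Finset.mem_insert.1 hu with rfl | hu
        · exact h4 _ _ (.inr ⟨rfl, rfl⟩)
        · exact h4 _ _ (.inl (.inl ⟨hu, rfl⟩))
    · rintro κ ⟨⟨⟨h2, a, c, h3, h4⟩, -⟩, h5⟩
      have hst : ¬st v = 1 := fun h => h5 ((h2 v).2.trans h)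
      refine ⟨h2, a, c, ?_, ?_⟩
      · convert h3 using 1
        funext u
        by_cases hu : u = v
        · subst hu; simp [hst]
        · simp [hu]
      · rintro u q ⟨hu, rfl⟩
        rcases Finset.mem_insert.1 hu with rfl | hu
        · exact h4 _ _ (.inr ⟨rfl, rfl⟩)
        · exact h4 _ _ (.inl (.inl ⟨hu, rfl⟩))
  · simpa using h
  · simpa using h

/-- The registers of `v` with row `t`. -/
def WorkRow (t : ℤ) (d : ℤ) (q : Qubit) : Prop :=
  (q.name = .X ∨ q.name = .A) ∧ q.row = t ∧ 0 ≤ q.col ∧ q.col ≤ d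

lemma triple_prepRow : Prog.Triple G σ env (Prepared G st W Z)
    (.loc (.forUp .i (num 0) dd (.seq (prep2 (X tt ii)) (prep2 (A tt ii)))))
    (Prepared G st W fun v q => Z v q ∨ WorkRow (env .t) (G.degree v) q) := by
  refine (Prog.Triple.loc (fun D κ => Prepared G st W
    (fun v q => Z v q ∨ v ∈ D ∧ WorkRow (env .t) (G.degree v) q) κ) fun D v hv => ?_).conseq
    (fun κ h => h.mono (by simp)) (fun κ h => h.mono (by simp))
  -- After `j` iterations the columns `0, …, j - 1` of party `v` are blank, whence the bound `j -
  -- 1`.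
  refine (Cmd.Triple.forUp 0 (G.degree v) (fun j κ => Prepared G st W
    (fun u q => Z u q ∨ u ∈ D ∧ WorkRow (env .t) (G.degree u) q ∨
      u = v ∧ WorkRow (env .t) (j - 1) q) κ) (fun j κ y h => h.setVar v y (by simp) (by simp))
      (fun j hj => ?_) fun κ h => ⟨rfl, (h.1 v).1, h.mono ?_⟩).post fun κ h => h.mono ?_
  · refine ((triple_prep2 (M := fun mv => mv .i = 0 + j) (q := X tt ii) .X (env .t) j (by simp)
      (fun mv hm b => ?_)).seq (triple_prep2 (M := fun mv => mv .i = 0 + j) (q := A tt ii) .A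
      (env .t) j (by simp) (fun mv hm b => ?_))).post fun κ h => h.1.mono ?_
    · rw [zero_add] at hm
      rw [reg, ← hm]; rfl
    · rw [zero_add] at hm
      rw [reg, ← hm]; rfl
    · rintro u ⟨nm, t, i, b⟩ (h | h | ⟨rfl, h1, h2, h3, h4⟩)
      · exact .inl (.inl (.inl h))
      · exact .inl (.inl (.inr (.inl h)))
      · simp only at h1 h2 h3 h4
        subst h2
        by_cases hi : i = j
        · subst hi
          rcases h1 with rfl | rfl
          · exact .inl (.inr ⟨rfl, b, rfl⟩)
          · exact .inr ⟨rfl, b, rfl⟩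
        · refine .inl (.inl (.inr (.inr ⟨rfl, h1, rfl, h3, ?_⟩)))
          push_cast at h4
          simp only
          omega
  · rintro u q (h | ⟨h1, h2⟩)
    · exact .inl h
    · rcases Finset.mem_insert.1 h1 with rfl | h1
      · refine .inr (.inr ⟨rfl, ?_⟩)
        convert h2 using 1
        omega
      · exact .inr (.inl ⟨h1, h2⟩)
  · rintro u q (h | h | ⟨-, -, -, h3, h4⟩)
    · exact .inl h
    · exact .inr h
    · push_cast at h4
      omega

lemma triple_subAprep {N : ℕ} (henv : env .N = N) :
    Prog.Triple G σ env (Prepared G st W fun _ q => q = qS) subAprep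
      (Prepared G st W fun v q => q = qS ∨ (∃ t : ℤ, 1 ≤ t ∧ t ≤ N - 1 ∧ WorkRow t (G.degree v) q) ∨
        ∃ b, q = reg .X N 0 b) := by
  have h1 := Prog.Triple.forUp (G := G) (σ := σ) (env := env) (x := .t) (lo := .lit 1) (hi := pN1)
    (p := .loc (.forUp .i (num 0) dd (.seq (prep2 (X tt ii)) (prep2 (A tt ii)))))
    (fun j => Prepared G st W fun v q => q = qS ∨
      ∃ t : ℤ, 1 ≤ t ∧ t ≤ j ∧ WorkRow t (G.degree v) q) fun j hj => by
      refine (triple_prepRow σ).post fun κ h => h.mono ?_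
      rintro v q (h | ⟨t, ht, ht', h⟩)
      · exact .inl (.inl h)
      · by_cases htj : t = j + 1
        · subst htj
          refine .inr ?_
          simpa [Expr.eval, add_comm] using h
        · exact .inl (.inr ⟨t, ht, by push_cast at ht'; omega, h⟩)
  refine (h1.pre fun κ h => h.mono ?_).seq ((Prog.Triple.loc (fun D κ => Prepared G st W
    (fun v q => q = qS ∨ (∃ t : ℤ, 1 ≤ t ∧ t ≤ N - 1 ∧ WorkRow t (G.degree v) q) ∨
        v ∈ D ∧ ∃ b, q = reg .X N 0 b) κ) fun D v hv => ?_).conseq (fun κ h => h.mono ?_)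
        (fun κ h => h.mono ?_))
  · refine ((triple_prep2 (M := fun _ => True) .X N 0 (by simp) (fun mv _ b => ?_)).pre
      fun κ h => ⟨h, trivial⟩).post fun κ h => h.1.mono ?_
    · simp [X, QRef.eval, pv, num, Expr.eval, henv]
    · rintro u q (h | h | ⟨h, hq⟩)
      · exact .inl (.inl h)
      · exact .inl (.inr (.inl h))
      · rcases Finset.mem_insert.1 h with rfl | h
        · exact .inr ⟨rfl, hq⟩
        · exact .inl (.inr (.inr ⟨h, hq⟩))
  · rintro v q (h | ⟨t, h1, h2, h⟩ | ⟨h, -⟩)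
    · exact .inl h
    · refine .inr ⟨t, h1, ?_, h⟩
      simp only [pN1, Expr.eval, henv]
      omega
    · simp at h
  · rintro v q (h | h | h)
    · exact .inl h
    · exact .inr (.inl h)
    · exact .inr (.inr ⟨Finset.mem_univ _, h⟩)
  · rintro v q (h | ⟨t, h1, h2, h⟩)
    · exact h
    · push_cast at h2
      omega

lemma markMap_apply_of_ne (E : Fin n → Prop) (c : Conf n) (v : Fin n) {q : Qubit} (hq : q ≠ qS) :
    markMap E c v q = c v q := by
  simp [markMap, hq]

lemma markMap_qS (E : Fin n → Prop) (c : Conf n) (v : Fin n) :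
    markMap E c v qS = (c v qS ^^ open scoped Classical in decide (Inconsistent E c)) := by
  simp [markMap]

lemma inconsistent_markMap (E : Fin n → Prop) (c : Conf n) :
    Inconsistent E (markMap E c) ↔ Inconsistent E c := by
  simp only [Inconsistent, markMap_apply_of_ne E c _ (show qR0 ≠ qS by simp)]

/-- Whether a basis state is inconsistent depends only on the qubits `R0`, which marking does not
change. -/
lemma markMap_involutive (E : Fin n → Prop) : Function.Involutive (markMap (n := n) E) := by
  intro c
  funext v q
  by_cases hq : q = qS
  · subst hq
    rw [markMap_qS, markMap_qS]
    by_cases h : Inconsistent E c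
    · simp [h, (inconsistent_markMap E c).2 h]
    · simp [h, mt (inconsistent_markMap E c).1 h]
  · rw [markMap_apply_of_ne E _ v hq, markMap_apply_of_ne E _ v hq]

open scoped Classical in
/-- The state after Subroutine A. -/
def Marked (st : Fin n → ℤ) (κ : Core n) : Prop :=
  ∃ (a : ℂ) (c : Conf n), (∀ v, c v qS = false) ∧
    ∀ c', κ.ψ c' = if Agree (fun v => st v = 1) c (markMap (fun v => st v = 1) c') then a else 0

/-- After the preparation, the work registers are blank in every basis state of the superposition,
so `subAMain_map` applies to the whole support. -/
theorem triple_subA {N : ℕ} (hG : G.Connected) (hN : n ≤ N) (henv : env .N = N) :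
    Prog.Triple G σ env (Prepared G st (fun v => st v = 1) fun _ q => q = qS) subA
      fun κ => KnowsStatus G st κ ∧ Marked st κ := by
  refine (triple_subAprep σ henv).seq (R := fun κ => KnowsStatus G st κ ∧ Marked st κ) ?_
  rintro s ⟨h1, a, c, h2, h3⟩ s' hs' h0
  obtain ⟨⟨h4, h5, h6⟩, h7⟩ := acts_subAMain G σ henv st s.core.ψ s.core.mem s.core.inbox s
    ⟨⟨rfl, rfl, fun _ _ _ => rfl⟩, h1⟩ s' hs' h0
  refine ⟨h7, a, c, fun v => h3 v qS (.inl rfl), fun c' => ?_⟩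
  -- The map of the program and `markMap` need to agree only on the support; the latter is an
  -- involution, which gives the amplitudes by substitution.
  rw [h4, Finsupp.mapDomain_congr (g := markMap fun v => st v = 1) fun d hd => ?_,
    mapDomain_involutive_apply (markMap_involutive _)]
  · exact h2 _
  · have hA : Agree (fun v => st v = 1) c d := by
      by_contra hA
      rw [Finsupp.mem_support_iff, h2, if_neg hA] at hd
      exact hd rfl
    refine subAMain_map σ hG hN st fun v b => ⟨fun nm hnm t i ht ht' hi hi' => ?_, ?_⟩
    · rw [hA v _ (by rintro ⟨-, h⟩; simp only [Qubit.mk.injEq] at h; simp [h.1] at hnm)]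
      exact h3 v _ (.inr (.inl ⟨t, ht, ht', by simpa using hnm, rfl, hi, hi'⟩))
    · rw [hA v _ (by simp)]
      exact h3 v _ (.inr (.inr ⟨b, rfl⟩))

end Preparation


/-! ### Subroutine B -/

section SubroutineB

variable {n : ℕ}

/-- The basis states `c` and `c'` agree, except possibly on the qubits `R0` and `R1` of the parties
in `E`. -/
def AgreeR (E : Finset (Fin n)) (c c' : Conf n) : Prop :=
  ∀ v q, ¬(v ∈ E ∧ (q = qR0 ∨ q = qR1)) → c' v q = c v q

/-- Change `R0` and `R1` of party `v`. -/
def Conf.setR (c : Conf n) (v : Fin n) (b₀ b₁ : Bool) : Conf n := (c.set v qR0 b₀).set v qR1 b₁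

lemma Conf.setR_R0 (c : Conf n) (v : Fin n) (b₀ b₁ : Bool) (u : Fin n) :
    c.setR v b₀ b₁ u qR0 = if u = v then b₀ else c u qR0 := by
  simp [Conf.setR, Conf.set_apply]

lemma Conf.setR_R1 (c : Conf n) (v : Fin n) (b₀ b₁ : Bool) (u : Fin n) :
    c.setR v b₀ b₁ u qR1 = if u = v then b₁ else c u qR1 := by
  simp [Conf.setR, Conf.set_apply]

lemma Conf.setR_of_ne (c : Conf n) (v : Fin n) (b₀ b₁ : Bool) (u : Fin n) {q : Qubit}
    (h : q ≠ qR0) (h' : q ≠ qR1) : c.setR v b₀ b₁ u q = c u q := by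
  simp [Conf.setR, Conf.set_apply, h, h']

lemma Conf.set_R0_eq (c : Conf n) (v : Fin n) (b : Bool) :
    c.set v qR0 b = c.setR v b (c v qR1) := by
  funext u q
  by_cases h0 : q = qR0
  · subst h0; rw [Conf.setR_R0]; simp [Conf.set_apply]
  by_cases h1 : q = qR1
  · subst h1; rw [Conf.setR_R1]; simp +contextual [Conf.set_apply]
  · rw [Conf.setR_of_ne _ _ _ _ _ h0 h1]; simp [Conf.set_apply, h0]

lemma Conf.set_R1_eq (c : Conf n) (v : Fin n) (b : Bool) :
    c.set v qR1 b = c.setR v (c v qR0) b := by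
  rw [Conf.setR, Conf.set_eta]

lemma agreeR_setR {E : Finset (Fin n)} {c c' : Conf n} {v : Fin n} (hv : v ∈ E) (b₀ b₁ : Bool) :
    AgreeR E c (c'.setR v b₀ b₁) ↔ AgreeR E c c' := by
  have key : ∀ u q, ¬(u ∈ E ∧ (q = qR0 ∨ q = qR1)) → c'.setR v b₀ b₁ u q = c' u q := by
    intro u q h
    by_cases hu : u = v
    · subst hu
      have h0 : q ≠ qR0 := fun h0 => h ⟨hv, .inl h0⟩
      have h1 : q ≠ qR1 := fun h1 => h ⟨hv, .inr h1⟩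
      exact Conf.setR_of_ne _ _ _ _ _ h0 h1
    · simp [Conf.setR, Conf.set_apply, hu]
  exact ⟨fun h u q hq => (key u q hq).symm.trans (h u q hq),
    fun h u q hq => (key u q hq).trans (h u q hq)⟩

open scoped Classical in
/-- The state is a sum over `β ∈ {0, 1}` of product states, where `w v β` holds the amplitudes of
the qubits `R0` and `R1` of the party `v ∈ E`, and the other qubits are as in `c`. -/
def IsCat (E : Finset (Fin n)) (a : ℂ) (c : Conf n) (w : Fin n → Bool → Bool → Bool → ℂ)
    (ψ : Conf n →₀ ℂ) : Prop :=
  ∀ c', ψ c' = if AgreeR E c c' then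
    a * ∑ β : Bool, ∏ v ∈ E, w v β (c' v qR0) (c' v qR1) else 0

lemma IsCat.congr {E : Finset (Fin n)} {a : ℂ} {c : Conf n} {w w' : Fin n → Bool → Bool → Bool → ℂ}
    {ψ : Conf n →₀ ℂ} (h : IsCat E a c w ψ) (hw : ∀ v ∈ E, w v = w' v) : IsCat E a c w' ψ := by
  intro c'
  rw [h c']
  congr 2
  exact Finset.sum_congr rfl fun β _ => Finset.prod_congr rfl fun v hv => by rw [hw v hv]

/-- A linear operation on `R0` and `R1` of one party changes only its factor in each of the two
products. Resets, CNOT and the gates `U_k`, `V_k` are all obtained by choosing the kernel `K`. -/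
lemma IsCat.gate {E : Finset (Fin n)} {a : ℂ} {c : Conf n} {w : Fin n → Bool → Bool → Bool → ℂ}
    {ψ ψ' : Conf n →₀ ℂ} (h : IsCat E a c w ψ) {v : Fin n} (hv : v ∈ E)
    (K : Bool → Bool → Bool → Bool → ℂ)
    (hK : ∀ c', ψ' c' = ∑ b₀ : Bool, ∑ b₁ : Bool,
      K (c' v qR0) (c' v qR1) b₀ b₁ * ψ (c'.setR v b₀ b₁)) :
    IsCat E a c (Function.update w v fun β r₀ r₁ =>
      ∑ b₀ : Bool, ∑ b₁ : Bool, K r₀ r₁ b₀ b₁ * w v β b₀ b₁) ψ' := by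
  classical
  intro c'
  have h1 : ∀ b₀ b₁, ψ (c'.setR v b₀ b₁) = if AgreeR E c c' then
      a * ∑ β : Bool, (w v β b₀ b₁ * ∏ u ∈ E.erase v, w u β (c' u qR0) (c' u qR1)) else 0 := by
    intro b₀ b₁
    rw [h]
    refine if_congr (agreeR_setR hv b₀ b₁) ?_ rfl
    congr 1
    refine Finset.sum_congr rfl fun β _ => ?_
    rw [← Finset.mul_prod_erase E _ hv, Conf.setR_R0, Conf.setR_R1, if_pos rfl, if_pos rfl]
    congr 1
    refine Finset.prod_congr rfl fun u hu => ?_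
    rw [Conf.setR_R0, Conf.setR_R1, if_neg (Finset.ne_of_mem_erase hu),
      if_neg (Finset.ne_of_mem_erase hu)]
  have h2 : ∀ β, ∏ u ∈ E, Function.update w v (fun β r₀ r₁ =>
      ∑ b₀ : Bool, ∑ b₁ : Bool, K r₀ r₁ b₀ b₁ * w v β b₀ b₁) u β (c' u qR0) (c' u qR1) =
      (∑ b₀ : Bool, ∑ b₁ : Bool, K (c' v qR0) (c' v qR1) b₀ b₁ * w v β b₀ b₁) *
        ∏ u ∈ E.erase v, w u β (c' u qR0) (c' u qR1) := by
    intro β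
    rw [← Finset.mul_prod_erase E _ hv, Function.update_self]
    congr 1
    refine Finset.prod_congr rfl fun u hu => ?_
    rw [Function.update_of_ne (Finset.ne_of_mem_erase hu)]
  rw [hK c']
  simp only [h1, h2]
  split_ifs with hA
  · simp only [Fintype.sum_bool]
    ring
  · simp

lemma IsCat.reset {E : Finset (Fin n)} {a : ℂ} {c : Conf n} {w : Fin n → Bool → Bool → Bool → ℂ}
    {ψ : Conf n →₀ ℂ} (h : IsCat E a c w ψ) {v : Fin n} (hv : v ∈ E) (b : Bool) :
    IsCat E a c (Function.update w v fun β r₀ r₁ => if r₁ = false then w v β r₀ b else 0)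
      (QLE.reset v qR1 b ψ) := by
  have := h.gate (ψ' := QLE.reset v qR1 b ψ) hv
    (fun r₀ r₁ b₀ b₁ => if r₁ = false ∧ b₀ = r₀ ∧ b₁ = b then 1 else 0) fun c' => by
      rw [reset_apply, Conf.set_R1_eq]
      cases c' v qR1 <;> cases c' v qR0 <;> cases b <;> simp
  convert this using 2
  funext β r₀ r₁
  cases r₁ <;> cases r₀ <;> cases b <;> simp

lemma IsCat.gate1 {E : Finset (Fin n)} {a : ℂ} {c : Conf n} {w : Fin n → Bool → Bool → Bool → ℂ}
    {ψ : Conf n →₀ ℂ} (h : IsCat E a c w ψ) {v : Fin n} (hv : v ∈ E)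
    (U : Matrix (Fin 2) (Fin 2) ℂ) :
    IsCat E a c (Function.update w v fun β r₀ r₁ => ∑ b, U (idx1 r₀) (idx1 b) * w v β b r₁)
      (applyGate1 U v qR0 ψ) := by
  have := h.gate (ψ' := applyGate1 U v qR0 ψ) hv
    (fun r₀ r₁ b₀ b₁ => if b₁ = r₁ then U (idx1 r₀) (idx1 b₀) else 0) fun c' => by
      simp only [applyGate1_apply, Conf.set_R0_eq]
      simp
  simpa using this

lemma IsCat.cnot {E : Finset (Fin n)} {a : ℂ} {c : Conf n} {w : Fin n → Bool → Bool → Bool → ℂ}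
    {ψ : Conf n →₀ ℂ} (h : IsCat E a c w ψ) {v : Fin n} (hv : v ∈ E) :
    IsCat E a c (Function.update w v fun β r₀ r₁ => w v β r₀ (r₁ ^^ r₀))
      (ψ.mapDomain (onParty v (cnotMap qR0 qR1))) := by
  have := h.gate (ψ' := ψ.mapDomain (onParty v (cnotMap qR0 qR1))) hv
    (fun r₀ r₁ b₀ b₁ => if b₀ = r₀ ∧ b₁ = (r₁ ^^ r₀) then 1 else 0) fun c' => by
      have hi : Function.Involutive (onParty v (cnotMap qR0 qR1)) :=
        onParty_involutive v (xorMap_involutive _ _ _)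
      rw [mapDomain_involutive_apply hi]
      have e : onParty v (cnotMap qR0 qR1) c' = c'.setR v (c' v qR0) (c' v qR1 ^^ c' v qR0) := by
        rw [← Conf.set_R1_eq]
        unfold onParty cnotMap Conf.set
        rw [xorMap_of_notMem (by simp)]
      rw [e]
      cases c' v qR1 <;> cases c' v qR0 <;> simp
  convert this using 2
  funext β r₀ r₁
  cases r₁ <;> cases r₀ <;> simp

lemma IsCat.gate2 {E : Finset (Fin n)} {a : ℂ} {c : Conf n} {w : Fin n → Bool → Bool → Bool → ℂ}
    {ψ : Conf n →₀ ℂ} (h : IsCat E a c w ψ) {v : Fin n} (hv : v ∈ E)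
    (U : Matrix (Fin 4) (Fin 4) ℂ) :
    IsCat E a c (Function.update w v fun β r₀ r₁ =>
        ∑ b₀, ∑ b₁, U (idx2 r₀ r₁) (idx2 b₀ b₁) * w v β b₀ b₁)
      (applyGate2 U v qR0 qR1 ψ) :=
  h.gate hv (fun r₀ r₁ b₀ b₁ => U (idx2 r₀ r₁) (idx2 b₀ b₁)) fun c' => by
    rw [applyGate2_apply U v (by simp)]
    rfl

/-- The amplitudes of `R0` and `R1` after Subroutine B if `R0` was in the state `β`. -/
noncomputable def finalAmp (k : ℤ) (β r₀ r₁ : Bool) : ℂ :=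
  if Even k then (if r₁ = false then UMat k (idx1 r₀) (idx1 β) else 0)
  else VMat k (idx2 r₀ r₁) (idx2 β β)

lemma om_pow {k : ℕ} (hk : k ≠ 0) : om k ^ k = -1 := by
  rw [om, ← Complex.exp_nat_mul]
  have h : (k : ℂ) * (Complex.I * ((Real.pi : ℂ) / ((k : ℤ) : ℂ))) = Real.pi * Complex.I := by
    have : (k : ℂ) ≠ 0 := by exact_mod_cast hk
    push_cast
    field_simp
  rw [h, Complex.exp_pi_mul_I]

/-- No basis state in which all the parties have the same contents of `R0` and `R1` has positive
probability after Subroutine B. -/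
theorem sum_finalAmp_pow {k : ℕ} (hk : 2 ≤ k) (r₀ r₁ : Bool) :
    ∑ β, finalAmp k β r₀ r₁ ^ k = 0 := by
  have hk0 : k ≠ 0 := by omega
  have hom := om_pow hk0
  have hom' : (om k)⁻¹ ^ k = -1 := by rw [inv_pow, hom]; norm_num
  rw [Fintype.sum_bool]
  -- The normalizing factor of the matrix can be dropped.
  have key : ∀ a x y : ℂ, x ^ k + y ^ k = 0 → (a * x) ^ k + (a * y) ^ k = 0 := by
    intro a x y h
    rw [mul_pow, mul_pow, ← mul_add, h, mul_zero]
  by_cases he : Even (k : ℤ)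
  · have he' : Even k := by exact_mod_cast he
    simp only [finalAmp, he, if_true]
    cases r₁
    · rw [if_pos rfl]
      refine key _ _ _ ?_
      -- The rows of `U_k` give `ω⁻ᵏ + 1` and `1 + (-ω)ᵏ`, which vanish for even `k`.
      cases r₀ <;> simp [idx1, he'.neg_pow, hom]
    · simp [hk0]
  · have ho : Odd k := by
      rw [← Nat.not_even_iff_odd]
      exact fun h => he (by exact_mod_cast h)
    simp only [finalAmp, he, if_false]
    refine key _ _ _ ?_
    -- Only the columns `00` and `11` of `V_k` occur. In its first two rows the entries have ratio
    -- `ω` and `ω⁻¹`, in the third they are opposite and `k` is odd, and in the fourth both are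
    -- zero.
    cases r₀ <;> cases r₁ <;> simp [idx2, ho.neg_pow, div_pow, hom, hk0] <;> ring

/-- The eligible parties. -/
def elig (st : Fin n → ℤ) : Finset (Fin n) := Finset.univ.filter fun v => st v = 1

lemma mem_elig {st : Fin n → ℤ} {v : Fin n} : v ∈ elig st ↔ st v = 1 := by simp [elig]

/-- The amplitudes of `R0` and `R1` if the parties in `D` have executed Subroutine B. -/
noncomputable def catAmp (k : ℤ) (D : Finset (Fin n)) (c : Conf n) (v : Fin n)
    (β r₀ r₁ : Bool) : ℂ :=
  if v ∈ D then finalAmp k β r₀ r₁ else if r₀ = β ∧ r₁ = c v qR1 then 1 else 0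

/-- The state if the check had the result consistent and the parties in `D` have executed
Subroutine B. -/
def ConsistentState (k : ℤ) (st : Fin n → ℤ) (D : Finset (Fin n)) (ψ : Conf n →₀ ℂ) : Prop :=
  ∃ a c, (∀ v, c v qS = false) ∧ IsCat (elig st) a c (catAmp k D c) ψ

/-- The state if the check had the result inconsistent. -/
def InconsistentState (st : Fin n → ℤ) (ψ : Conf n →₀ ℂ) : Prop :=
  ∃ c, (∀ v, c v qS = true) ∧
    ∀ c', ψ c' ≠ 0 → AgreeR (elig st) c c' ∧ Inconsistent (fun v => st v = 1) c'

lemma agree_imp_agreeR {st : Fin n → ℤ} {c c' : Conf n} (h : Agree (fun v => st v = 1) c c') :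
    AgreeR (elig st) c c' :=
  fun v q hq => h v q fun h' => hq ⟨mem_elig.2 h'.1, .inl h'.2⟩

/-- A basis state survives if its eligible parties hold a common bit in `R0`. Such assignments are
those for which one of the two products of indicators, for `β = 0` and `β = 1`, is 1; this is the
cat state. -/
lemma project_marked_false {k : ℤ} {st : Fin n → ℤ} {κ : Core n} (h : Marked st κ)
    (hE : (elig st).Nonempty) (v : Fin n) : ConsistentState k st ∅ (project v qS false κ.ψ) := by
  classical
  obtain ⟨a, c, hS, h⟩ := h
  refine ⟨a, c, hS, fun c' => ?_⟩
  have hw : ∀ β, ∏ u ∈ elig st, catAmp k ∅ c u β (c' u qR0) (c' u qR1) =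
      if ∀ u ∈ elig st, c' u qR0 = β ∧ c' u qR1 = c u qR1 then 1 else 0 := by
    intro β
    simp only [catAmp, Finset.notMem_empty, if_false]
    rw [Finset.prod_ite_zero, Finset.prod_const_one]
    congr
  simp only [hw]
  rw [project_apply, h]
  obtain ⟨u₀, hu₀⟩ := hE
  by_cases hI : Inconsistent (fun v => st v = 1) c'
  · have hβ : ∀ β, ¬∀ u ∈ elig st, c' u qR0 = β ∧ c' u qR1 = c u qR1 := by
      intro β hβ
      obtain ⟨u, hu, hu'⟩ := hI (!β)
      rw [(hβ u (mem_elig.2 hu)).1] at hu'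
      cases β <;> simp at hu'
    simp only [hβ, if_false, Finset.sum_const_zero, mul_zero, ite_self]
    split_ifs with h1 h2
    · have := h2 v qS (by simp)
      rw [markMap_qS, h1, hS] at this
      simp [hI] at this
    · rfl
    · rfl
  · have hm : markMap (fun v => st v = 1) c' = c' := by
      funext u q
      by_cases hq : q = qS
      · subst hq; rw [markMap_qS]; simp [hI]
      · exact markMap_apply_of_ne _ _ _ hq
    rw [hm]
    have hc : ∀ u ∈ elig st, c' u qR0 = c' u₀ qR0 := by
      unfold Inconsistent at hI
      push Not at hI
      obtain ⟨b, hb⟩ := hI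
      have hb' : ∀ u ∈ elig st, c' u qR0 = !b := by
        intro u hu
        have := hb u (mem_elig.1 hu)
        revert this
        cases c' u qR0 <;> cases b <;> simp
      intro u hu
      rw [hb' u hu, hb' u₀ hu₀]
    -- As an eligible party `u₀` exists, the common bit is determined, and exactly one value of `β`
    -- can contribute.
    have hsum : (∑ β : Bool, if ∀ u ∈ elig st, c' u qR0 = β ∧ c' u qR1 = c u qR1 then (1 : ℂ)
        else 0) = if ∀ u ∈ elig st, c' u qR1 = c u qR1 then 1 else 0 := by
      rw [Finset.sum_eq_single (c' u₀ qR0)]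
      · exact if_congr ⟨fun h u hu => (h u hu).2, fun h u hu => ⟨hc u hu, h u hu⟩⟩ rfl rfl
      · exact fun β _ hβ => if_neg fun h => hβ (h u₀ hu₀).1.symm
      · simp
    rw [hsum, mul_ite, mul_one, mul_zero, ← ite_and, ← ite_and]
    refine if_congr ⟨fun h => ⟨agree_imp_agreeR h.2, fun u _ => h.2 u qR1 (by simp)⟩,
      fun h => ⟨(h.1 v qS (by simp)).trans (hS v), fun u q hq => ?_⟩⟩ rfl rfl
    by_cases hq' : u ∈ elig st ∧ (q = qR0 ∨ q = qR1)
    · obtain ⟨hu, rfl | rfl⟩ := hq'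
      · exact (hq ⟨mem_elig.1 hu, rfl⟩).elim
      · exact h.2 u hu
    · exact h.1 u q hq'

lemma project_marked_true {st : Fin n → ℤ} {κ : Core n} (h : Marked st κ) (v : Fin n) :
    InconsistentState st (project v qS true κ.ψ) := by
  classical
  obtain ⟨a, c, hS, h⟩ := h
  refine ⟨fun u => Function.update (c u) qS true, by simp, fun c' h0 => ?_⟩
  rw [project_apply, h] at h0
  have h1 : c' v qS = true := by
    by_contra h1; exact h0 (if_neg h1)
  have h2 : Agree (fun v => st v = 1) c (markMap (fun v => st v = 1) c') := by
    by_contra h2; simp [h2] at h0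
  have hI : Inconsistent (fun v => st v = 1) c' := by
    have := h2 v qS (by simp)
    rw [markMap_qS, h1, hS] at this
    simpa using this
  refine ⟨fun u q hq => ?_, hI⟩
  by_cases hq' : q = qS
  · subst hq'
    have := h2 u qS (by simp)
    rw [markMap_qS, hS] at this
    simpa [hI] using this
  · have := agree_imp_agreeR h2 u q hq
    rw [markMap_apply_of_ne _ _ _ hq'] at this
    simpa [hq'] using this

/-- Each party measures its own `S`, but all of them carry the same bit. After the first measurement
the results of the others are therefore determined and leave the state unchanged. -/
lemma project_eq_self {v : Fin n} {q : Qubit} {b b' : Bool} {ψ : Conf n →₀ ℂ}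
    (h : ∀ c, ψ c ≠ 0 → c v q = b) (h0 : project v q b' ψ ≠ 0) :
    b' = b ∧ project v q b' ψ = ψ := by
  obtain ⟨c, hc⟩ := Finsupp.ne_iff.1 h0
  rw [project_apply] at hc
  have hb : b' = b := by
    split_ifs at hc with hb
    · rw [← hb, h c hc]
    · exact (hc rfl).elim
  subst hb
  refine ⟨rfl, Finsupp.ext fun c => ?_⟩
  rw [project_apply]
  split_ifs with hc'
  · rfl
  · by_contra h1
    exact hc' (h c (Ne.symm h1))

/-- The states that occur before a party executes `checkPhase`. -/
def CheckState (k : ℤ) (st : Fin n → ℤ) (D : Finset (Fin n)) (κ : Core n) : Prop :=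
  D = ∅ ∧ Marked st κ ∨ ConsistentState k st D κ.ψ ∨ InconsistentState st κ.ψ

lemma CheckState.project {k : ℤ} {st : Fin n → ℤ} {D : Finset (Fin n)} {κ : Core n}
    (h : CheckState k st D κ) (hE : (elig st).Nonempty) {v : Fin n} {b : Bool}
    (h0 : project v qS b κ.ψ ≠ 0) :
    b = false ∧ ConsistentState k st D (project v qS b κ.ψ) ∨
      b = true ∧ InconsistentState st (QLE.project v qS b κ.ψ) := by
  rcases h with ⟨rfl, h⟩ | h | h
  · cases b
    · exact .inl ⟨rfl, project_marked_false h hE v⟩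
    · exact .inr ⟨rfl, project_marked_true h v⟩
  · obtain ⟨a, c, hS, h'⟩ := id h
    have h1 : ∀ c', κ.ψ c' ≠ 0 → c' v qS = false := by
      intro c' hc'
      have : AgreeR (elig st) c c' := by
        by_contra hA
        exact hc' ((h' c').trans (if_neg hA))
      rw [this v qS (by simp), hS]
    obtain ⟨hb, he⟩ := project_eq_self h1 h0
    exact .inl ⟨hb, he.symm ▸ h⟩
  · obtain ⟨c, hS, h'⟩ := id h
    have h1 : ∀ c', κ.ψ c' ≠ 0 → c' v qS = true := fun c' hc' => by
      rw [(h' c' hc').1 v qS (by simp), hS]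
    obtain ⟨hb, he⟩ := project_eq_self h1 h0
    exact .inr ⟨hb, he.symm ▸ h⟩

lemma InconsistentState.reset {st : Fin n → ℤ} {ψ : Conf n →₀ ℂ} (h : InconsistentState st ψ)
    (v : Fin n) (b : Bool) : InconsistentState st (reset v qR1 b ψ) := by
  obtain ⟨c, hS, h⟩ := h
  refine ⟨c.set v qR1 false, fun u => by simp [Conf.set_apply, hS], fun c' h0 => ?_⟩
  rw [reset_apply] at h0
  split_ifs at h0 with h1
  · obtain ⟨h2, h3⟩ := h _ h0
    refine ⟨fun u q hq => ?_, fun b => ?_⟩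
    · have := h2 u q hq
      rw [Conf.set_apply] at this ⊢
      split_ifs at this ⊢ with hu
      · rw [hu.1, hu.2, h1]
      · exact this
    · obtain ⟨u, hu, hu'⟩ := h3 b
      exact ⟨u, hu, by simpa [Conf.set_apply] using hu'⟩
  · exact (h0 rfl).elim

variable {G : SimpleGraph (Fin n)} [DecidableRel G.Adj] (σ : PortNumbering G) {st : Fin n → ℤ}
  {env : PVar → ℤ}

open AlgI

/-- Before its turn, a party still has in `R1` the fixed bit of `c`. The reset must find this bit,
as the other branch is zero, and so it does not disturb the superposition. -/
lemma IsCat.reset_fresh {k : ℤ} {D : Finset (Fin n)} {a : ℂ} {c : Conf n} {ψ : Conf n →₀ ℂ}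
    (h : IsCat (elig st) a c (catAmp k D c) ψ) {v : Fin n} (hv : v ∈ elig st) (hD : v ∉ D)
    {b : Bool} (h0 : QLE.reset v qR1 b ψ ≠ 0) :
    IsCat (elig st) a c (Function.update (catAmp k D c) v fun β r₀ r₁ =>
      if r₀ = β ∧ r₁ = false then 1 else 0) (QLE.reset v qR1 b ψ) := by
  classical
  have h1 := h.reset hv b
  have hb : b = c v qR1 := by
    by_contra hb
    refine h0 (Finsupp.ext fun c' => ?_)
    have hz : ∀ β, ∏ u ∈ elig st, Function.update (catAmp k D c) v (fun β r₀ r₁ =>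
        if r₁ = false then catAmp k D c v β r₀ b else 0) u β (c' u qR0) (c' u qR1) = 0 :=
      fun β => Finset.prod_eq_zero hv (by simp [catAmp, hD, hb])
    rw [h1 c']
    simp only [hz, Finset.sum_const_zero, mul_zero, ite_self, Finsupp.coe_zero, Pi.zero_apply]
  convert h1 using 2
  funext β r₀ r₁
  simp only [catAmp, hD, hb, if_false, and_true]
  rw [← ite_and]
  exact if_congr and_comm rfl rfl

lemma catAmp_insert {k : ℤ} {D : Finset (Fin n)} {c : Conf n} {u v : Fin n} (h : u ≠ v) :
    catAmp k (insert v D) c u = catAmp k D c u := by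
  funext β r₀ r₁
  simp [catAmp, h]

lemma catAmp_self {k : ℤ} {D : Finset (Fin n)} {c : Conf n} {v : Fin n} :
    catAmp k (insert v D) c v = finalAmp k := by
  funext β r₀ r₁
  simp [catAmp]

/-- For odd `k` the assertion after the CNOT is that the component `β` holds `|ββ⟩`, so `V_k`
contributes its column `ββ`. The predicate `P` carries along facts that do not depend on the quantum
state. -/
lemma triple_subB {k : ℕ} (hk : 2 ≤ k) (henv : env .k = k) {D : Finset (Fin n)} {v : Fin n}
    (hv : st v = 1) (P : Core n → Prop) (hP : ∀ κ ψ, P κ → P ⟨ψ, κ.mem, κ.inbox⟩) :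
    Cmd.Triple env v (fun κ => P κ ∧ ∃ a c, (∀ v, c v qS = false) ∧ IsCat (elig st) a c
      (Function.update (catAmp k D c) v fun β r₀ r₁ => if r₀ = β ∧ r₁ = false then 1 else 0) κ.ψ)
      subB (fun κ => P κ ∧ ConsistentState k st (insert v D) κ.ψ) := by
  have hv' := mem_elig.2 hv
  have hke : ∀ κ : Core n, (pv .k).eval (κ.look env v) = k := fun κ => henv
  refine .ite (.gate1 ?_) (.seq (Q := fun κ => (P κ ∧ ∃ a c, (∀ v, c v qS = false) ∧
      IsCat (elig st) a c (Function.update (catAmp k D c) v fun β r₀ r₁ =>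
        if r₀ = β ∧ r₁ = β then 1 else 0) κ.ψ) ∧ ¬Even (k : ℤ)) (.xor ?_) (.gate2 ?_ ?_))
  · rintro κ ⟨⟨h1, a, c, h2, h3⟩, h4⟩
    have he : Even (k : ℤ) := by rw [← hke κ]; exact h4
    refine ⟨hP _ _ h1, a, c, h2, ?_⟩
    rw [hke]
    refine (h3.gate1 hv' (UMat k)).congr fun u hu => ?_
    by_cases huv : u = v
    · subst huv
      rw [catAmp_self]
      funext β r₀ r₁
      simp only [Function.update_self, finalAmp, he, if_true]
      cases β <;> cases r₁ <;> simp
    · rw [Function.update_of_ne huv, Function.update_of_ne huv, catAmp_insert huv]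
  · rintro κ ⟨⟨h1, a, c, h2, h3⟩, h4⟩
    have he : ¬Even (k : ℤ) := by rw [← hke κ]; exact h4
    refine ⟨⟨hP _ _ h1, a, c, h2, (h3.cnot hv').congr fun u hu => ?_⟩, he⟩
    by_cases huv : u = v
    · subst huv
      funext β r₀ r₁
      simp only [Function.update_self]
      cases β <;> cases r₀ <;> cases r₁ <;> simp
    · rw [Function.update_of_ne huv, Function.update_of_ne huv, Function.update_of_ne huv]
  · intro κ _
    simp [R0, R1, QRef.eval]
  · rintro κ ⟨⟨h1, a, c, h2, h3⟩, he⟩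
    refine ⟨hP _ _ h1, a, c, h2, ?_⟩
    rw [hke]
    -- An odd `k ≥ 2` is at least 3, which is where `Vgate` is the matrix `V_k`.
    have hk3 : (3 : ℤ) ≤ k := by
      have : k ≠ 2 := by rintro rfl; exact he (by decide)
      omega
    rw [Vgate, dif_pos hk3]
    refine (h3.gate2 hv' (VMat k)).congr fun u hu => ?_
    by_cases huv : u = v
    · subst huv
      rw [catAmp_self]
      funext β r₀ r₁
      simp only [Function.update_self, finalAmp, he, if_false]
      cases β <;> simp
    · rw [Function.update_of_ne huv, Function.update_of_ne huv, catAmp_insert huv]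

/-- The basis states of positive amplitude agree up to the contents of `R0` and `R1`, and these are
not the same for all the eligible parties if there are `k` of them. -/
def Broken (k : ℕ) (st : Fin n → ℤ) (ψ : Conf n →₀ ℂ) : Prop :=
  ∃ c, ∀ c', ψ c' ≠ 0 → AgreeR (elig st) c c' ∧ ((elig st).card = k →
    ¬∃ r₀ r₁, ∀ v ∈ elig st, c' v qR0 = r₀ ∧ c' v qR1 = r₁)

/-- If the `k` eligible parties all hold the same pair, each of the two products is a `k`-th power,
and `sum_finalAmp_pow` makes the amplitude vanish. -/
lemma ConsistentState.broken {k : ℕ} {ψ : Conf n →₀ ℂ} (hk : 2 ≤ k)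
    (h : ConsistentState k st Finset.univ ψ) : Broken k st ψ := by
  classical
  obtain ⟨a, c, -, h⟩ := h
  refine ⟨c, fun c' h0 => ⟨?_, ?_⟩⟩
  · by_contra hA
    exact h0 ((h c').trans (if_neg hA))
  · rintro hcard ⟨r₀, r₁, hr⟩
    refine h0 ((h c').trans ?_)
    have : ∀ β, ∏ v ∈ elig st, catAmp k Finset.univ c v β (c' v qR0) (c' v qR1) =
        finalAmp k β r₀ r₁ ^ k := by
      intro β
      rw [← hcard, ← Finset.prod_const]
      refine Finset.prod_congr rfl fun v hv => ?_
      rw [(hr v hv).1, (hr v hv).2, hcard]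
      simp [catAmp]
    simp only [this]
    rw [sum_finalAmp_pow hk, mul_zero, ite_self]

lemma InconsistentState.broken {ψ : Conf n →₀ ℂ} (k : ℕ) (h : InconsistentState st ψ) :
    Broken k st ψ := by
  obtain ⟨c, -, h⟩ := h
  refine ⟨c, fun c' h0 => ⟨(h c' h0).1, ?_⟩⟩
  rintro - ⟨r₀, r₁, hr⟩
  obtain ⟨u, hu, hu'⟩ := (h c' h0).2 (!r₀)
  rw [(hr u (mem_elig.2 hu)).1] at hu'
  cases r₀ <;> simp at hu'

theorem triple_checkPhase {k : ℕ} (hk : 2 ≤ k) (henv : env .k = k) (hE : (elig st).Nonempty) :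
    Prog.Triple G σ env (fun κ => KnowsStatus G st κ ∧ Marked st κ) (.loc checkPhase)
      (fun κ => KnowsStatus G st κ ∧ Broken k st κ.ψ) := by
  have hn : (Finset.univ : Finset (Fin n)) ≠ ∅ := by
    obtain ⟨v, -⟩ := hE
    exact Finset.ne_empty_of_mem (Finset.mem_univ v)
  -- The first party finds the unmeasured marked state, the later ones a state of known type; after
  -- any party has acted, only the latter remains.
  have key : ∀ D v, v ∉ D → Cmd.Triple env v
      (fun κ => KnowsStatus G st κ ∧ CheckState k st D κ) checkPhase
      (fun κ => KnowsStatus G st κ ∧ (ConsistentState k st (insert v D) κ.ψ ∨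
        InconsistentState st κ.ψ)) := by
    intro D v hv
    have hB : Cmd.Triple env v (fun κ => (KnowsStatus G st κ ∧ ConsistentState k st D κ.ψ) ∧
        eligible.holds (κ.look env v)) (.seq (.prep R1) subB)
        (fun κ => KnowsStatus G st κ ∧ ConsistentState k st (insert v D) κ.ψ) := by
      by_cases hst : st v = 1
      · refine .seq (.prep ?_) (triple_subB hk henv hst (KnowsStatus G st) fun κ ψ h => h)
        rintro κ b ⟨⟨h1, a, c, hS, h2⟩, -⟩ h0
        exact ⟨h1, a, c, hS, h2.reset_fresh (mem_elig.2 hst) hv h0⟩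
      · rintro s ⟨⟨h1, -⟩, h2⟩
        exact (hst ((h1 v).2.symm.trans h2)).elim
    refine .seq (Q := fun κ => KnowsStatus G st κ ∧ (κ.mem v .s = 0 ∧ ConsistentState k st D κ.ψ ∨
      κ.mem v .s = 1 ∧ InconsistentState st κ.ψ)) (.measure ?_) (.ite (.pre (.ite (hB.post
        fun κ h => ⟨h.1, .inl h.2⟩) (.skip ?_)) ?_) (.prep ?_))
    · rintro κ b ⟨h1, h2⟩ h0
      refine ⟨h1.setVar v _ (by simp) (by simp), ?_⟩
      rcases h2.project hE h0 with ⟨rfl, h⟩ | ⟨rfl, h⟩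
      · exact .inl ⟨by simp [Core.setVar_mem], h⟩
      · exact .inr ⟨by simp [Core.setVar_mem], h⟩
    · rintro κ ⟨⟨h1, a, c, hS, h2⟩, h3⟩
      refine ⟨h1, .inl ⟨a, c, hS, h2.congr fun u hu => ?_⟩⟩
      rw [catAmp_insert]
      rintro rfl
      exact h3 ((h1 u).2.trans (mem_elig.1 hu))
    · rintro κ ⟨⟨h1, ⟨-, h2⟩ | ⟨h2, -⟩⟩, h3⟩
      · exact ⟨h1, h2⟩
      · have h3' : κ.mem v .s = 0 := h3
        omega
    · rintro κ b ⟨⟨h1, ⟨h2, -⟩ | ⟨-, h2⟩⟩, h3⟩ h0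
      · exact (h3 h2).elim
      · exact ⟨h1, .inr (h2.reset v b)⟩
  refine (Prog.Triple.loc (fun D κ => KnowsStatus G st κ ∧ CheckState k st D κ)
    fun D v hv => (key D v hv).post fun κ h => ⟨h.1, .inr h.2⟩).conseq
    (fun κ h => ⟨h.1, .inl ⟨rfl, h.2⟩⟩) fun κ h => ⟨h.1, ?_⟩
  rcases h.2 with ⟨h, -⟩ | h | h
  · exact (hn h).elim
  · exact h.broken hk
  · exact h.broken k

end SubroutineB


/-! ### Measurement of the qubits `R0` and `R1` -/

section Measurement

variable {n : ℕ} {G : SimpleGraph (Fin n)} [DecidableRel G.Adj] (σ : PortNumbering G)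
  {st : Fin n → ℤ} {env : PVar → ℤ}

open AlgI

/-- A bit as an integer. -/
def bitVal (b : Bool) : ℤ := if b then 1 else 0

/-- The parties in `D` hold in `z` the result of their measurement. -/
def Reads (st : Fin n → ℤ) (D : Finset (Fin n)) (κ : Core n) : Prop :=
  ∀ v ∈ D, (st v = 1 → ∀ c, κ.ψ c ≠ 0 → κ.mem v .z = 2 * bitVal (c v qR0) + bitVal (c v qR1)) ∧
    (st v ≠ 1 → κ.mem v .z = -1)

lemma project_apply_ne_zero {v : Fin n} {q : Qubit} {b : Bool} {ψ : Conf n →₀ ℂ} {c : Conf n}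
    (h : project v q b ψ c ≠ 0) : c v q = b ∧ ψ c ≠ 0 := by
  rw [project_apply] at h
  split_ifs at h with hc
  · exact ⟨hc, h⟩
  · exact (h rfl).elim

/-- The states that occur during the measurement. -/
def MeasState (G : SimpleGraph (Fin n)) [DecidableRel G.Adj] (k : ℕ) (st : Fin n → ℤ)
    (D : Finset (Fin n)) (κ : Core n) : Prop :=
  KnowsStatus G st κ ∧ Broken k st κ.ψ ∧ Reads st D κ

lemma MeasState.measure {k : ℕ} {D : Finset (Fin n)} {κ : Core n} (h : MeasState G k st D κ)
    (v : Fin n) (q : Qubit) (b : Bool) {x : CVar} (a : ℤ) (hd : x ≠ .d) (hs : x ≠ .status)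
    (hz : x ≠ .z) : MeasState G k st D ⟨project v q b κ.ψ, (κ.setVar v x a).mem, κ.inbox⟩ := by
  obtain ⟨h1, ⟨c, h2⟩, h3⟩ := h
  refine ⟨h1.setVar v a hd hs, ⟨c, fun c' h0 => h2 c' (project_apply_ne_zero h0).2⟩,
    fun u hu => ?_⟩
  rw [Core.setVar_mem, if_neg fun h => hz h.2.symm]
  exact ⟨fun hst c' h0 => (h3 u hu).1 hst c' (project_apply_ne_zero h0).2, (h3 u hu).2⟩

lemma MeasState.insert {k : ℕ} {D : Finset (Fin n)} {κ : Core n} (h : MeasState G k st D κ)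
    {v : Fin n} (hv : v ∉ D) {a : ℤ} (ha : (st v = 1 → ∀ c, κ.ψ c ≠ 0 →
      a = 2 * bitVal (c v qR0) + bitVal (c v qR1)) ∧ (st v ≠ 1 → a = -1)) :
    MeasState G k st (insert v D) (κ.setVar v .z a) := by
  refine ⟨h.1.setVar v a (by simp) (by simp), h.2.1, fun u hu => ?_⟩
  rw [Core.setVar_mem]
  rcases Finset.mem_insert.1 hu with rfl | hu'
  · rw [if_pos ⟨rfl, rfl⟩]
    exact ha
  · rw [if_neg]
    · exact h.2.2 u hu'
    · rintro ⟨rfl, -⟩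
      exact hv hu'

lemma triple_measPhase_aux {k : ℕ} : Prog.Triple G σ env (MeasState G k st ∅) (.loc measPhase)
    (MeasState G k st Finset.univ) := by
  refine .loc (MeasState G k st) fun D v hv => .ite (.seq (Q := fun κ => (MeasState G k st D κ ∧
    st v = 1) ∧ ∀ c, κ.ψ c ≠ 0 → κ.mem v .b0 = bitVal (c v qR0)) (.measure ?_)
    (.seq (Q := fun κ => ((MeasState G k st D κ ∧ st v = 1) ∧
      ∀ c, κ.ψ c ≠ 0 → κ.mem v .b0 = bitVal (c v qR0)) ∧
      ∀ c, κ.ψ c ≠ 0 → κ.mem v .b1 = bitVal (c v qR1)) (.measure ?_) (.assign ?_))) (.assign ?_)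
  · rintro κ b ⟨h1, h2⟩ -
    refine ⟨⟨h1.measure v _ b _ (by simp) (by simp) (by simp), (h1.1 v).2.symm.trans h2⟩,
      fun c h0 => ?_⟩
    rw [Core.setVar_mem, if_pos ⟨rfl, rfl⟩, ← (project_apply_ne_zero h0).1]
    rfl
  · rintro κ b ⟨⟨h1, h2⟩, h3⟩ -
    refine ⟨⟨⟨h1.measure v _ b _ (by simp) (by simp) (by simp), h2⟩, fun c h0 => ?_⟩,
      fun c h0 => ?_⟩
    · rw [Core.setVar_mem, if_neg (by simp)]
      exact h3 c (project_apply_ne_zero h0).2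
    · rw [Core.setVar_mem, if_pos ⟨rfl, rfl⟩, ← (project_apply_ne_zero h0).1]
      rfl
  · rintro κ ⟨⟨⟨h1, h2⟩, h3⟩, h4⟩
    refine h1.insert hv ⟨fun _ c h0 => ?_, fun h => (h h2).elim⟩
    rw [← h3 c h0, ← h4 c h0, two_mul]
    rfl
  · rintro κ ⟨h1, h2⟩
    exact h1.insert hv ⟨fun h => (h2 ((h1.1 v).2.trans h)).elim, fun _ => rfl⟩

/-- The classical knowledge of the parties after the measurement, which has left the state `ψ`. -/
def KnowsValue (G : SimpleGraph (Fin n)) [DecidableRel G.Adj] (st ζ : Fin n → ℤ)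
    (ψ : Conf n →₀ ℂ) (κ : Core n) : Prop :=
  KnowsStatus G st κ ∧ κ.ψ = ψ ∧ ∀ v, κ.mem v .z = ζ v

/-- What the values measured by the parties satisfy. -/
def ValidValues (k : ℕ) (st ζ : Fin n → ℤ) : Prop :=
  (∀ v, st v = 1 → 0 ≤ ζ v) ∧ (∀ v, st v ≠ 1 → ζ v = -1) ∧
    ((elig st).card = k → ¬∃ a, ∀ v ∈ elig st, ζ v = a)

lemma bitVal_eq {a b a' b' : Bool} (h : 2 * bitVal a + bitVal b = 2 * bitVal a' + bitVal b') :
    a = a' ∧ b = b' := by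
  revert h
  cases a <;> cases b <;> cases a' <;> cases b' <;> simp [bitVal]

/-- The values `z` determine the bits `R0` and `R1` of all eligible parties, and `Broken` fixes the
remaining qubits. So the support has a single element, and the state is a multiple of a basis state
again. -/
theorem triple_measPhase {k : ℕ} : Prog.Triple G σ env
    (fun κ => KnowsStatus G st κ ∧ Broken k st κ.ψ) (.loc measPhase)
    (fun κ => ∃ ζ ψ, ValidValues k st ζ ∧ (∃ a c, IsUniform (fun _ => False) a c ψ) ∧
      KnowsValue G st ζ ψ κ) := by
  classical
  intro s hs s' hs' h0
  obtain ⟨h1, ⟨c₀, h2⟩, h3⟩ := triple_measPhase_aux σ s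
    ⟨hs.1, hs.2, fun v hv => (Finset.notMem_empty v hv).elim⟩ s' hs' h0
  obtain ⟨c, hc⟩ := Finsupp.ne_iff.1 h0
  have hz : ∀ v ∈ elig st, s'.core.mem v .z = 2 * bitVal (c v qR0) + bitVal (c v qR1) :=
    fun v hv => (h3 v (Finset.mem_univ v)).1 (mem_elig.1 hv) c hc
  refine ⟨fun v => s'.core.mem v .z, s'.core.ψ, ⟨fun v hv => ?_,
    fun v => (h3 v (Finset.mem_univ v)).2, ?_⟩, ⟨s'.ψ c, c, fun c' => ?_⟩, h1, rfl, fun _ => rfl⟩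
  · refine le_of_le_of_eq ?_ (hz v (mem_elig.2 hv)).symm
    unfold bitVal
    split_ifs <;> norm_num
  · rintro hk ⟨a, ha⟩
    -- Without eligible parties, `Broken` with `card = k` would be contradictory, because any pair
    -- is then vacuously common to all.
    have hne : (elig st).Nonempty := by
      by_contra hne
      rw [Finset.not_nonempty_iff_eq_empty] at hne
      exact (h2 c hc).2 hk ⟨false, false, by simp [hne]⟩
    obtain ⟨u, hu⟩ := hne
    refine (h2 c hc).2 hk ⟨c u qR0, c u qR1, fun v hv => bitVal_eq ?_⟩
    rw [← hz v hv, ← hz u hu]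
    exact (ha v hv).trans (ha u hu).symm
  · change s'.ψ c' = _
    have key : s'.ψ c' ≠ 0 → c' = c := by
      intro hc'
      funext v q
      by_cases hq : v ∈ elig st ∧ (q = qR0 ∨ q = qR1)
      · have := bitVal_eq (((h3 v (Finset.mem_univ v)).1 (mem_elig.1 hq.1) c' hc').symm.trans
          (hz v hq.1))
        rcases hq.2 with rfl | rfl
        · exact this.1
        · exact this.2
      · rw [(h2 c' hc').1 v q hq, (h2 c hc).1 v q hq]
    split_ifs with hA
    · rw [show c' = c from funext fun v => funext fun q => hA v q (by simp)]
    · by_contra hc'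
      exact hA (by rw [key hc']; exact fun _ _ _ => rfl)

end Measurement

/-! ### Subroutine C -/

section SubroutineC

variable {n : ℕ} {G : SimpleGraph (Fin n)} [DecidableRel G.Adj] (σ : PortNumbering G)
  {st ζ : Fin n → ℤ} {ψ : Conf n →₀ ℂ} {env : PVar → ℤ}

open AlgI

lemma KnowsValue.setVar {κ : Core n} (h : KnowsValue G st ζ ψ κ) (v : Fin n)
    {x : CVar} (a : ℤ) (hd : x ≠ .d) (hs : x ≠ .status) (hz : x ≠ .z) :
    KnowsValue G st ζ ψ (κ.setVar v x a) := by
  refine ⟨h.1.setVar v a hd hs, h.2.1, fun u => ?_⟩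
  rw [Core.setVar_mem, if_neg fun h => hz h.2.symm]
  exact h.2.2 u

/-- After `j` rounds, `v` knows that some value is at least `a`. -/
def KnowsBound (G : SimpleGraph (Fin n)) (ζ : Fin n → ℤ) (a : ℤ) : ℕ → Fin n → Prop
  | 0, v => a ≤ ζ v
  | j + 1, v => KnowsBound G ζ a j v ∨ ∃ u, G.Adj v u ∧ KnowsBound G ζ a j u

/-- The messages at the ports are the values of `zmax` after `j` rounds. -/
def InboxMax (ζ : Fin n → ℤ) (j : ℕ) (κ : Core n) : Prop :=
  ∀ v i u i', remote G σ v i = some (u, i') → ∀ a, a ≤ κ.inbox v i ↔ KnowsBound G ζ a j u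

/-- The value of `zmax` is described by the thresholds `a` below it, so that taking a maximum
becomes a disjunction. After `m` iterations the messages at the ports up to `m` are included.
Messages were fixed by the exchange, so it does not matter that some parties have already updated.
-/
lemma triple_updateMax (j : ℕ) (D : Finset (Fin n)) {v : Fin n} (hv : v ∉ D) :
    Cmd.Triple env v (fun κ => (KnowsValue G st ζ ψ κ ∧ InboxMax σ ζ j κ) ∧
        ∀ u a, a ≤ κ.mem u .zmax ↔ KnowsBound G ζ a (if u ∈ D then j + 1 else j) u)
      (.forUp .i (num 1) dd (.seq (.recv .y ii) (.assign .zmax (.max (cv .zmax) (cv .y)))))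
      (fun κ => (KnowsValue G st ζ ψ κ ∧ InboxMax σ ζ j κ) ∧
        ∀ u a, a ≤ κ.mem u .zmax ↔ KnowsBound G ζ a (if u ∈ insert v D then j + 1 else j) u) := by
  refine (Cmd.Triple.forUp 1 (G.degree v) (fun m κ => (KnowsValue G st ζ ψ κ ∧ InboxMax σ ζ j κ) ∧
    (∀ u ≠ v, ∀ a, a ≤ κ.mem u .zmax ↔ KnowsBound G ζ a (if u ∈ D then j + 1 else j) u) ∧
    ∀ a, a ≤ κ.mem v .zmax ↔ KnowsBound G ζ a j v ∨ ∃ i : ℤ, i ≤ m ∧ ∃ u i',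
      remote G σ v i = some (u, i') ∧ KnowsBound G ζ a j u)
    (fun m κ b h => ?_) (fun m hm => .seq (Q := fun κ => ((KnowsValue G st ζ ψ κ ∧
      InboxMax σ ζ j κ) ∧
    (∀ u ≠ v, ∀ a, a ≤ κ.mem u .zmax ↔ KnowsBound G ζ a (if u ∈ D then j + 1 else j) u) ∧
    ∀ a, a ≤ κ.mem v .zmax ↔ KnowsBound G ζ a j v ∨ ∃ i : ℤ, i ≤ m ∧ ∃ u i',
      remote G σ v i = some (u, i') ∧ KnowsBound G ζ a j u) ∧
      κ.mem v .y = κ.inbox v (1 + m)) (.recv ?_) (.assign ?_)) fun κ h => ?_).post fun κ h => ?_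
  · refine ⟨⟨h.1.1.setVar v b (by simp) (by simp) (by simp), h.1.2⟩, ?_⟩
    simpa [Core.setVar_mem] using h.2
  · rintro κ ⟨h, hi⟩
    refine ⟨⟨⟨h.1.1.setVar v _ (by simp) (by simp) (by simp), h.1.2⟩, ?_⟩, ?_⟩
    · simpa [Core.setVar_mem] using h.2
    · rw [Core.setVar_mem, if_pos ⟨rfl, rfl⟩, ← hi]
      rfl
  · rintro κ ⟨⟨⟨h1, h2⟩, h3, h4⟩, h5⟩
    refine ⟨⟨h1.setVar v _ (by simp) (by simp) (by simp), h2⟩, fun u hu a => ?_, fun a => ?_⟩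
    · rw [Core.setVar_mem, if_neg fun h => hu h.1]
      exact h3 u hu a
    · rw [Core.setVar_mem, if_pos ⟨rfl, rfl⟩]
      change a ≤ max (κ.mem v .zmax) (κ.mem v .y) ↔ _
      obtain ⟨u, i', hr⟩ := remote_isSome G σ (v := v) (i := 1 + m) ⟨by omega, hm⟩
      rw [le_max_iff, h4, h5, h2 v _ u i' hr a, or_assoc]
      refine or_congr Iff.rfl ⟨?_, ?_⟩
      · rintro (⟨i, hi, h⟩ | h)
        · exact ⟨i, by push_cast; omega, h⟩
        · exact ⟨1 + m, by push_cast; omega, u, i', hr, h⟩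
      · rintro ⟨i, hi, w, i'', hr', h⟩
        push_cast at hi
        by_cases him : i ≤ m
        · exact .inl ⟨i, him, w, i'', hr', h⟩
        · obtain rfl : i = 1 + m := by omega
          rw [hr, Option.some.injEq, Prod.mk.injEq] at hr'
          obtain ⟨rfl, -⟩ := hr'
          exact .inr h
  · obtain ⟨h1, h2⟩ := h
    refine ⟨rfl, (h1.1.1 v).1, h1, fun u _ a => h2 u a, fun a => ?_⟩
    rw [h2 v a, if_neg hv, or_iff_left]
    rintro ⟨i, hi, u, i', hr, -⟩
    have := remote_port G σ hr
    push_cast at hi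
    omega
  · obtain ⟨h1, h2, h3⟩ := h
    refine ⟨h1, fun u a => ?_⟩
    by_cases hu : u = v
    · subst hu
      rw [h3 a, if_pos (Finset.mem_insert_self u D), KnowsBound]
      refine or_congr Iff.rfl ⟨?_, ?_⟩
      · rintro ⟨i, -, w, i', hr, h⟩
        exact ⟨w, (remote_eq_some G σ hr).1, h⟩
      · rintro ⟨w, hw, h⟩
        obtain ⟨i, i', hr⟩ := exists_port G σ hw
        have := remote_port G σ hr
        exact ⟨i, by omega, w, i', hr, h⟩
    · simpa [hu] using h2 u hu a

/-- For each threshold `a`, the knowledge that some value is at least `a` spreads as in `spread`, so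
the search for a maximum is reduced to the same Boolean flooding as in Subroutine A. -/
theorem triple_subC {N : ℕ} (hG : G.Connected) (hN : n ≤ N) (henv : env .N = N) {M : ℤ}
    (hM : ∃ u, ζ u = M) (hM' : ∀ u, ζ u ≤ M) :
    Prog.Triple G σ env (KnowsValue G st ζ ψ) subC
      (fun κ => KnowsValue G st ζ ψ κ ∧ ∀ v, κ.mem v .zmax = M) := by
  refine .seq (Q := fun κ => KnowsValue G st ζ ψ κ ∧
    ∀ v a, a ≤ κ.mem v .zmax ↔ KnowsBound G ζ a 0 v) ?_ ((Prog.Triple.forUp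
    (fun j κ => KnowsValue G st ζ ψ κ ∧ ∀ v a, a ≤ κ.mem v .zmax ↔ KnowsBound G ζ a j v)
      fun j hj => .seq (Q := fun κ => (KnowsValue G st ζ ψ κ ∧ InboxMax σ ζ j κ) ∧
        ∀ v a, a ≤ κ.mem v .zmax ↔ KnowsBound G ζ a j v) (.exchC ?_)
        ((Prog.Triple.loc (fun D κ => (KnowsValue G st ζ ψ κ ∧ InboxMax σ ζ j κ) ∧
          ∀ u a, a ≤ κ.mem u .zmax ↔ KnowsBound G ζ a (if u ∈ D then j + 1 else j) u)
          fun D v hv => triple_updateMax σ j D hv).conseq ?_ ?_)).post ?_)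
  · refine (Prog.Triple.loc (fun D κ => KnowsValue G st ζ ψ κ ∧
      ∀ v ∈ D, κ.mem v .zmax = ζ v) fun D v hv => .assign ?_).conseq
      (fun κ h => ⟨h, by simp⟩) fun κ h => ⟨h.1, fun v a => ?_⟩
    · rintro κ ⟨h1, h2⟩
      refine ⟨h1.setVar v _ (by simp) (by simp) (by simp), fun u hu => ?_⟩
      rw [Core.setVar_mem]
      split_ifs with huv
      · rw [huv.1]
        exact h1.2.2 v
      · exact h2 u ((Finset.mem_insert.1 hu).resolve_left fun h => huv ⟨h, rfl⟩)
    · rw [h.2 v (Finset.mem_univ v)]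
      exact Iff.rfl
  · rintro κ ⟨h1, h2⟩
    refine ⟨⟨h1, fun v i u i' hr a => ?_⟩, h2⟩
    simp only [hr]
    exact h2 u a
  · simp
  · simp only [Finset.mem_univ, if_true]
    exact fun κ h => ⟨h.1.1, h.2⟩
  · rintro κ ⟨h1, h2⟩
    refine ⟨h1, fun v => ?_⟩
    have hj : (pN1.eval env - (Expr.lit 1).eval env + 1).toNat = N - 1 := by
      simp only [pN1, Expr.eval, henv]
      omega
    rw [hj] at h2
    have h3 : ∀ a, a ≤ κ.mem v .zmax ↔ ∃ u, a ≤ ζ u := fun a =>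
      (h2 v a).trans (spread hG hN (P := KnowsBound G ζ a) (fun _ _ _ => Iff.rfl) v)
    -- The threshold `zmax` itself gives `zmax ≤ M`, and the threshold `M` gives the converse.
    obtain ⟨u, hu⟩ := (h3 _).1 le_rfl
    obtain ⟨w, hw⟩ := hM
    exact le_antisymm (hu.trans (hM' u)) ((h3 M).2 ⟨w, hw.ge⟩)

end SubroutineC

/-! ### Algorithm I -/

section AlgorithmI

variable {n : ℕ} {G : SimpleGraph (Fin n)} [DecidableRel G.Adj] (σ : PortNumbering G)
  {env : PVar → ℤ}

open AlgI

/-- Before the phase with parameter `k`, between one and `k` parties are eligible, and the qubits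
are in a computational basis state. -/
def PhaseState (G : SimpleGraph (Fin n)) [DecidableRel G.Adj] (k : ℕ) (κ : Core n) : Prop :=
  ∃ st, (∀ v, st v = 0 ∨ st v = 1) ∧ (elig st).Nonempty ∧ (elig st).card ≤ k ∧
    Prepared G st (fun _ => False) (fun _ _ => False) κ

lemma triple_dropPhase {st ζ : Fin n → ℤ} {ψ : Conf n →₀ ℂ} {M : ℤ} :
    Prog.Triple G σ env (fun κ => KnowsValue G st ζ ψ κ ∧ ∀ v, κ.mem v .zmax = M) (.loc dropPhase)
      (fun κ => KnowsStatus G (fun v => if ζ v = M then st v else 0) κ ∧ κ.ψ = ψ) := by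
  refine (Prog.Triple.loc (fun D κ => (KnowsStatus G (fun v => if v ∈ D ∧ ζ v ≠ M then 0 else st v)
    κ ∧ κ.ψ = ψ) ∧ ∀ v, κ.mem v .z = ζ v ∧ κ.mem v .zmax = M) fun D v hv =>
    .ite (.skip ?_) (.assign ?_)).conseq (fun κ h => ?_) fun κ h => ⟨?_, h.1.2⟩
  · rintro κ ⟨⟨⟨h1, h2⟩, h3⟩, h4⟩
    have hz : ζ v = M := (h3 v).1.symm.trans (Eq.trans h4 (h3 v).2)
    refine ⟨⟨fun u => ⟨(h1 u).1, (h1 u).2.trans ?_⟩, h2⟩, h3⟩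
    by_cases hu : u = v
    · subst hu; simp [hz]
    · simp [hu]
  · rintro κ ⟨⟨⟨h1, h2⟩, h3⟩, h4⟩
    have hz : ζ v ≠ M := fun hz => h4 ((h3 v).1.trans (hz.trans (h3 v).2.symm))
    refine ⟨⟨fun u => ⟨?_, ?_⟩, h2⟩, fun u => ?_⟩
    · simpa [Core.setVar_mem] using (h1 u).1
    · rw [Core.setVar_mem]
      by_cases hu : u = v
      · subst hu; simp [hz]; rfl
      · simpa [hu] using (h1 u).2
    · simpa [Core.setVar_mem] using h3 u
  · simpa [h.2, h.1.2.2] using ⟨h.1.1, h.1.2.1⟩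
  · convert h.1.1 using 2
    simp

/-- The party `m` with the largest value shows that somebody stays eligible. The bound `k - 1` needs
an argument only if there are `k` eligible parties, in which case their values are not all equal. -/
theorem triple_phase {N k : ℕ} (hG : G.Connected) (hN : n ≤ N) (hk : 2 ≤ k) (henv : env .N = N)
    (henv' : env .k = k) :
    Prog.Triple G σ env (PhaseState G k) phase (PhaseState G (k - 1)) := by
  rintro s ⟨st, hst, hE, hcard, hs⟩
  refine ((triple_prepPhase σ).seq ((triple_subA σ hG hN henv).seq
    ((triple_checkPhase σ hk henv' hE).seq ((triple_measPhase σ).seq ?_)))) s hs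
  rintro s ⟨ζ, ψ, ⟨hζ, hζ', hζk⟩, ⟨a, c, hψ⟩, hs⟩
  obtain ⟨v₀, hv₀⟩ := hE
  obtain ⟨m, -, hm⟩ := Finset.exists_max_image Finset.univ ζ ⟨v₀, Finset.mem_univ _⟩
  refine ((triple_subC σ hG hN henv ⟨m, rfl⟩ fun u => hm u (Finset.mem_univ u)).seq
    ((triple_dropPhase σ).post fun κ h => ?_)) s hs
  have hsub : ∀ v, v ∈ elig (fun v => if ζ v = ζ m then st v else 0) ↔
      v ∈ elig st ∧ ζ v = ζ m := by
    intro v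
    rw [mem_elig, mem_elig]
    split_ifs with hv <;> simp [hv]
  refine ⟨_, fun v => ?_, ⟨m, (hsub m).2 ⟨?_, rfl⟩⟩, ?_, h.1, a, c, h.2 ▸ hψ, by simp⟩
  · split_ifs
    · exact hst v
    · exact .inl rfl
  -- An ineligible party has the value `-1`, which is below the nonnegative value of the eligible
  -- party `v₀`.
  · by_contra hm'
    have h1 := hζ' m fun h => hm' (mem_elig.2 h)
    have h2 := hm v₀ (Finset.mem_univ _)
    have h3 := hζ v₀ (mem_elig.1 hv₀)
    omega
  · have hle : elig (fun v => if ζ v = ζ m then st v else 0) ⊆ elig st :=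
      fun v hv => ((hsub v).1 hv).1
    by_cases hc : (elig st).card = k
    · have : ∃ v ∈ elig st, ζ v ≠ ζ m := by
        by_contra! h
        exact hζk hc ⟨_, h⟩
      obtain ⟨v, hv, hv'⟩ := this
      have := Finset.card_lt_card (Finset.ssubset_iff_of_subset hle |>.2
        ⟨v, hv, fun h => hv' ((hsub v).1 h).2⟩)
      omega
    · have := Finset.card_le_card hle
      omega

lemma phaseState_initState {N : ℕ} (hG : G.Connected) (hN : n ≤ N) :
    PhaseState G N (initState G).core := by
  classical
  have hE : elig (fun _ : Fin n => 1) = Finset.univ := by simp [elig]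
  have := hG.nonempty
  refine ⟨fun _ => 1, fun _ => .inr rfl, hE ▸ Finset.univ_nonempty, by simpa [hE] using hN,
    fun v => ⟨rfl, rfl⟩, 1, fun _ _ => false, fun c => ?_, by simp⟩
  change Finsupp.single _ _ c = _
  rw [Finsupp.single_apply]
  refine if_congr ⟨?_, fun h => ?_⟩ rfl rfl
  · rintro rfl _ _ _; rfl
  · funext v q
    exact (h v q (by simp)).symm

theorem triple_algorithmI {N : ℕ} (hG : G.Connected) (hN : n ≤ N) (henv : env .N = N) :
    Prog.Triple G σ env (PhaseState G N) algorithmI (PhaseState G 1) := by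
  have hN1 : 1 ≤ N := by
    obtain ⟨v⟩ := hG.nonempty
    exact (Nat.one_le_iff_ne_zero.2 fun h => by subst h; exact v.elim0).trans hN
  refine .seq (Q := PhaseState G N) ?_ ((Prog.Triple.forDown (fun j => PhaseState G (N - j))
    fun j hj => ?_).post fun κ h => ?_)
  · rintro s ⟨st, h1, h2, h3, h4⟩ s' hs' h0
    refine ⟨st, h1, h2, h3, ?_⟩
    refine Prog.Triple.loc (fun _ => Prepared G st (fun _ => False) fun _ _ => False)
      (fun D v hv => ?_) s h4 s' hs' h0
    have key : ∀ q, Cmd.Triple env v (Prepared G st (fun _ => False) fun _ _ => False) (.prep q)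
        (Prepared G st (fun _ => False) fun _ _ => False) := by
      intro q
      refine .prep ?_
      rintro κ b ⟨g1, a, c, g2, -⟩ g0
      exact ⟨g1, a, _, g2.reset (by simp) g0, by simp⟩
    exact (key _).seq ((key _).seq (key _))
  · simp only [Expr.eval, henv] at hj ⊢
    have := triple_phase σ (k := N - j) (env := Function.update env .k ((N : ℤ) - j)) hG hN
      (by omega) (by simp [henv]) (by simp; omega)
    rwa [Nat.sub_sub] at this
  -- The loop runs `N - 1` times, which is 0 for `N = 1`; so the final parameter is 1 in every case.
  · simp only [Expr.eval, henv] at h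
    convert h using 1
    omega

lemma PhaseState.uniqueLeader {s : State n} (h : PhaseState G 1 s.core) : UniqueLeader s := by
  obtain ⟨st, h1, ⟨l, hl⟩, h3, h4, -⟩ := h
  refine ⟨l, (h4 l).2.trans (mem_elig.1 hl), fun v hv => (h4 v).2.trans ((h1 v).resolve_right ?_)⟩
  exact fun h => hv (Finset.card_le_one.1 h3 v (mem_elig.2 h) l hl)

theorem algorithmI_uniqueLeader {N : ℕ} (hG : G.Connected) (hN : n ≤ N) {s : State n}
    (hs : s ∈ algorithmI.outcomes G σ N) (h0 : s.ψ ≠ 0) : UniqueLeader s :=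
  (triple_algorithmI σ hG hN rfl _ (phaseState_initState hG hN) s hs h0).uniqueLeader

/-- A branch without a unique leader has amplitude 0 and contributes nothing. Hence the probability
equals the total probability of all branches, which is conserved from its initial value 1. -/
theorem prob_algorithmI {N : ℕ} (hG : G.Connected) (hN : n ≤ N) :
    prob (algorithmI.outcomes G σ N) UniqueLeader = 1 := by
  have h : prob (algorithmI.outcomes G σ N) UniqueLeader =
      totalProb (algorithmI.outcomes G σ N) := by
    unfold prob totalProb
    congr 1
    refine List.map_congr_left fun s hs => ?_
    split_ifs with hu
    · rfl
    · by_cases h0 : s.ψ = 0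
      · rw [h0, normSq_zero]
      · exact (hu (algorithmI_uniqueLeader σ hG hN hs h0)).elim
  rw [h, Prog.outcomes, totalProb_run]
  simp [initState, normSq]

end AlgorithmI

end QLE

theorem corollary3 :
    ∃ C : ℕ, ∀ (n N : ℕ) (G : SimpleGraph (Fin n)) [DecidableRel G.Adj]
      (σ : QLE.PortNumbering G), G.Connected → n ≤ N →
      QLE.prob (QLE.algorithmI.outcomes G σ N) QLE.UniqueLeader = 1 ∧
      ∀ s ∈ QLE.algorithmI.outcomes G σ N, s.ψ ≠ 0 →
        QLE.UniqueLeader s ∧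
        s.rounds ≤ C * N ^ 2 ∧
        (∀ v, s.steps v ≤ C * (max G.maxDegree 1 * N ^ 2)) ∧
        (∀ v, s.qsent v + s.qrecv v ≤ C * (G.degree v * N ^ 2)) ∧
        ∑ v, (s.qsent v + s.csent v) ≤ C * (G.edgeFinset.card * N ^ 2) := by
  refine ⟨1000, fun n N G _ σ hG hN => ⟨QLE.prob_algorithmI σ hG hN, fun s hs h0 =>
    ⟨QLE.algorithmI_uniqueLeader σ hG hN hs h0, QLE.algorithmI_resources σ N ?_ s hs⟩⟩⟩
  -- A connected graph has a vertex, so `1 ≤ n ≤ N`.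
  obtain ⟨v⟩ := hG.nonempty
  exact v.pos.trans_le hN
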